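/- **Setting.** There are $n$ players. Player $i$ has a compact convex action set $\mathcal X_i\subseteq\mathbb R^d$ ($d\ge 1$) with nonempty interior and diameter at most $B$, and a continuous cost $c_i:\prod_j\mathcal X_j\to[0,1]$ which, in the player's own action $x_i$, is differentiable, convex and $\ell_i$-smooth (its gradient $\nabla_i c_i$ is $\ell_i$-Lipschitz in $x_i$), with $\|\nabla_i c_i\|\le G$. The operator $F=(\nabla_i c_i)_i$ is monotone: $\langle F(x)-F(y),x-y\rangle\ge 0$ for all $x,y$. Let $\mathrm{SW}(x)=\sum_i c_i(x)$ and $\mathrm{OPT}=\min_x \mathrm{SW}(x)$ over $\prod_j\mathcal X_j$. The game is $(C_1,C_2)$-smooth: $C_1>0$, $C_2<1$, and for some joint action $x'$, $\sum_i c_i(x_i',x_{-i})\le C_1\mathrm{OPT}+C_2\,\mathrm{SW}(x)$ for every joint action $x$. **Regularizers.** For each $i$, $h_i$ is a $\nu$-self-concordant barrier for $\mathcal X_i$: convex and $C^3$ on $\operatorname{int}\mathcal X_i$, tending to $\infty$ at the boundary, with $|\nabla^3h_i(x)[v,v,v]|\le 2(v^\top\nabla^2h_i(x)v)^{3/2}$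 and $|\nabla h_i(x)^\top v|\le\sqrt\nu\,(v^\top\nabla^2h_i(x)v)^{1/2}$. Further, $p_i$ is $C^2$ near $\mathcal X_i$ with $\mu I\preceq\nabla^2p_i\preceq\zeta I$ on $\mathcal X_i$ ($\mu\ge0$, $\zeta>0$), its Bregman divergence satisfies $D_{p_i}\le C_p<\infty$ on $\mathcal X_i$, and for some $\kappa>0$ the function $c_i(x_i,x_{-i})-\kappa p_i(x_i)$ is convex in $x_i$. Here $D_f(y,x)=f(y)-f(x)-\langle\nabla f(x),y-x\rangle$. **Algorithm.** Put $\eta_t=\frac1{2d\,t^{3/4}}$ and $\delta_t=t^{-1/4}$. Every player starts at $x_i^1=\arg\min_{\mathcal X_i}h_i$, and in rounds $t=1,2,\dots$ sets $A_i^t=(\nabla^2h_i(x_i^t)+\eta_t(t+1)\nabla^2p_i(x_i^t))^{-1/2}$, plays $\hat x_i^t=x_i^t+\delta_tA_i^tz_i^t$, where the $z_i^t$ are independent (over $i$ and $t$) and uniform on the unit sphere of $\mathbb R^d$, observes $c_i(\hat x^t)$, puts $\hat g_i^t=\frac d{\delta_t}c_i(\hat x^t)(A_i^t)^{-1}z_i^t$,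 and updates $$x_i^{t+1}=\arg\min_{y\in\mathcal X_i}\{\eta_t\langle y,\hat g_i^t\rangle+\eta_t\kappa(t+1)D_{p_i}(y,x_i^t)+D_{h_i}(y,x_i^t)\}$$ (both minimizations with $h_i=+\infty$ on the boundary of $\mathcal X_i$). **Claim.** All the expectations below exist, and $$\frac1T\sum_{t=1}^T\mathbb E[\mathrm{SW}(\hat x^t)]=O\Big(\frac{C_1\,\mathrm{OPT}}{1-C_2}+\frac{n\nu d\log T}{(1-C_2)T^{1/4}}+\frac{\sqrt n\,B\sum_i\ell_i}{(1-C_2)T^{1/4}}\Big)\qquad(T\to\infty)$$ with an absolute implied constant: there is a universal $K>0$ (independent of $n,d$, the game, the regularizers and every parameter above) such that, in every such setting, the left side is at most $K$ times the expression in parentheses for all sufficiently large $T$ (how large may depend on the setting). -/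

import Mathlib

open MeasureTheory ProbabilityTheory

noncomputable section

/-- The action space `ℝ^d` with its Euclidean norm. -/
abbrev Act (d : ℕ) : Type := EuclideanSpace ℝ (Fin d)

/-- An `n`-player game: action sets `X i ⊆ ℝ^d` and cost functions `c i`, of which only the values
on the product of the action sets are ever used. -/
structure Game (n d : ℕ) where
  X : Fin n → Set (Act d)
  c : Fin n → (Fin n → Act d) → ℝ

namespace Game

variable {n d : ℕ}

/-- The joint actions `∏ i, X i`. -/
def profiles (𝒢 : Game n d) : Set (Fin n → Act d) := {x | ∀ i, x i ∈ 𝒢.X i}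

/-- The cost `y ↦ c_i(y, x_{-i})` of player `i` as a function of her own action. -/
def ownCost (𝒢 : Game n d) (i : Fin n) (x : Fin n → Act d) (y : Act d) : ℝ :=
  𝒢.c i (Function.update x i y)

/-- The partial gradient `∇_i c_i(x)`, taken relative to the action set `X i` (so that it is the
usual gradient in the interior and also makes sense on the boundary). -/
def partialGrad (𝒢 : Game n d) (i : Fin n) (x : Fin n → Act d) : Act d :=
  gradientWithin (𝒢.ownCost i x) (𝒢.X i) (x i)

/-- The standing assumptions on the game: compact convex action sets with nonempty interior and
diameter at most `B`; costs in `[0, 1]`, continuous, and, in the player's own action,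
differentiable, convex and `ℓ i`-smooth; gradients bounded by `G`; monotone gradient operator. -/
structure IsMonotoneGame (𝒢 : Game n d) (B G : ℝ) (ℓ : Fin n → ℝ) : Prop where
  convex_set : ∀ i, Convex ℝ (𝒢.X i)
  compact_set : ∀ i, IsCompact (𝒢.X i)
  nonempty_interior : ∀ i, (interior (𝒢.X i)).Nonempty
  diameter : ∀ i, ∀ y ∈ 𝒢.X i, ∀ y' ∈ 𝒢.X i, ‖y - y'‖ ≤ B
  range : ∀ i, ∀ x ∈ 𝒢.profiles, 𝒢.c i x ∈ Set.Icc (0 : ℝ) 1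
  continuous : ∀ i, ContinuousOn (𝒢.c i) 𝒢.profiles
  differentiable : ∀ i, ∀ x ∈ 𝒢.profiles, DifferentiableOn ℝ (𝒢.ownCost i x) (𝒢.X i)
  convex : ∀ i, ∀ x ∈ 𝒢.profiles, ConvexOn ℝ (𝒢.X i) (𝒢.ownCost i x)
  smooth : ∀ i, ∀ x ∈ 𝒢.profiles, ∀ y ∈ 𝒢.X i,
    ‖𝒢.partialGrad i (Function.update x i y) - 𝒢.partialGrad i x‖ ≤ ℓ i * ‖y - x i‖
  bounded_grad : ∀ i, ∀ x ∈ 𝒢.profiles, ‖𝒢.partialGrad i x‖ ≤ G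
  monotone : ∀ x ∈ 𝒢.profiles, ∀ y ∈ 𝒢.profiles,
    0 ≤ ∑ i, inner ℝ (𝒢.partialGrad i x - 𝒢.partialGrad i y) (x i - y i)

/-- The social cost `SW(x) = ∑ i, c_i(x)`. -/
def SW (𝒢 : Game n d) (x : Fin n → Act d) : ℝ := ∑ i, 𝒢.c i x

/-- The optimal social cost `OPT = min_x SW(x)` over the joint actions. -/
def OPT (𝒢 : Game n d) : ℝ := sInf (𝒢.SW '' 𝒢.profiles)

/-- `(C₁, C₂)`-smoothness of a game. -/
def IsSmoothGame (𝒢 : Game n d) (C₁ C₂ : ℝ) : Prop :=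
  0 < C₁ ∧ C₂ < 1 ∧ ∃ x' ∈ 𝒢.profiles, ∀ x ∈ 𝒢.profiles,
    ∑ i, 𝒢.c i (Function.update x i (x' i)) ≤ C₁ * 𝒢.OPT + C₂ * 𝒢.SW x

end Game

section Regularizers

variable {d : ℕ}

/-- The Hessian `∇²f(x)` as a linear operator, `⟪∇²f(x) u, v⟫ = D²f(x)[u, v]`. -/
def hess (f : Act d → ℝ) (x : Act d) : Act d →L[ℝ] Act d := fderiv ℝ (gradient f) x

/-- The Bregman divergence `D_f(y, x) = f(y) - f(x) - ⟪∇f(x), y - x⟫`. -/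
def bregman (f : Act d → ℝ) (y x : Act d) : ℝ := f y - f x - inner ℝ (gradient f x) (y - x)

/-- `h` is a `ν`-self-concordant barrier for the closed convex set `X`. Only the values of `h` on
the interior of `X` matter; `h` is understood to be `+∞` on the boundary. -/
structure IsSelfConcordantBarrier (ν : ℝ) (X : Set (Act d)) (h : Act d → ℝ) : Prop where
  contDiffOn : ContDiffOn ℝ 3 h (interior X)
  barrier : ∀ b ∈ frontier X, Filter.Tendsto h (nhdsWithin b (interior X)) Filter.atTop
  hess_nonneg : ∀ x ∈ interior X, ∀ v, 0 ≤ inner ℝ (hess h x v) v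
  third_deriv : ∀ x ∈ interior X, ∀ v,
    |iteratedFDeriv ℝ 3 h x (fun _ => v)| ≤ 2 * (inner ℝ (hess h x v) v) ^ (3 / 2 : ℝ)
  first_deriv : ∀ x ∈ interior X, ∀ v,
    |inner ℝ (gradient h x) v| ≤ Real.sqrt ν * Real.sqrt (inner ℝ (hess h x v) v)

/-- The conditions on the second regularizer `p i` of every player: `p i` is twice continuously
differentiable with `μ I ≼ ∇²p ≼ ζ I` (hence convex) on `X i`, its Bregman divergence is bounded by
`Cp` on `X i`, and `c_i - κ p_i` is convex in the player's own action. -/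
structure IsRegularizer {n : ℕ} (𝒢 : Game n d) (κ μ ζ Cp : ℝ) (p : Fin n → Act d → ℝ) :
    Prop where
  κ_pos : 0 < κ
  μ_nonneg : 0 ≤ μ
  ζ_pos : 0 < ζ
  contDiffAt : ∀ i, ∀ x ∈ 𝒢.X i, ContDiffAt ℝ 2 (p i) x
  hess_lower : ∀ i, ∀ x ∈ 𝒢.X i, ∀ v, μ * ‖v‖ ^ 2 ≤ inner ℝ (hess (p i) x v) v
  hess_upper : ∀ i, ∀ x ∈ 𝒢.X i, ∀ v, inner ℝ (hess (p i) x v) v ≤ ζ * ‖v‖ ^ 2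
  bregman_le : ∀ i, ∀ y ∈ 𝒢.X i, ∀ x ∈ 𝒢.X i, bregman (p i) y x ≤ Cp
  convex_sub : ∀ i, ∀ x ∈ 𝒢.profiles,
    ConvexOn ℝ (𝒢.X i) (fun y => 𝒢.ownCost i x y - κ * p i y)

end Regularizers

section Algorithm

variable {n d : ℕ}

/-- The unit sphere of `ℝ^d`. -/
abbrev Sph (d : ℕ) : Type := Metric.sphere (0 : Act d) 1

/-- The uniform probability distribution on the unit sphere (normalized surface measure). -/
def uniformSphere (d : ℕ) : Measure (Sph d) :=
  ((volume : Measure (Act d)).toSphere Set.univ)⁻¹ • (volume : Measure (Act d)).toSphere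

variable {Ω : Type*}

/-- The action profile `x̂^t` with components `x̂_i^t = x_i^t + δ_t A_i^t z_i^t`, played in
round `t`. -/
def played (δ : ℕ → ℝ) (z : Fin n → ℕ → Ω → Sph d) (x : Fin n → ℕ → Ω → Act d)
    (A : Fin n → ℕ → Ω → Act d →L[ℝ] Act d) (t : ℕ) (ω : Ω) : Fin n → Act d :=
  fun i => x i t ω + δ t • A i t ω (z i t ω : Act d)

/-- The gradient estimator `ĝ_i^t = (d / δ_t) c_i(x̂^t) (A_i^t)⁻¹ z_i^t`. -/
def gradEst (𝒢 : Game n d) (δ : ℕ → ℝ) (z : Fin n → ℕ → Ω → Sph d)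
    (x : Fin n → ℕ → Ω → Act d) (A : Fin n → ℕ → Ω → Act d →L[ℝ] Act d)
    (i : Fin n) (t : ℕ) (ω : Ω) : Act d :=
  ((d : ℝ) / δ t * 𝒢.c i (played δ z x A t ω)) • (A i t ω).inverse (z i t ω : Act d)

/-- Every player runs the algorithm with learning rates `η`, sampling radii `δ`, regularizers `h i`
and `p i` and constant `κ`. Rounds are `t = 1, 2, …`; entries at `t = 0` are not used.
The minimizations over `X i` are over its interior, `h i` being `+∞` on the boundary. -/
structure IsAlgorithmRun (𝒢 : Game n d) (h p : Fin n → Act d → ℝ) (κ : ℝ) (η δ : ℕ → ℝ)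
    (z : Fin n → ℕ → Ω → Sph d) (x : Fin n → ℕ → Ω → Act d)
    (A : Fin n → ℕ → Ω → Act d →L[ℝ] Act d) : Prop where
  init_mem : ∀ i ω, x i 1 ω ∈ interior (𝒢.X i)
  init_min : ∀ i ω, IsMinOn (h i) (interior (𝒢.X i)) (x i 1 ω)
  /-- `A_i^t` is positive semidefinite. -/
  scaling_pos : ∀ i, ∀ t ≥ 1, ∀ ω, (A i t ω).IsPositive
  /-- `(A_i^t)² (∇²h(x_i^t) + η_t (t + 1) ∇²p(x_i^t)) = I`, i.e. `A_i^t` is the inverse square root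
  of that Hessian. -/
  scaling_eq : ∀ i, ∀ t ≥ 1, ∀ ω,
    A i t ω * A i t ω * (hess (h i) (x i t ω) + (η t * ((t : ℝ) + 1)) • hess (p i) (x i t ω)) = 1
  step_mem : ∀ i, ∀ t ≥ 1, ∀ ω, x i (t + 1) ω ∈ interior (𝒢.X i)
  step_min : ∀ i, ∀ t ≥ 1, ∀ ω,
    IsMinOn
      (fun y => η t * inner ℝ y (gradEst 𝒢 δ z x A i t ω)
        + η t * κ * ((t : ℝ) + 1) * bregman (p i) y (x i t ω)
        + bregman (h i) y (x i t ω))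
      (interior (𝒢.X i)) (x i (t + 1) ω)

/-- The sampled directions `z_i^t` are independent over players and rounds, and each of them is
uniformly distributed on the unit sphere. -/
structure IsUniformSampling [MeasurableSpace Ω] (P : Measure Ω) (z : Fin n → ℕ → Ω → Sph d) :
    Prop where
  measurable : ∀ i t, Measurable (z i t)
  law : ∀ i t, P.map (z i t) = uniformSphere d
  indep : iIndepFun (fun k : Fin n × ℕ => z k.1 k.2) P

end Algorithm

end

/-! Each player runs mirror descent with the barrier `h i` plus a growing multiple of `p i`. The
proof tracks the potential D_h(u, x^t) + κ η_t t D_p(u, x^t) for a comparator u. By `three_point`,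
one step changes it by the estimated regret, a stability term, and the growth κ η_t D_p(u, x^t),
because the step itself carries the weight η_t (t + 1).

The growth is cancelled by curvature. The divergence theorem on the ball
(`integral_sphere_mul_inner`) identifies the conditional mean of the one-point estimator with the
average of the partial gradient over the sampling ellipsoid. Convexity of c_i - κ p_i then
contributes exactly -κ D_p(u, x^t). Terms linear in the sampled direction average to zero, so the
bias left by `integral_estimator_le` is only 2ℓδ²B² + κεδB², where ε is the oscillation of ∇²p on
the sampling scale. It is eventually at most ν δ_t.

For stability, self-concordance keeps the samples feasible (`dikin`) and bounds D_h below in the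
local norm. Hence `stability_le` controls that term by η_t² (d/δ_t)² times the square of the
observed cost. Costs lie in [0, 1], so the square is at most the cost, and η_t (d/δ_t)² = d δ_t / 2
tends to zero. In late rounds the noise is therefore at most θ η_t times the cost with θ = (1 -
C₂)/2; it is absorbed into the social cost instead of being summed. This is what makes the final
constant independent of κ, ζ and B.

The comparator is the smoothness target x'_i pulled by a fraction 1/T towards x_i^1
(`exists_comparator`): this costs 1/T per round and raises the barrier by at most ν log T. Summing
over players and using (C₁, C₂)-smoothness, `integral_SW_le` gives η_t (1 - C₂)/2 · E SW ≤ V_t -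
V_{t+1} + η_t (C₁ OPT + n/T + nνδ_t). `exists_average_le` telescopes this from a late round t₀ and
divides by η_T; every quantity depending on the setting but not on T is eventually beaten by log T.

The conditional means require that iterates be measurable functions of earlier directions. The step
is only implicitly defined, so this is read off from the optimality condition, using that ∇h + σ∇p
is continuous and injective. -/

noncomputable section

/-! ### The divergence theorem on the unit ball, by radial cutoffs. -/

section Sphere
set_option linter.unusedSectionVars false
open Set Metric Filter Topology

variable {E : Type*} [NormedAddCommGroup E] [InnerProductSpace ℝ E] [FiniteDimensional ℝ E]
  [MeasurableSpace E] [BorelSpace E] [Nontrivial E]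

/-- Polar coordinates for a product of a radial and an angular function. -/
theorem integral_radial_mul_angular (a : ℝ → ℝ) (b : sphere (0 : E) 1 → ℝ) (b' : E → ℝ)
    (hb : ∀ (z : sphere (0 : E) 1) (r : ℝ), 0 < r → b' (r • (z : E)) = b z) :
    ∫ x, a ‖x‖ * b' x ∂(volume : Measure E)
      = (∫ z, b z ∂(volume : Measure E).toSphere)
        * ∫ r in Ioi (0 : ℝ), r ^ (Module.finrank ℝ E - 1) * a r := by
  calc ∫ x, a ‖x‖ * b' x ∂(volume : Measure E)
      = ∫ x : ({(0)}ᶜ : Set E), a ‖x.1‖ * b' x.1 ∂((volume : Measure E).comap (↑)) := by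
        rw [integral_subtype_comap (measurableSet_singleton _).compl fun x ↦ a ‖x‖ * b' x,
          restrict_compl_singleton]
    _ = ∫ x, b x.1 * a x.2 ∂(volume : Measure E).toSphere.prod
          (.volumeIoiPow (Module.finrank ℝ E - 1)) := by
      rw [← (Measure.measurePreserving_homeomorphUnitSphereProd
        (volume : Measure E)).integral_comp
        (Homeomorph.measurableEmbedding _) (fun x => b x.1 * a x.2)]
      refine integral_congr_ae (.of_forall fun x => ?_)
      have hx : 0 < ‖(x : E)‖ := norm_pos_iff.2 x.2
      have h := hb (homeomorphUnitSphereProd E x).1 ‖(x : E)‖ hx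
      simp only [homeomorphUnitSphereProd_apply_snd_coe]
      rw [← h, mul_comm]
      congr 2
      rw [homeomorphUnitSphereProd_apply_fst_coe, smul_smul, mul_inv_cancel₀ hx.ne', one_smul]
    _ = _ := by
      rw [integral_prod_mul (μ := (volume : Measure E).toSphere)
        (ν := .volumeIoiPow (Module.finrank ℝ E - 1)) b (fun r => a r)]
      congr 1
      simp only [Measure.volumeIoiPow, ENNReal.ofReal]
      rw [integral_withDensity_eq_integral_smul,
        integral_subtype_comap measurableSet_Ioi
          fun r ↦ Real.toNNReal (r ^ (Module.finrank ℝ E - 1)) • a r,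
        setIntegral_congr_fun measurableSet_Ioi fun x hx ↦ ?_]
      · rw [NNReal.smul_def, Real.coe_toNNReal _ (pow_nonneg hx.out.le _), smul_eq_mul]
      · exact (measurable_subtype_coe.pow_const _).real_toNNReal

/-- A smooth radial cutoff: `1` for `r ≤ 1 - ε`, `0` for `r ≥ 1`. -/
def cutoff (ε r : ℝ) : ℝ := Real.smoothTransition ((1 - r) / ε)

theorem contDiff_cutoff (ε : ℝ) : ContDiff ℝ 1 (cutoff ε) := by
  unfold cutoff
  exact (Real.smoothTransition.contDiff (n := 1)).comp (by fun_prop)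

theorem cutoff_eq_one {ε r : ℝ} (hε : 0 < ε) (hr : r ≤ 1 - ε) : cutoff ε r = 1 :=
  Real.smoothTransition.one_of_one_le (by rw [le_div_iff₀ hε]; linarith)

theorem cutoff_eq_zero {ε r : ℝ} (hε : 0 < ε) (hr : 1 ≤ r) : cutoff ε r = 0 :=
  Real.smoothTransition.zero_of_nonpos (div_nonpos_of_nonpos_of_nonneg (by linarith) hε.le)

theorem cutoff_antitone {ε : ℝ} (hε : 0 < ε) : Antitone (cutoff ε) := fun r s h =>
  Real.smoothTransition.monotone (by gcongr)

theorem deriv_cutoff_nonpos {ε : ℝ} (hε : 0 < ε) (r : ℝ) : deriv (cutoff ε) r ≤ 0 :=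
  (cutoff_antitone hε).deriv_nonpos

theorem deriv_cutoff_eq_zero {ε r : ℝ} (hε : 0 < ε) (hr : r ≤ 1 - ε ∨ 1 ≤ r) :
    deriv (cutoff ε) r = 0 := by
  have hmin : IsLocalMin (cutoff ε) r ∨ IsLocalMax (cutoff ε) r := by
    rcases hr with hr | hr
    · right
      refine .of_forall fun y => ?_
      rw [cutoff_eq_one hε hr]; exact Real.smoothTransition.le_one _
    · left
      refine .of_forall fun y => ?_
      rw [cutoff_eq_zero hε hr]; exact Real.smoothTransition.nonneg _
  rcases hmin with h | h
  · exact h.deriv_eq_zero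
  · exact h.deriv_eq_zero

/-- The weight of the shell in polar coordinates. -/
theorem integral_deriv_cutoff {ε : ℝ} (hε : 0 < ε) (hε1 : ε < 1) (k : ℕ) :
    (1 - ε) ^ k ≤ ∫ r in Ioi (0 : ℝ), r ^ k * -deriv (cutoff ε) r ∧
      ∫ r in Ioi (0 : ℝ), r ^ k * -deriv (cutoff ε) r ≤ 1 := by
  have hcont : Continuous (deriv (cutoff ε)) := (contDiff_cutoff ε).continuous_deriv le_rfl
  have h0 : ∀ r, 0 ≤ -deriv (cutoff ε) r := fun r => neg_nonneg.2 (deriv_cutoff_nonpos hε r)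
  have e1 : ∫ r in Ioi (0 : ℝ), r ^ k * -deriv (cutoff ε) r
      = ∫ r in (1 - ε)..1, r ^ k * -deriv (cutoff ε) r := by
    rw [intervalIntegral.integral_of_le (by linarith)]
    refine setIntegral_eq_of_subset_of_forall_sdiff_eq_zero measurableSet_Ioi
      (fun r hr => lt_trans (by linarith : (0 : ℝ) < 1 - ε) hr.1) ?_
    intro r hr
    rw [deriv_cutoff_eq_zero hε, neg_zero, mul_zero]
    by_contra! h
    exact hr.2 ⟨h.1, h.2.le⟩
  have e2 : ∫ r in (1 - ε)..1, -deriv (cutoff ε) r = 1 := by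
    rw [intervalIntegral.integral_neg, intervalIntegral.integral_deriv_eq_sub
      (fun x _ => ((contDiff_cutoff ε).differentiable one_ne_zero) x)
      (hcont.intervalIntegrable _ _), cutoff_eq_one hε le_rfl, cutoff_eq_zero hε le_rfl]
    norm_num
  rw [e1]
  constructor
  · calc (1 - ε) ^ k = ∫ r in (1 - ε)..1, (1 - ε) ^ k * -deriv (cutoff ε) r := by
          rw [intervalIntegral.integral_const_mul, e2, mul_one]
      _ ≤ _ := by
        refine intervalIntegral.integral_mono_on (by linarith)
          (Continuous.intervalIntegrable (by fun_prop) _ _)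
          (Continuous.intervalIntegrable (by fun_prop) _ _) fun r hr => ?_
        exact mul_le_mul_of_nonneg_right (pow_le_pow_left₀ (by linarith) hr.1 _) (h0 r)
  · calc _ ≤ ∫ r in (1 - ε)..1, -deriv (cutoff ε) r := by
          refine intervalIntegral.integral_mono_on (by linarith)
            (Continuous.intervalIntegrable (by fun_prop) _ _)
            (Continuous.intervalIntegrable (by fun_prop) _ _) fun r hr => ?_
          exact mul_le_of_le_one_left (h0 r) (pow_le_one₀ (by linarith [hr.1]) hr.2)
      _ = 1 := e2

theorem tsupport_cutoff_norm {ε : ℝ} (hε : 0 < ε) :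
    tsupport (fun x : E => cutoff ε ‖x‖) ⊆ closedBall 0 1 := by
  refine closure_minimal (fun x hx => ?_) isClosed_closedBall
  rw [mem_closedBall_zero_iff]
  by_contra! h
  exact hx (cutoff_eq_zero hε h.le)

/-- The norm is singular only at the origin, and there the cutoff is locally constant because ε < 1;
the formula survives since its right side is zero at 0. -/
theorem hasFDerivAt_cutoff_norm {ε : ℝ} (hε : 0 < ε) (hε1 : ε < 1) (x : E) :
    HasFDerivAt (fun x : E => cutoff ε ‖x‖)
      ((deriv (cutoff ε) ‖x‖ * ‖x‖⁻¹) • innerSL ℝ x) x := by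
  rcases eq_or_ne x 0 with rfl | hx
  · have h1 : (fun x : E => cutoff ε ‖x‖) =ᶠ[𝓝 0] fun _ => (1 : ℝ) := by
      filter_upwards [ball_mem_nhds (0 : E) (by linarith : 0 < 1 - ε)] with y hy
      exact cutoff_eq_one hε (mem_ball_zero_iff.1 hy).le
    simpa using (hasFDerivAt_const (1 : ℝ) (0 : E)).congr_of_eventuallyEq h1
  · have h1 : HasFDerivAt (fun x : E => ‖x‖) (‖x‖⁻¹ • innerSL ℝ x) x := by
      have h := (hasStrictFDerivAt_norm_sq x).hasFDerivAt.sqrt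
        (pow_ne_zero 2 (norm_ne_zero_iff.2 hx))
      simp only [Real.sqrt_sq (norm_nonneg _)] at h
      refine h.congr_fderiv ?_
      ext y
      have : ‖x‖ ≠ 0 := norm_ne_zero_iff.2 hx
      simp
      field_simp
    have h2 := (((contDiff_cutoff ε).differentiable one_ne_zero) ‖x‖).hasDerivAt
    refine (h2.comp_hasFDerivAt x h1).congr_fderiv ?_
    rw [smul_smul]

theorem integrable_of_continuousOn_isCompact {g : E → ℝ} {K : Set E} (hK : IsCompact K)
    (h : ContinuousOn g K) (hs : ∀ x, x ∉ K → g x = 0) : Integrable g := by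
  rw [← integrableOn_iff_integrable_of_support_subset (s := K)
    (fun x hx => by_contra fun h => hx (hs x h))]
  exact h.integrableOn_compact hK

/-- Integration by parts on the unit ball against a smooth radial cutoff. -/
theorem integral_cutoff_mul_fderiv {ε : ℝ} (hε : 0 < ε) (hε1 : ε < 1) {f : E → ℝ} (w : E)
    (hf : ∀ x ∈ closedBall (0 : E) 1, DifferentiableAt ℝ f x)
    (hf' : ContinuousOn (fun x => fderiv ℝ f x w) (closedBall 0 1)) :
    ∫ x, cutoff ε ‖x‖ * fderiv ℝ f x w
      = ∫ x : E, -deriv (cutoff ε) ‖x‖ * (‖x‖⁻¹ * inner ℝ x w * f x) := by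
  have hc : Continuous (cutoff ε) := (contDiff_cutoff ε).continuous
  have hc' : Continuous (deriv (cutoff ε)) := (contDiff_cutoff ε).continuous_deriv le_rfl
  have hfc : ContinuousOn f (closedBall 0 1) :=
    fun x hx => (hf x hx).continuousAt.continuousWithinAt
  have hout : ∀ x : E, x ∉ closedBall (0 : E) 1 → 1 ≤ ‖x‖ := fun x hx => by
    rw [mem_closedBall_zero_iff, not_le] at hx; exact hx.le
  have hd : ∀ x : E, fderiv ℝ (fun x : E => cutoff ε ‖x‖) x w
      = deriv (cutoff ε) ‖x‖ * ‖x‖⁻¹ * inner ℝ x w := fun x => by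
    rw [(hasFDerivAt_cutoff_norm hε hε1 x).fderiv]; simp
  have hcd : ContDiff ℝ 1 (fun x : E => cutoff ε ‖x‖) := by
    rw [contDiff_iff_contDiffAt]
    intro x
    rcases eq_or_ne x 0 with rfl | hx
    · have h1 : (fun x : E => cutoff ε ‖x‖) =ᶠ[𝓝 0] fun _ => (1 : ℝ) := by
        filter_upwards [ball_mem_nhds (0 : E) (by linarith : 0 < 1 - ε)] with y hy
        exact cutoff_eq_one hε (mem_ball_zero_iff.1 hy).le
      exact contDiffAt_const.congr_of_eventuallyEq h1
    · exact (contDiff_cutoff ε).contDiffAt.comp x (contDiffAt_norm ℝ hx)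
  rw [integral_mul_fderiv_eq_neg_fderiv_mul_of_integrable]
  · rw [← integral_neg]
    refine integral_congr_ae (.of_forall fun x => ?_)
    simp only [hd]; ring
  · refine integrable_of_continuousOn_isCompact (isCompact_closedBall (0 : E) 1) ?_ fun x hx => ?_
    · exact ((hcd.continuous_fderiv one_ne_zero).clm_apply continuous_const).continuousOn.mul hfc
    · simp [hd, deriv_cutoff_eq_zero hε (.inr (hout x hx))]
  · refine integrable_of_continuousOn_isCompact (isCompact_closedBall (0 : E) 1) ?_ fun x hx => ?_
    · exact (hc.comp continuous_norm).continuousOn.mul hf'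
    · simp [cutoff_eq_zero hε (hout x hx)]
  · refine integrable_of_continuousOn_isCompact (isCompact_closedBall (0 : E) 1) ?_ fun x hx => ?_
    · exact (hc.comp continuous_norm).continuousOn.mul hfc
    · simp [cutoff_eq_zero hε (hout x hx)]
  · exact fun x _ => (hasFDerivAt_cutoff_norm hε hε1 x).differentiableAt
  · exact fun x hx => hf x (tsupport_cutoff_norm hε hx)

/-- The divergence theorem on the unit ball, for the vector field `f • w`. -/
theorem integral_sphere_mul_inner {f : E → ℝ} (w : E)
    (hf : ∀ x ∈ closedBall (0 : E) 1, DifferentiableAt ℝ f x)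
    (hf' : ContinuousOn (fun x => fderiv ℝ f x w) (closedBall 0 1)) :
    ∫ z : sphere (0 : E) 1, f z * inner ℝ (z : E) w ∂(volume : Measure E).toSphere
      = ∫ x in ball (0 : E) 1, fderiv ℝ f x w := by
  set k := Module.finrank ℝ E - 1
  -- The 2 keeps every shell width strictly below 1, so no shell reaches the origin.
  set ε : ℕ → ℝ := fun m => 1 / ((m : ℝ) + 2) with hεdef
  have hε : ∀ m, 0 < ε m := fun m => by positivity
  have hε1 : ∀ m, ε m < 1 := fun m => by
    simp only [hεdef]; rw [div_lt_one (by positivity)]; linarith [(Nat.cast_nonneg m : (0 : ℝ) ≤ m)]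
  have hεt : Tendsto ε atTop (𝓝 0) := by
    have h := (tendsto_one_div_add_atTop_nhds_zero_nat (𝕜 := ℝ)).comp (tendsto_add_atTop_nat 1)
    refine h.congr fun m => ?_
    simp only [hεdef, Function.comp]; push_cast; ring
  set I : ℕ → ℝ := fun m => ∫ r in Ioi (0 : ℝ), r ^ k * -deriv (cutoff (ε m)) r with hI
  have hIt : Tendsto I atTop (𝓝 1) := by
    refine tendsto_of_tendsto_of_tendsto_of_le_of_le (g := fun m => (1 - ε m) ^ k) ?_
      tendsto_const_nhds (fun m => (integral_deriv_cutoff (hε m) (hε1 m) k).1)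
      (fun m => (integral_deriv_cutoff (hε m) (hε1 m) k).2)
    simpa using (tendsto_const_nhds (x := (1 : ℝ))).sub hεt |>.pow k
  have hfc : ContinuousOn f (closedBall 0 1) :=
    fun x hx => (hf x hx).continuousAt.continuousWithinAt
  -- the interior term
  have hleft : Tendsto (fun m => ∫ x, cutoff (ε m) ‖x‖ * fderiv ℝ f x w) atTop
      (𝓝 (∫ x in ball (0 : E) 1, fderiv ℝ f x w)) := by
    rw [← integral_indicator measurableSet_ball]
    refine tendsto_integral_of_dominated_convergence
      ((closedBall (0 : E) 1).indicator fun x => |fderiv ℝ f x w|) (fun m => ?_) ?_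
      (fun m => .of_forall fun x => ?_) (.of_forall fun x => ?_)
    · refine (integrable_of_continuousOn_isCompact (isCompact_closedBall (0 : E) 1) ?_
        fun x hx => ?_).aestronglyMeasurable
      · exact ((contDiff_cutoff _).continuous.comp continuous_norm).continuousOn.mul hf'
      · rw [mem_closedBall_zero_iff, not_le] at hx
        simp [cutoff_eq_zero (hε m) hx.le]
    · exact (integrable_indicator_iff measurableSet_closedBall).2
        (hf'.abs.integrableOn_compact (isCompact_closedBall _ _))
    · by_cases hx : x ∈ closedBall (0 : E) 1
      · rw [indicator_of_mem hx, norm_mul, Real.norm_eq_abs, Real.norm_eq_abs,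
          abs_of_nonneg (show 0 ≤ cutoff (ε m) ‖x‖ from Real.smoothTransition.nonneg _)]
        exact mul_le_of_le_one_left (abs_nonneg _) (Real.smoothTransition.le_one _)
      · rw [indicator_of_notMem hx]
        rw [mem_closedBall_zero_iff, not_le] at hx
        simp [cutoff_eq_zero (hε m) hx.le]
    · by_cases hx : x ∈ ball (0 : E) 1
      · rw [indicator_of_mem hx]
        rw [mem_ball_zero_iff] at hx
        refine tendsto_const_nhds.congr' ?_
        filter_upwards [hεt.eventually (gt_mem_nhds (sub_pos.2 hx))] with m hm
        rw [cutoff_eq_one (hε m) (by linarith), one_mul]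
      · rw [indicator_of_notMem hx]
        rw [mem_ball_zero_iff, not_lt] at hx
        refine tendsto_const_nhds.congr fun m => ?_
        rw [cutoff_eq_zero (hε m) hx, zero_mul]
  -- With f evaluated at x/‖x‖ the integral factors in polar coordinates into `S * I m`. Uniform
  -- continuity of f on the closed ball makes the replacement harmless, since the shell is thin and
  -- its weight is at most `M`.
  have hright : Tendsto (fun m => ∫ x : E, -deriv (cutoff (ε m)) ‖x‖ * (‖x‖⁻¹ * inner ℝ x w * f x))
      atTop (𝓝 (∫ z : sphere (0 : E) 1, f z * inner ℝ (z : E) w ∂(volume : Measure E).toSphere)) := by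
    set S := ∫ z : sphere (0 : E) 1, f z * inner ℝ (z : E) w ∂(volume : Measure E).toSphere
    set M := (volume : Measure E).toSphere.real univ with hM
    have hSI : Tendsto (fun m => S * I m) atTop (𝓝 S) := by simpa using hIt.const_mul S
    have hpol : ∀ m, ∫ x : E, -deriv (cutoff (ε m)) ‖x‖ *
        (‖x‖⁻¹ * inner ℝ x w * f (‖x‖⁻¹ • x)) = S * I m := fun m => by
      refine integral_radial_mul_angular (fun r => -deriv (cutoff (ε m)) r)
        (fun z : sphere (0 : E) 1 => f z * inner ℝ (z : E) w) _ fun z r hr => ?_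
      have hz : ‖(z : E)‖ = 1 := mem_sphere_zero_iff_norm.1 z.2
      rw [norm_smul, hz, mul_one, Real.norm_of_nonneg hr.le, smul_smul, inv_mul_cancel₀ hr.ne',
        one_smul, inner_smul_left]
      simp only [conj_trivial]
      field_simp
    have hmass : ∀ m, ∫ x : E, -deriv (cutoff (ε m)) ‖x‖ ≤ M := fun m => by
      have h := integral_radial_mul_angular (E := E) (fun r => -deriv (cutoff (ε m)) r)
        (fun _ => 1) (fun _ => 1) fun _ _ _ => rfl
      simp only [mul_one] at h
      rw [h, integral_const, smul_eq_mul, mul_one]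
      exact mul_le_of_le_one_right measureReal_nonneg
        (integral_deriv_cutoff (hε m) (hε1 m) k).2
    have hc' : ∀ m, Continuous (deriv (cutoff (ε m))) :=
      fun m => (contDiff_cutoff _).continuous_deriv le_rfl
    have hint0 : ∀ m, Integrable fun x : E => -deriv (cutoff (ε m)) ‖x‖ := fun m => by
      refine integrable_of_continuousOn_isCompact (isCompact_closedBall (0 : E) 1)
        (((hc' m).comp continuous_norm).neg.continuousOn) fun x hx => ?_
      rw [mem_closedBall_zero_iff, not_le] at hx
      rw [deriv_cutoff_eq_zero (hε m) (.inr hx.le), neg_zero]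
    have hannulus : ∀ m (g : E → ℝ), ContinuousOn g (closedBall (0 : E) 1 \ ball 0 (1 - ε m)) →
        Integrable fun x : E => -deriv (cutoff (ε m)) ‖x‖ * (‖x‖⁻¹ * inner ℝ x w * g x) := by
      intro m g hg
      refine integrable_of_continuousOn_isCompact
        ((isCompact_closedBall (0 : E) 1).diff isOpen_ball)
        (((hc' m).comp continuous_norm).neg.continuousOn.mul
          (((continuous_norm.continuousOn.inv₀ fun x hx => ?_).mul
            (by fun_prop)).mul hg)) fun x hx => ?_
      · have := hx.2
        rw [mem_ball_zero_iff, not_lt] at this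
        linarith [hε1 m]
      · rw [deriv_cutoff_eq_zero (hε m), neg_zero, zero_mul]
        by_contra! h
        refine hx ⟨mem_closedBall_zero_iff.2 h.2.le, fun hb => ?_⟩
        linarith [mem_ball_zero_iff.1 hb]
    have hrad : ∀ m, ContinuousOn (fun x => f (‖x‖⁻¹ • x))
        (closedBall (0 : E) 1 \ ball 0 (1 - ε m)) := fun m => by
      have h0 : ∀ x ∈ closedBall (0 : E) 1 \ ball 0 (1 - ε m), ‖x‖ ≠ 0 := fun x hx => by
        have := hx.2
        rw [mem_ball_zero_iff, not_lt] at this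
        linarith [hε1 m]
      refine hfc.comp ((continuous_norm.continuousOn.inv₀ h0).smul continuousOn_id) fun x hx => ?_
      rw [mem_closedBall_zero_iff, norm_smul, norm_inv, norm_norm, inv_mul_cancel₀ (h0 x hx)]
    rw [← sub_zero S]
    have hfin : Tendsto (fun m => (∫ x : E, -deriv (cutoff (ε m)) ‖x‖ *
        (‖x‖⁻¹ * inner ℝ x w * f x)) - S * I m) atTop (𝓝 0) := by
      rw [Metric.tendsto_atTop]
      intro η hη
      set η' := η / (‖w‖ * M + 1) with hη'
      have hpos : 0 < ‖w‖ * M + 1 := by positivity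
      obtain ⟨ρ, hρ, hu⟩ := Metric.uniformContinuousOn_iff.1
        ((isCompact_closedBall (0 : E) 1).uniformContinuousOn_of_continuous hfc) η' (by positivity)
      obtain ⟨N, hN⟩ := eventually_atTop.1 (hεt.eventually (gt_mem_nhds hρ))
      refine ⟨N, fun m hm => ?_⟩
      rw [dist_zero_right, ← hpol m, ← integral_sub (hannulus m f (hfc.mono sdiff_subset))
        (hannulus m _ (hrad m))]
      calc _ ≤ ∫ x : E, -deriv (cutoff (ε m)) ‖x‖ * (‖w‖ * η') := by
            refine norm_integral_le_of_norm_le ((hint0 m).mul_const _) (.of_forall fun x => ?_)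
            by_cases hx : ‖x‖ ≤ 1 - ε m ∨ 1 ≤ ‖x‖
            · simp [deriv_cutoff_eq_zero (hε m) hx]
            push Not at hx
            have hx0 : 0 < ‖x‖ := by linarith [hε1 m]
            rw [← mul_sub, ← mul_sub, norm_mul, Real.norm_of_nonneg
              (neg_nonneg.2 (deriv_cutoff_nonpos (hε m) _)), norm_mul]
            refine mul_le_mul_of_nonneg_left (mul_le_mul ?_ ?_ (norm_nonneg _) (norm_nonneg _))
              (neg_nonneg.2 (deriv_cutoff_nonpos (hε m) _))
            · rw [norm_mul, norm_inv, norm_norm, inv_mul_le_iff₀ hx0]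
              exact norm_inner_le_norm x w
            · rw [← dist_eq_norm]
              refine (hu x (mem_closedBall_zero_iff.2 hx.2.le) _ ?_ ?_).le
              · rw [mem_closedBall_zero_iff, norm_smul, norm_inv, norm_norm,
                  inv_mul_cancel₀ hx0.ne']
              · have h1 : x - ‖x‖⁻¹ • x = (1 - ‖x‖⁻¹) • x := by rw [sub_smul, one_smul]
                have h2 : ‖1 - ‖x‖⁻¹‖ * ‖x‖ = 1 - ‖x‖ := by
                  rw [← abs_of_pos hx0, ← Real.norm_eq_abs, norm_norm, ← norm_norm x,
                    ← norm_mul, sub_mul, norm_norm, inv_mul_cancel₀ hx0.ne', one_mul,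
                    Real.norm_eq_abs, abs_of_nonpos (by linarith)]
                  ring
                rw [dist_eq_norm, h1, norm_smul, h2]
                linarith [hN m hm]
        _ ≤ M * (‖w‖ * η') := by
            rw [integral_mul_const]
            exact mul_le_mul_of_nonneg_right (hmass m) (by positivity)
        _ < (‖w‖ * M + 1) * η' := by nlinarith [show 0 < η' by positivity]
        _ = η := by rw [hη']; field_simp
    have := hfin.add hSI
    simpa using this
  refine tendsto_nhds_unique hright (hleft.congr fun m => ?_)
  exact integral_cutoff_mul_fderiv (hε m) (hε1 m) w hf hf'

end Sphere

/-! ### Taylor bounds along segments and Bregman divergences. -/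

section Calculus
open Set Filter Topology

/-- Second-order Taylor lower bound on an interval. -/
theorem taylor_lower_bound {φ φ' φ'' : ℝ → ℝ} {s m : ℝ} (hs : 0 ≤ s)
    (h1 : ∀ u ∈ Icc 0 s, HasDerivAt φ (φ' u) u) (h2 : ∀ u ∈ Icc 0 s, HasDerivAt φ' (φ'' u) u)
    (hm : ∀ u ∈ Icc 0 s, m ≤ φ'' u) : m * s ^ 2 / 2 ≤ φ s - φ 0 - φ' 0 * s := by
  have hφ' : ∀ u ∈ Icc 0 s, 0 ≤ φ' u - φ' 0 - m * u := by
    have hmono : MonotoneOn (fun u => φ' u - φ' 0 - m * u) (Icc 0 s) := by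
      refine monotoneOn_of_hasDerivWithinAt_nonneg (f' := fun u => φ'' u - m) (convex_Icc 0 s)
        (fun u hu => ?_) (fun u hu => ?_) (fun u hu => ?_)
      · exact ((((h2 u hu).sub_const _).sub ((hasDerivAt_id u).const_mul m))).continuousAt.continuousWithinAt
      · have := ((h2 u (interior_subset hu)).sub_const (φ' 0)).sub ((hasDerivAt_id u).const_mul m)
        rw [mul_one] at this
        exact this.hasDerivWithinAt
      · exact sub_nonneg.2 (hm u (interior_subset hu))
    intro u hu
    have := hmono ⟨le_rfl, hs⟩ hu hu.1
    simpa using this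
  have hmono : MonotoneOn (fun u => φ u - φ' 0 * u - m / 2 * u ^ 2) (Icc 0 s) := by
    have hd : ∀ u ∈ Icc 0 s, HasDerivAt (fun u => φ u - φ' 0 * u - m / 2 * u ^ 2)
        (φ' u - φ' 0 - m * u) u := fun u hu => by
      have := ((h1 u hu).sub ((hasDerivAt_id u).const_mul (φ' 0))).sub
        (((hasDerivAt_id u).pow 2).const_mul (m / 2))
      refine this.congr_deriv ?_
      simp; ring
    exact monotoneOn_of_hasDerivWithinAt_nonneg (convex_Icc 0 s)
      (fun u hu => (hd u hu).continuousAt.continuousWithinAt)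
      (fun u hu => (hd u (interior_subset hu)).hasDerivWithinAt)
      (fun u hu => hφ' u (interior_subset hu))
  have := hmono ⟨le_rfl, hs⟩ ⟨hs, le_rfl⟩ hs
  simp only at this
  nlinarith

variable {d : ℕ} {f : Act d → ℝ} {x v : Act d} {s : ℝ}

theorem hasGradientAt_line (h : DifferentiableAt ℝ f (x + s • v)) :
    HasDerivAt (fun s : ℝ => f (x + s • v)) (inner ℝ (gradient f (x + s • v)) v) s := by
  have h1 : HasDerivAt (fun s : ℝ => x + s • v) v s := by
    simpa using ((hasDerivAt_id s).smul_const v).const_add x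
  have := h.hasFDerivAt.comp_hasDerivAt s h1
  rwa [← inner_gradient_left] at this

theorem ContDiffAt.gradient_one {y : Act d} (h : ContDiffAt ℝ 2 f y) :
    ContDiffAt ℝ 1 (gradient f) y :=
  (InnerProductSpace.toDual ℝ (Act d)).symm.contDiff.contDiffAt.comp y
    (h.fderiv_right (m := 1) (by norm_num))

theorem hasFDerivAt_gradient {y : Act d} (h : ContDiffAt ℝ 2 f y) :
    HasFDerivAt (gradient f) (hess f y) y :=
  (h.gradient_one.differentiableAt one_ne_zero).hasFDerivAt

theorem hasDerivAt_inner_gradient_line (h : ContDiffAt ℝ 2 f (x + s • v)) :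
    HasDerivAt (fun s : ℝ => inner ℝ (gradient f (x + s • v)) v)
      (inner ℝ (hess f (x + s • v) v) v) s := by
  have h1 : HasDerivAt (fun s : ℝ => x + s • v) v s := by
    simpa using ((hasDerivAt_id s).smul_const v).const_add x
  have := ((hasFDerivAt_gradient h).comp_hasDerivAt s h1).inner ℝ (hasDerivAt_const s v)
  simpa using this

/-- Bridge between the operator form of the Hessian and the multilinear derivatives in which
self-concordance is phrased. -/
theorem inner_hess_eq_iteratedFDeriv {y : Act d} (h : ContDiffAt ℝ 2 f y) (v : Act d) :
    inner ℝ (hess f y v) v = iteratedFDeriv ℝ 2 f y (fun _ => v) := by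
  have h1 : HasFDerivAt (fun y => inner ℝ (gradient f y) v)
      ((innerSL ℝ v) ∘L hess f y) y := by
    have := (innerSL ℝ v).hasFDerivAt.comp y (hasFDerivAt_gradient h)
    refine this.congr_of_eventuallyEq (.of_forall fun y => ?_)
    simp
  have h2 : HasFDerivAt (fun y => fderiv ℝ f y v)
      ((fderiv ℝ (fderiv ℝ f) y).flip v) y := by
    have h := ((h.fderiv_right (m := 1) (by norm_num)).differentiableAt one_ne_zero).hasFDerivAt
    simpa using h.clm_apply (hasFDerivAt_const v y)
  simp only [inner_gradient_left] at h1
  have h3 := congrArg (fun L => L v) (h1.unique h2)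
  rw [iteratedFDeriv_two_apply]
  simpa [real_inner_comm] using h3

theorem hasDerivAt_inner_hess_line (h : ContDiffAt ℝ 3 f (x + s • v)) :
    HasDerivAt (fun s : ℝ => inner ℝ (hess f (x + s • v) v) v)
      (iteratedFDeriv ℝ 3 f (x + s • v) (fun _ => v)) s := by
  have h1 : HasDerivAt (fun s : ℝ => x + s • v) v s := by
    simpa using ((hasDerivAt_id s).smul_const v).const_add x
  have hd : DifferentiableAt ℝ (iteratedFDeriv ℝ 2 f) (x + s • v) :=
    h.differentiableAt_iteratedFDeriv (by norm_num)
  have h2 := hd.hasFDerivAt.comp_hasDerivAt s h1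
  have h3 := (ContinuousMultilinearMap.apply ℝ (fun _ : Fin 2 => Act d) ℝ
    (fun _ => v)).hasFDerivAt.comp_hasDerivAt s h2
  rw [iteratedFDeriv_succ_apply_left]
  refine HasDerivAt.congr_of_eventuallyEq h3 ?_
  have hev : ∀ᶠ y in 𝓝 (x + s • v), ContDiffAt ℝ 3 f y := h.eventually (by norm_num)
  filter_upwards [h1.continuousAt.eventually hev] with u hu
  exact inner_hess_eq_iteratedFDeriv (hu.of_le (by norm_num)) v

/-- The Bregman divergence is bounded below by the smallest curvature along the segment. -/
theorem le_bregman_of_le_hess {y : Act d} {m : ℝ}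
    (hf : ∀ s ∈ Icc (0 : ℝ) 1, ContDiffAt ℝ 2 f (x + s • (y - x)))
    (hm : ∀ s ∈ Icc (0 : ℝ) 1, m ≤ inner ℝ (hess f (x + s • (y - x)) (y - x)) (y - x)) :
    m / 2 ≤ bregman f y x := by
  have := taylor_lower_bound (φ := fun s : ℝ => f (x + s • (y - x))) zero_le_one
    (fun u hu => hasGradientAt_line ((hf u hu).differentiableAt (by norm_num)))
    (fun u hu => hasDerivAt_inner_gradient_line (hf u hu)) hm
  simpa [bregman] using this

theorem inner_gradient_sub (f : Act d → ℝ) (x y : Act d) :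
    inner ℝ (gradient f x - gradient f y) (x - y) = bregman f x y + bregman f y x := by
  have : y - x = -(x - y) := by abel
  simp only [bregman, this, inner_sub_left, inner_neg_right]
  ring

theorem bregman_self (f : Act d → ℝ) (x : Act d) : bregman f x x = 0 := by simp [bregman]

/-- Convexity of the Bregman divergence along rays, from the gradient inequality. -/
theorem bregman_line_le {y : Act d} {l : ℝ} (hl0 : 0 ≤ l) (hl1 : l ≤ 1)
    (h1 : 0 ≤ bregman f y (x + l • (y - x))) (h0 : 0 ≤ bregman f x (x + l • (y - x))) :
    bregman f (x + l • (y - x)) x ≤ l * bregman f y x := by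
  have e1 : y - (x + l • (y - x)) = (1 - l) • (y - x) := by module
  have e2 : x - (x + l • (y - x)) = (-l) • (y - x) := by module
  have e3 : x + l • (y - x) - x = l • (y - x) := by abel
  simp only [bregman, e1, e2, e3, inner_smul_right] at *
  nlinarith [mul_nonneg hl0 h1, mul_nonneg (sub_nonneg.2 hl1) h0]

end Calculus

/-! ### Self-concordant barriers: Dikin ellipsoid, divergence bounds, logarithmic growth. -/

namespace IsSelfConcordantBarrier
open Set Filter Topology

variable {d : ℕ} {ν B : ℝ} {X : Set (Act d)} {h : Act d → ℝ}

theorem contDiffAt (hb : IsSelfConcordantBarrier ν X h) {x : Act d} (hx : x ∈ interior X) :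
    ContDiffAt ℝ 3 h x := hb.contDiffOn.contDiffAt (isOpen_interior.mem_nhds hx)

theorem contDiffAt_two (hb : IsSelfConcordantBarrier ν X h) {x : Act d} (hx : x ∈ interior X) :
    ContDiffAt ℝ 2 h x := (hb.contDiffAt hx).of_le (by norm_num)

/-- `(∇²h[v, v] + ε) ^ (-1/2)` is `1`-Lipschitz along segments with direction `v`. -/
theorem abs_rpow_sub_le (hb : IsSelfConcordantBarrier ν X h) {x v : Act d} {s ε : ℝ} (hε : 0 < ε)
    (hs : 0 ≤ s) (hx : ∀ u ∈ Icc 0 s, x + u • v ∈ interior X) :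
    |(inner ℝ (hess h (x + s • v) v) v + ε) ^ (-(1 / 2) : ℝ)
      - (inner ℝ (hess h x v) v + ε) ^ (-(1 / 2) : ℝ)| ≤ s := by
  set a : ℝ → ℝ := fun u => inner ℝ (hess h (x + u • v) v) v with ha
  have ha0 : ∀ u ∈ Icc 0 s, 0 ≤ a u := fun u hu => hb.hess_nonneg _ (hx u hu) v
  have hd : ∀ u ∈ Icc 0 s, HasDerivWithinAt (fun u => (a u + ε) ^ (-(1 / 2) : ℝ))
      (iteratedFDeriv ℝ 3 h (x + u • v) (fun _ => v) * (-(1 / 2)) * (a u + ε) ^ (-(1 / 2) - 1 : ℝ))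
      (Icc 0 s) u := fun u hu =>
    (((hasDerivAt_inner_hess_line (hb.contDiffAt (hx u hu))).add_const ε).rpow_const
      (.inl (show a u + ε ≠ 0 by have := ha0 u hu; positivity))).hasDerivWithinAt
  -- Self-concordance bounds the third derivative by 2 a^(3/2), which the factors 1/2 and (a +
  -- ε)^(-3/2) reduce to 1. The shift ε is there because a may vanish.
  have hbound : ∀ u ∈ Icc 0 s, ‖iteratedFDeriv ℝ 3 h (x + u • v) (fun _ => v) * (-(1 / 2))
      * (a u + ε) ^ (-(1 / 2) - 1 : ℝ)‖ ≤ 1 := by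
    intro u hu
    have hpos : 0 < a u + ε := by linarith [ha0 u hu]
    have h3 := hb.third_deriv _ (hx u hu) v
    rw [norm_mul, norm_mul, Real.norm_eq_abs, Real.norm_eq_abs, Real.norm_eq_abs,
      abs_of_pos (Real.rpow_pos_of_pos hpos _)]
    have h4 : (a u) ^ (3 / 2 : ℝ) ≤ (a u + ε) ^ (3 / 2 : ℝ) :=
      Real.rpow_le_rpow (ha0 u hu) (by linarith) (by norm_num)
    have h5 : (a u + ε) ^ (3 / 2 : ℝ) * (a u + ε) ^ (-(1 / 2) - 1 : ℝ) = 1 := by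
      rw [← Real.rpow_add hpos]; norm_num
    have h6 : |(-(1 / 2) : ℝ)| = 1 / 2 := by norm_num
    rw [h6]
    calc _ ≤ (2 * (a u + ε) ^ (3 / 2 : ℝ)) * (1 / 2) * (a u + ε) ^ (-(1 / 2) - 1 : ℝ) := by
          have := Real.rpow_nonneg hpos.le (-(1 / 2) - 1 : ℝ)
          gcongr
          exact h3.trans (mul_le_mul_of_nonneg_left h4 zero_le_two)
      _ = (a u + ε) ^ (3 / 2 : ℝ) * (a u + ε) ^ (-(1 / 2) - 1 : ℝ) := by ring
      _ = 1 := h5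
  have := (convex_Icc 0 s).norm_image_sub_le_of_norm_hasDerivWithin_le hd hbound
    ⟨le_rfl, hs⟩ ⟨hs, le_rfl⟩
  simpa [ha, abs_of_nonneg hs] using this

/-- For negative `a` both sides are zero by convention: the real power carries the factor cos(-π/2).
-/
theorem rpow_neg_half (a : ℝ) : a ^ (-(1 / 2) : ℝ) = (Real.sqrt a)⁻¹ := by
  by_cases h : 0 ≤ a
  · rw [Real.rpow_neg h, ← Real.sqrt_eq_rpow]
  · push Not at h
    rw [Real.sqrt_eq_zero_of_nonpos h.le, Real.rpow_def_of_neg h]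
    have : -(1 / 2) * Real.pi = -(Real.pi / 2) := by ring
    rw [this, Real.cos_neg, Real.cos_pi_div_two]; simp

/-- The inverse square root of the (shifted) curvature starts above 1 and drops by at most 1 over
unit time, so it stays away from zero. The bound is uniform in `s`, which lets `dikin` rule out
blow-up of `h`. -/
theorem hess_le (hb : IsSelfConcordantBarrier ν X h) {x v : Act d}
    (hv : inner ℝ (hess h x v) v < 1) :
    ∃ C, 0 ≤ C ∧ ∀ s ∈ Icc (0 : ℝ) 1, (∀ u ∈ Icc 0 s, x + u • v ∈ interior X) →
      inner ℝ (hess h (x + s • v) v) v ≤ C := by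
  by_cases hx : x ∈ interior X
  swap
  · refine ⟨0, le_rfl, fun s hs hu => ?_⟩
    exact absurd (by simpa using hu 0 ⟨le_rfl, hs.1⟩) hx
  set a0 := inner ℝ (hess h x v) v
  have ha0 : 0 ≤ a0 := hb.hess_nonneg x hx v
  set ε := (1 - a0) / 2 with hε
  have hεpos : 0 < ε := by linarith
  set r := Real.sqrt (a0 + ε) with hr
  have hr0 : 0 < r := Real.sqrt_pos.2 (by linarith)
  have hr1 : r < 1 := by rw [hr, Real.sqrt_lt' one_pos]; linarith
  have hgap : 0 < r⁻¹ - 1 := sub_pos.2 ((one_lt_inv₀ hr0).2 hr1)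
  refine ⟨(r⁻¹ - 1)⁻¹ ^ 2, by positivity, fun s hs hu => ?_⟩
  have h1 := hb.abs_rpow_sub_le hεpos hs.1 hu
  have ha : 0 ≤ inner ℝ (hess h (x + s • v) v) v := hb.hess_nonneg _ (hu s ⟨hs.1, le_rfl⟩) v
  rw [rpow_neg_half, rpow_neg_half] at h1
  set y := Real.sqrt (inner ℝ (hess h (x + s • v) v) v + ε) with hy
  have hy0 : 0 < y := Real.sqrt_pos.2 (by linarith)
  have h2 : r⁻¹ - 1 ≤ y⁻¹ := by
    have := (abs_le.1 h1).1
    linarith [hs.2]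
  have h3 : y ≤ (r⁻¹ - 1)⁻¹ := by
    rw [← inv_inv y]; exact inv_anti₀ hgap h2
  have h4 : y ^ 2 ≤ (r⁻¹ - 1)⁻¹ ^ 2 := pow_le_pow_left₀ hy0.le h3 2
  rw [hy, Real.sq_sqrt (by linarith)] at h4
  linarith

/-- The open Dikin ellipsoid is contained in the domain. -/
theorem dikin (hb : IsSelfConcordantBarrier ν X h) {x v : Act d} (hx : x ∈ interior X)
    (hv : inner ℝ (hess h x v) v < 1) : x + v ∈ interior X := by
  obtain ⟨C, hC0, hC⟩ := hb.hess_le hv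
  by_contra hnot
  -- First-exit argument: before the exit time the curvature bound keeps `h` bounded along the ray,
  -- while the barrier property at the exit point forces `h` to infinity.
  set S : Set ℝ := {s | s ∈ Icc (0 : ℝ) 1 ∧ x + s • v ∉ interior X} with hS
  have hSc : IsClosed S := by
    refine isClosed_Icc.inter ?_
    exact (isOpen_interior.preimage (by fun_prop : Continuous fun s : ℝ => x + s • v)).isClosed_compl
  have hSn : S.Nonempty := ⟨1, ⟨zero_le_one, le_rfl⟩, by simpa using hnot⟩
  have hSb : BddBelow S := ⟨0, fun s hs => hs.1.1⟩
  set t := sInf S with ht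
  have htS : t ∈ S := hSc.csInf_mem hSn hSb
  have hlt : ∀ u, 0 ≤ u → u < t → x + u • v ∈ interior X := fun u hu0 hut => by
    by_contra hu
    exact absurd (csInf_le hSb ⟨⟨hu0, hut.le.trans htS.1.2⟩, hu⟩) (not_le.2 hut)
  have ht0 : 0 < t := by
    refine lt_of_le_of_ne htS.1.1 fun h0 => htS.2 ?_
    rw [← h0]; simpa using hx
  have hbd : ∀ s, 0 ≤ s → s < t →
      h (x + s • v) ≤ h x + |inner ℝ (gradient h x) v| + C := fun s hs0 hst => by
    have hin : ∀ u ∈ Icc 0 s, x + u • v ∈ interior X := fun u hu => hlt u hu.1 (hu.2.trans_lt hst)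
    have hs1 : s ≤ 1 := hst.le.trans htS.1.2
    have := taylor_lower_bound (φ := fun s : ℝ => -h (x + s • v)) (m := -C) hs0
      (fun u hu => (hasGradientAt_line
        ((hb.contDiffAt (hin u hu)).differentiableAt (by norm_num))).neg)
      (fun u hu => (hasDerivAt_inner_gradient_line (hb.contDiffAt_two (hin u hu))).neg)
      (fun u hu => neg_le_neg (hC u ⟨hu.1, hu.2.trans hs1⟩
        fun w hw => hin w ⟨hw.1, hw.2.trans hu.2⟩))
    simp only [zero_smul, add_zero] at this
    have h1 : inner ℝ (gradient h x) v * s ≤ |inner ℝ (gradient h x) v| := by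
      refine (mul_le_mul_of_nonneg_right (le_abs_self _) hs0).trans ?_
      exact mul_le_of_le_one_right (abs_nonneg _) hs1
    have h2 : C * s ^ 2 ≤ C := mul_le_of_le_one_right hC0 (pow_le_one₀ hs0 hs1)
    linarith
  have hcont : Tendsto (fun s : ℝ => x + s • v) (𝓝[Ico 0 t] t)
      (𝓝[interior X] (x + t • v)) := by
    refine tendsto_nhdsWithin_iff.2 ⟨?_, ?_⟩
    · exact ((by fun_prop : Continuous fun s : ℝ => x + s • v).tendsto t).mono_left nhdsWithin_le_nhds
    · filter_upwards [self_mem_nhdsWithin] with s hs using hlt s hs.1 hs.2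
  have hne : (𝓝[Ico 0 t] t).NeBot := by
    rw [← mem_closure_iff_nhdsWithin_neBot, closure_Ico ht0.ne]
    exact ⟨ht0.le, le_rfl⟩
  have hfr : x + t • v ∈ frontier X := by
    refine ⟨closure_mono interior_subset ?_, htS.2⟩
    rw [mem_closure_iff_nhdsWithin_neBot]
    exact hcont.neBot
  have hinf := (hb.barrier _ hfr).comp hcont
  obtain ⟨s, hs1, hs2⟩ := ((hinf.eventually_gt_atTop
    (h x + |inner ℝ (gradient h x) v| + C)).and self_mem_nhdsWithin).exists
  exact absurd (hbd s hs2.1 hs2.2) (not_le.2 hs1)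

/-- The closed Dikin ellipsoid is contained in the closed domain. -/
theorem dikin_closed (hb : IsSelfConcordantBarrier ν X h) (hX : IsClosed X) {x v : Act d}
    (hx : x ∈ interior X) (hv : inner ℝ (hess h x v) v ≤ 1) : x + v ∈ X := by
  have hlim : Tendsto (fun l : ℝ => x + l • v) (𝓝[Ico 0 1] 1) (𝓝 (x + v)) := by
    have := (by fun_prop : Continuous fun s : ℝ => x + s • v).tendsto 1
    rw [one_smul] at this
    exact this.mono_left nhdsWithin_le_nhds
  have hne : (𝓝[Ico (0 : ℝ) 1] 1).NeBot := by
    rw [← mem_closure_iff_nhdsWithin_neBot, closure_Ico zero_ne_one]; simp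
  refine hX.mem_of_tendsto hlim ?_
  filter_upwards [self_mem_nhdsWithin] with l hl
  refine interior_subset (hb.dikin hx ?_)
  rw [map_smul, inner_smul_left, inner_smul_right]
  have h0 := hb.hess_nonneg x hx v
  simp only [conj_trivial]
  have h1 : l * inner ℝ (hess h x v) v ≤ l := mul_le_of_le_one_right hl.1 hv
  have h2 : l * (l * inner ℝ (hess h x v) v) ≤ l * l := mul_le_mul_of_nonneg_left h1 hl.1
  nlinarith [hl.1, hl.2]

/-- The Dikin ellipsoid lies in a set of diameter at most B; otherwise it would contain a multiple
of v longer than B. -/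
theorem norm_sq_le (hb : IsSelfConcordantBarrier ν X h)
    (hB : ∀ y ∈ X, ∀ y' ∈ X, ‖y - y'‖ ≤ B) (hB0 : 0 < B) {x : Act d} (hx : x ∈ interior X)
    (v : Act d) : ‖v‖ ^ 2 ≤ B ^ 2 * inner ℝ (hess h x v) v := by
  by_contra! hlt
  set a := inner ℝ (hess h x v) v with ha
  have ha0 : 0 ≤ a := hb.hess_nonneg x hx v
  have hlt' : a < ‖v‖ ^ 2 / B ^ 2 := by rw [lt_div_iff₀ (by positivity)]; linarith
  -- 1/c² is the midpoint of a and ‖v‖²/B², so c·v has local norm below 1 and Euclidean norm above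
  -- B. This also covers a = 0.
  set c := Real.sqrt (2 / (a + ‖v‖ ^ 2 / B ^ 2))
  have hden : 0 < a + ‖v‖ ^ 2 / B ^ 2 := by linarith
  have hc2 : c ^ 2 = 2 / (a + ‖v‖ ^ 2 / B ^ 2) := Real.sq_sqrt (by positivity)
  have hin : x + c • v ∈ interior X := by
    refine hb.dikin hx ?_
    rw [map_smul, inner_smul_left, inner_smul_right]
    simp only [conj_trivial]
    rw [← mul_assoc, ← pow_two, hc2, div_mul_eq_mul_div, div_lt_one hden]
    linarith
  have h1 := hB _ (interior_subset hin) _ (interior_subset hx)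
  rw [add_sub_cancel_left] at h1
  have h2 : ‖c • v‖ ^ 2 ≤ B ^ 2 := pow_le_pow_left₀ (norm_nonneg _) h1 2
  rw [norm_smul, mul_pow, Real.norm_eq_abs, sq_abs, hc2, div_mul_eq_mul_div, div_le_iff₀ hden] at h2
  have h3 : B ^ 2 * (‖v‖ ^ 2 / B ^ 2) = ‖v‖ ^ 2 := by field_simp
  rw [mul_add, h3] at h2
  linarith

theorem segment_mem (hX : Convex ℝ X) {x y : Act d} (hx : x ∈ interior X) (hy : y ∈ interior X)
    {s : ℝ} (hs : s ∈ Icc (0 : ℝ) 1) : x + s • (y - x) ∈ interior X :=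
  hX.interior.add_smul_sub_mem hx hy hs

theorem bregman_nonneg (hb : IsSelfConcordantBarrier ν X h) (hX : Convex ℝ X) {x y : Act d}
    (hx : x ∈ interior X) (hy : y ∈ interior X) : 0 ≤ bregman h y x := by
  have := le_bregman_of_le_hess (f := h) (x := x) (y := y) (m := 0)
    (fun s hs => hb.contDiffAt_two (segment_mem hX hx hy hs))
    (fun s hs => hb.hess_nonneg _ (segment_mem hX hx hy hs) _)
  linarith

/-- Within local distance one, the Lipschitz bound on the inverse local norm keeps the curvature
along the segment above a quarter of its initial value; Taylor supplies the remaining 1/2. -/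
theorem bregman_ge_of_le_one (hb : IsSelfConcordantBarrier ν X h) (hX : Convex ℝ X) {x y : Act d}
    (hx : x ∈ interior X) (hy : y ∈ interior X)
    (hr : inner ℝ (hess h x (y - x)) (y - x) ≤ 1) :
    inner ℝ (hess h x (y - x)) (y - x) / 8 ≤ bregman h y x := by
  set v := y - x with hv
  set a0 := inner ℝ (hess h x v) v with ha0
  have h0 : 0 ≤ a0 := hb.hess_nonneg x hx v
  have key : ∀ s ∈ Icc (0 : ℝ) 1, a0 / 4 ≤ inner ℝ (hess h (x + s • v) v) v := by
    intro s hs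
    set a := inner ℝ (hess h (x + s • v) v) v
    have ha : 0 ≤ a := hb.hess_nonneg _ (segment_mem hX hx hy hs) v
    -- From p⁻¹ ≤ q⁻¹ + 1 follows q ≤ p(1 + q), and (1 + q)² ≤ 2(1 + q²) ≤ 4(1 + ε) since a0 ≤ 1.
    -- Then ε tends to 0.
    have hε : ∀ ε : ℝ, 0 < ε → a0 ≤ (a + ε) * (4 * (1 + ε)) := by
      intro ε hε
      have h1 := hb.abs_rpow_sub_le (x := x) (v := v) hε hs.1
        fun u hu => segment_mem hX hx hy ⟨hu.1, hu.2.trans hs.2⟩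
      rw [rpow_neg_half, rpow_neg_half] at h1
      have h2 := (abs_le.1 h1).2
      set p := Real.sqrt (a + ε)
      set q := Real.sqrt (a0 + ε) with hq
      have hp0 : 0 < p := Real.sqrt_pos.2 (by linarith)
      have hq0 : 0 < q := Real.sqrt_pos.2 (by linarith)
      have h3 : p⁻¹ ≤ q⁻¹ + 1 := by linarith [hs.2]
      have h4 : q ≤ p * (1 + q) := by
        have := mul_le_mul_of_nonneg_left h3 (mul_pos hp0 hq0).le
        have e1 : p * q * p⁻¹ = q := by field_simp
        have e2 : p * q * (q⁻¹ + 1) = p * (1 + q) := by field_simp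
        linarith
      have h5 : q ^ 2 ≤ p ^ 2 * (1 + q) ^ 2 := by
        rw [← mul_pow]; exact pow_le_pow_left₀ hq0.le h4 2
      have hq2 : q ^ 2 = a0 + ε := Real.sq_sqrt (by linarith)
      have hp2 : p ^ 2 = a + ε := Real.sq_sqrt (by linarith)
      have h6 : (1 + q) ^ 2 ≤ 4 * (1 + ε) := by nlinarith [sq_nonneg (q - 1)]
      have h7 : p ^ 2 * (1 + q) ^ 2 ≤ p ^ 2 * (4 * (1 + ε)) :=
        mul_le_mul_of_nonneg_left h6 (sq_nonneg _)
      rw [hp2] at h7 h5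
      linarith
    have hlim : Tendsto (fun ε : ℝ => (a + ε) * (4 * (1 + ε))) (𝓝[>] 0) (𝓝 ((a + 0) * (4 * (1 + 0)))) :=
      ((by fun_prop : Continuous fun ε : ℝ => (a + ε) * (4 * (1 + ε))).tendsto 0).mono_left
        nhdsWithin_le_nhds
    have := ge_of_tendsto hlim (by filter_upwards [self_mem_nhdsWithin] with ε h using hε ε h)
    linarith
  have := le_bregman_of_le_hess (f := h) (x := x) (y := y) (m := a0 / 4)
    (fun s hs => hb.contDiffAt_two (segment_mem hX hx hy hs)) key
  linarith

/-- At the point of the segment at local distance one the quadratic bound gives 1/8, and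
`bregman_line_le` propagates it linearly. This linear growth later excludes long steps. -/
theorem bregman_ge_of_one_le (hb : IsSelfConcordantBarrier ν X h) (hX : Convex ℝ X) {x y : Act d}
    (hx : x ∈ interior X) (hy : y ∈ interior X)
    (hr : 1 ≤ inner ℝ (hess h x (y - x)) (y - x)) :
    Real.sqrt (inner ℝ (hess h x (y - x)) (y - x)) / 8 ≤ bregman h y x := by
  set r := Real.sqrt (inner ℝ (hess h x (y - x)) (y - x)) with hrdef
  have hr1 : 1 ≤ r := Real.one_le_sqrt.2 hr
  have hr2 : r ^ 2 = inner ℝ (hess h x (y - x)) (y - x) := Real.sq_sqrt (by linarith)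
  have hl : r⁻¹ ∈ Icc (0 : ℝ) 1 := ⟨by positivity, inv_le_one_of_one_le₀ hr1⟩
  have hm := segment_mem hX hx hy hl
  have e : x + r⁻¹ • (y - x) - x = r⁻¹ • (y - x) := by abel
  have h1 : inner ℝ (hess h x (x + r⁻¹ • (y - x) - x)) (x + r⁻¹ • (y - x) - x) = 1 := by
    rw [e, map_smul, inner_smul_left, inner_smul_right, ← hr2]
    simp only [conj_trivial]
    field_simp
  have h2 := hb.bregman_ge_of_le_one hX hx hm h1.le
  rw [h1] at h2
  have h3 := bregman_line_le hl.1 hl.2 (hb.bregman_nonneg hX hm hy) (hb.bregman_nonneg hX hm hx)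
  have h4 : 1 / 8 ≤ r⁻¹ * bregman h y x := h2.trans h3
  have h5 := mul_le_mul_of_nonneg_left h4 (by linarith : (0 : ℝ) ≤ r)
  rw [← mul_assoc, mul_inv_cancel₀ (by linarith), one_mul] at h5
  linarith

theorem bregman_pos (hb : IsSelfConcordantBarrier ν X h) (hX : Convex ℝ X)
    (hB : ∀ y ∈ X, ∀ y' ∈ X, ‖y - y'‖ ≤ B) (hB0 : 0 < B) {x y : Act d}
    (hx : x ∈ interior X) (hy : y ∈ interior X) (hne : y ≠ x) : 0 < bregman h y x := by
  have h1 := hb.norm_sq_le hB hB0 hx (y - x)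
  have h2 : 0 < ‖y - x‖ := norm_pos_iff.2 (sub_ne_zero.2 hne)
  have h3 : 0 < inner ℝ (hess h x (y - x)) (y - x) := by
    by_contra! h
    nlinarith [sq_nonneg B, mul_nonneg (sq_nonneg B) (neg_nonneg.2 h), pow_pos h2 2]
  rcases le_total (inner ℝ (hess h x (y - x)) (y - x)) 1 with hr | hr
  · exact lt_of_lt_of_le (by positivity) (hb.bregman_ge_of_le_one hX hx hy hr)
  · exact lt_of_lt_of_le (by positivity) (hb.bregman_ge_of_one_le hX hx hy hr)

/-- Sublevel sets of the barrier are compact subsets of the interior. -/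
theorem isCompact_sublevel (hb : IsSelfConcordantBarrier ν X h) (hX : IsCompact X) (M : ℝ) :
    IsCompact {x | x ∈ interior X ∧ h x ≤ M} := by
  refine hX.of_isClosed_subset (isClosed_of_closure_subset fun b hbc => ?_)
    fun x hx => interior_subset hx.1
  set S := {x | x ∈ interior X ∧ h x ≤ M}
  have hne : (𝓝[S] b).NeBot := mem_closure_iff_nhdsWithin_neBot.1 hbc
  have hmono : 𝓝[S] b ≤ 𝓝[interior X] b := nhdsWithin_mono _ fun x hx => hx.1
  have hev : ∀ᶠ x in 𝓝[S] b, h x ≤ M := by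
    filter_upwards [self_mem_nhdsWithin] with x hx using hx.2
  by_cases hbi : b ∈ interior X
  · refine ⟨hbi, ?_⟩
    have := (hb.contDiffAt hbi).continuousAt.tendsto.mono_left (nhdsWithin_le_nhds (s := S))
    exact le_of_tendsto this hev
  · have hfr : b ∈ frontier X :=
      ⟨closure_mono (fun x hx => interior_subset hx.1) hbc, hbi⟩
    have := (hb.barrier b hfr).mono_left hmono
    obtain ⟨x, hx1, hx2⟩ := ((this.eventually_gt_atTop M).and hev).exists
    exact absurd hx2 (not_le.2 hx1)

/-- For ν ≤ 0 the gradient would vanish, so `h` could not blow up at the boundary, which is nonempty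
because a compact set is not the whole positive-dimensional space. -/
theorem nu_pos (hb : IsSelfConcordantBarrier ν X h) (hX : Convex ℝ X) (hXc : IsCompact X)
    (hd : 1 ≤ d) (hi : (interior X).Nonempty) : 0 < ν := by
  by_contra! hν
  obtain ⟨x, hx⟩ := hi
  have hz : ∀ y ∈ interior X, gradient h y = 0 := fun y hy => by
    have := hb.first_deriv y hy (gradient h y)
    rw [Real.sqrt_eq_zero_of_nonpos hν, zero_mul, real_inner_self_eq_norm_sq] at this
    have h2 := abs_nonpos_iff.1 this
    exact norm_eq_zero.1 (pow_eq_zero_iff two_ne_zero |>.1 h2)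
  have hle : ∀ y ∈ interior X, h y ≤ h x := fun y hy => by
    have := hb.bregman_nonneg hX hy hx
    simp only [bregman, hz y hy, inner_zero_left] at this
    linarith
  have hfr : (frontier X).Nonempty := by
    have : Nontrivial (Act d) := by
      have : Nonempty (Fin d) := ⟨⟨0, hd⟩⟩
      infer_instance
    refine nonempty_frontier_iff.2 ⟨⟨x, interior_subset hx⟩, fun h => ?_⟩
    exact noncompact_univ (Act d) (h ▸ hXc)
  obtain ⟨b, hbf⟩ := hfr
  have hne : (𝓝[interior X] b).NeBot := by
    rw [← mem_closure_iff_nhdsWithin_neBot, hX.closure_interior_eq_closure_of_nonempty_interior ⟨x, hx⟩]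
    exact hbf.1
  obtain ⟨y, hy1, hy2⟩ := (((hb.barrier b hbf).eventually_gt_atTop (h x)).and
    self_mem_nhdsWithin).exists
  exact absurd (hle y hy2) (not_le.2 hy1)

/-- The barrier grows at most logarithmically along segments towards the boundary. -/
theorem le_add_log (hb : IsSelfConcordantBarrier ν X h) (hX : Convex ℝ X) (hν : 0 < ν)
    {x y : Act d} (hx : x ∈ interior X) (hy : y ∈ X) {s : ℝ} (hs0 : 0 ≤ s) (hs1 : s < 1) :
    h (x + s • (y - x)) ≤ h x - ν * Real.log (1 - s) := by
  set v := y - x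
  have hin : ∀ u : ℝ, 0 ≤ u → u < 1 → x + u • v ∈ interior X := fun u h0 h1 => by
    have := hX.combo_interior_self_mem_interior hx hy (a := 1 - u) (b := u) (by linarith) h0 (by ring)
    convert this using 1
    module
  set ψ : ℝ → ℝ := fun u => inner ℝ (gradient h (x + u • v)) v with hψ
  have hψd : ∀ u, 0 ≤ u → u < 1 → HasDerivAt ψ (inner ℝ (hess h (x + u • v) v) v) u :=
    fun u h0 h1 => hasDerivAt_inner_gradient_line (hb.contDiffAt_two (hin u h0 h1))
  have hψν : ∀ u, 0 ≤ u → u < 1 → ψ u ^ 2 ≤ ν * inner ℝ (hess h (x + u • v) v) v := by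
    intro u h0 h1
    have h2 := hb.first_deriv _ (hin u h0 h1) v
    have h3 := pow_le_pow_left₀ (abs_nonneg _) h2 2
    rwa [sq_abs, mul_pow, Real.sq_sqrt hν.le, Real.sq_sqrt (hb.hess_nonneg _ (hin u h0 h1) v)] at h3
  -- Riccati comparison: ψ² ≤ ν ψ' makes -1/ψ - u/ν nondecreasing wherever ψ > 0, so a value above
  -- ν/(1 - u0) would force blow-up before time 1.
  have hψb : ∀ u, 0 ≤ u → u < 1 → ψ u ≤ ν / (1 - u) := by
    intro u0 h0 h1
    by_contra! hlt
    have hpos0 : 0 < ψ u0 := lt_trans (div_pos hν (by linarith)) hlt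
    have hI : ∀ u ∈ Ico u0 1, 0 ≤ u ∧ u < 1 := fun u hu => ⟨h0.trans hu.1, hu.2⟩
    have hmono : MonotoneOn ψ (Ico u0 1) :=
      monotoneOn_of_hasDerivWithinAt_nonneg (convex_Ico _ _)
        (fun u hu => (hψd u (hI u hu).1 (hI u hu).2).continuousAt.continuousWithinAt)
        (fun u hu => (hψd u (hI u (interior_subset hu)).1
          (hI u (interior_subset hu)).2).hasDerivWithinAt)
        (fun u hu => hb.hess_nonneg _ (hin u (hI u (interior_subset hu)).1
          (hI u (interior_subset hu)).2) v)
    have hpos : ∀ u ∈ Ico u0 1, 0 < ψ u := fun u hu =>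
      hpos0.trans_le (hmono ⟨le_rfl, h1⟩ hu hu.1)
    have hdd : ∀ u ∈ Ico u0 1, HasDerivAt (fun u => -(ψ u)⁻¹ - u / ν)
        (inner ℝ (hess h (x + u • v) v) v / ψ u ^ 2 - 1 / ν) u := fun u hu => by
      have := ((hψd u (hI u hu).1 (hI u hu).2).inv (hpos u hu).ne').neg.sub
        ((hasDerivAt_id u).div_const ν)
      refine this.congr_deriv ?_
      ring
    have hmono2 : MonotoneOn (fun u => -(ψ u)⁻¹ - u / ν) (Ico u0 1) :=
      monotoneOn_of_hasDerivWithinAt_nonneg (convex_Ico _ _)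
        (fun u hu => (hdd u hu).continuousAt.continuousWithinAt)
        (fun u hu => (hdd u (interior_subset hu)).hasDerivWithinAt)
        (fun u hu => by
          have hu' := interior_subset hu
          rw [sub_nonneg, div_le_div_iff₀ hν (pow_pos (hpos u hu') 2)]
          have := hψν u (hI u hu').1 (hI u hu').2
          linarith)
    have hfin : ∀ u ∈ Ico u0 1, (u - u0) / ν ≤ (ψ u0)⁻¹ := fun u hu => by
      have := hmono2 ⟨le_rfl, h1⟩ hu hu.1
      simp only at this
      have h5 := inv_pos.2 (hpos u hu)
      rw [sub_div]; linarith
    have hlim : (1 - u0) / ν ≤ (ψ u0)⁻¹ := by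
      have hne : (𝓝[Ico u0 1] (1 : ℝ)).NeBot := by
        rw [← mem_closure_iff_nhdsWithin_neBot, closure_Ico h1.ne]; exact ⟨h1.le, le_rfl⟩
      refine le_of_tendsto (f := fun u : ℝ => (u - u0) / ν) (x := 𝓝[Ico u0 1] (1 : ℝ)) ?_
        (by filter_upwards [self_mem_nhdsWithin] with u hu using hfin u hu)
      exact ((by fun_prop : Continuous fun u : ℝ => (u - u0) / ν).tendsto 1).mono_left
        nhdsWithin_le_nhds
    have h7 := inv_anti₀ (div_pos (by linarith) hν) hlim
    rw [inv_inv, inv_div] at h7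
    exact absurd h7 (not_le.2 hlt)
  have hd : ∀ u ∈ Icc 0 s, HasDerivAt (fun u : ℝ => -ν * Real.log (1 - u) - h (x + u • v))
      (ν / (1 - u) - ψ u) u := fun u hu => by
    have hu1 : u < 1 := hu.2.trans_lt hs1
    have h1 : HasDerivAt (fun u : ℝ => 1 - u) (-1) u := by
      simpa using (hasDerivAt_id u).const_sub 1
    have h2 := (h1.log (by linarith)).const_mul (-ν)
    have h3 := h2.sub (hasGradientAt_line (f := h) (x := x) (v := v) (s := u)
      ((hb.contDiffAt (hin u hu.1 hu1)).differentiableAt (by norm_num)))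
    refine h3.congr_deriv ?_
    ring
  have hmono : MonotoneOn (fun u : ℝ => -ν * Real.log (1 - u) - h (x + u • v)) (Icc 0 s) :=
    monotoneOn_of_hasDerivWithinAt_nonneg (convex_Icc _ _)
      (fun u hu => (hd u hu).continuousAt.continuousWithinAt)
      (fun u hu => (hd u (interior_subset hu)).hasDerivWithinAt)
      (fun u hu => by
        have hu' := interior_subset hu
        exact sub_nonneg.2 (hψb u hu'.1 (hu'.2.trans_lt hs1)))
  have := hmono ⟨le_rfl, hs0⟩ ⟨hs0, le_rfl⟩ hs0
  simp at this
  linarith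

end IsSelfConcordantBarrier

/-! ### The inverse square root of the Hessian. -/

section Scaling
open Set Filter Topology

variable {d : ℕ} {A M : Act d →L[ℝ] Act d}

theorem clm_mul_eq_one_comm {S T : Act d →L[ℝ] Act d} (h : S * T = 1) : T * S = 1 := by
  have h1 : (S : Act d →ₗ[ℝ] Act d) * (T : Act d →ₗ[ℝ] Act d) = 1 := by
    ext1 v; exact congrArg (fun L : Act d →L[ℝ] Act d => L v) h
  have h2 := mul_eq_one_comm.1 h1
  ext1 v
  exact congrArg (fun L : Act d →ₗ[ℝ] Act d => L v) h2

theorem scaling_inverse (h : A * A * M = 1) : A.inverse = A * M := by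
  have h1 : A * (A * M) = 1 := by rw [← mul_assoc]; exact h
  exact ContinuousLinearMap.inverse_eq h1 (clm_mul_eq_one_comm h1)

theorem scaling_apply_inverse (h : A * A * M = 1) (v : Act d) : A (A.inverse v) = v := by
  rw [scaling_inverse h]
  exact congrArg (fun L : Act d →L[ℝ] Act d => L v) h

theorem scaling_inverse_apply (h : A * A * M = 1) (v : Act d) : A.inverse (A v) = v := by
  rw [scaling_inverse h]
  have h1 : A * (A * M) = 1 := by rw [← mul_assoc]; exact h
  exact congrArg (fun L : Act d →L[ℝ] Act d => L v) (clm_mul_eq_one_comm h1)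

theorem inner_scaling_inverse (hA : A.IsPositive) (h : A * A * M = 1) (z v : Act d) :
    inner ℝ (A.inverse z) v = inner ℝ z (A.inverse v) := by
  conv_lhs => rw [← scaling_apply_inverse h v]
  rw [← hA.isSymmetric.apply_clm, scaling_apply_inverse h]

theorem norm_scaling_inverse_sq (hA : A.IsPositive) (h : A * A * M = 1) (v : Act d) :
    ‖A.inverse v‖ ^ 2 = inner ℝ (M v) v := by
  rw [← real_inner_self_eq_norm_sq]
  have h1 : inner ℝ (A.inverse v) (A.inverse v) = inner ℝ (A.inverse v) (A (M v)) := by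
    rw [scaling_inverse h]; rfl
  rw [h1, ← hA.isSymmetric.apply_clm, scaling_apply_inverse h, real_inner_comm]

theorem inner_hessian_scaling (hA : A.IsPositive) (h : A * A * M = 1) (z : Act d) :
    inner ℝ (M (A z)) (A z) = ‖z‖ ^ 2 := by
  rw [← norm_scaling_inverse_sq hA h, scaling_inverse_apply h]

/-- A positive semidefinite operator is determined by its square. -/
theorem isPositive_eq_of_sq_eq {S T : Act d →L[ℝ] Act d} (hS : S.IsPositive) (hT : T.IsPositive)
    (h : S * S = T * T) : S = T := by
  set D : Act d →ₗ[ℝ] Act d := (S : Act d →ₗ[ℝ] Act d) - T with hD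
  have hsymm : D.IsSymmetric := hS.isSymmetric.sub hT.isSymmetric
  -- On a unit eigenvector v of S - T with eigenvalue l, equality of squares gives l(⟨Sv,v⟩ +
  -- ⟨Tv,v⟩) = 0. If l is not visibly zero, both nonnegative forms vanish at v, and their difference
  -- is l.
  have hker : ∀ i, D (hsymm.eigenvectorBasis rfl i) = 0 := by
    intro i
    set v := hsymm.eigenvectorBasis rfl i
    set l : ℝ := hsymm.eigenvalues rfl i
    have hv : D v = l • v := hsymm.apply_eigenvectorBasis rfl i
    have hST : S v = T v + l • v := by
      rw [← hv]; simp [hD]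
    have hsq : S (S v) = T (T v) := congrArg (fun L : Act d →L[ℝ] Act d => L v) h
    have hS0 : 0 ≤ inner ℝ (S v) v := hS.inner_nonneg_left v
    have hT0 : 0 ≤ inner ℝ (T v) v := hT.inner_nonneg_left v
    have h1 : inner ℝ (S (S v)) v = inner ℝ (S v) (S v) := hS.isSymmetric _ _
    have h2 : inner ℝ (T (T v)) v = inner ℝ (T v) (T v) := hT.isSymmetric _ _
    have h3 : inner ℝ (S v) (S v) = inner ℝ (T v) (T v) := by rw [← h1, ← h2, hsq]
    have h4 : l * (inner ℝ (S v) v + inner ℝ (T v) v) = 0 := by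
      have : inner ℝ (S v - T v) (S v + T v) = (0 : ℝ) := by
        rw [inner_sub_left, inner_add_right, inner_add_right, h3, real_inner_comm (S v) (T v)]
        ring
      rw [show S v - T v = l • v by rw [hST]; abel, inner_smul_left, inner_add_right,
        real_inner_comm (S v) v, real_inner_comm (T v) v] at this
      simpa using this
    rcases mul_eq_zero.1 h4 with h5 | h5
    · rw [hv, h5, zero_smul]
    · have h6 : inner ℝ (S v) v = 0 := by linarith
      have h7 : inner ℝ (T v) v = 0 := by linarith
      rw [hST, inner_add_left, h7, inner_smul_left, real_inner_self_eq_norm_sq,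
        (hsymm.eigenvectorBasis rfl).norm_eq_one] at h6
      have : l = 0 := by simpa using h6
      rw [hv, this, zero_smul]
  have hD0 : D = 0 := (hsymm.eigenvectorBasis rfl).toBasis.ext fun i => by simpa using hker i
  ext1 v
  have := congrArg (fun L : Act d →ₗ[ℝ] Act d => L v) hD0
  simpa [hD, sub_eq_zero] using this

/-- If the Hessian `M` depends measurably on a parameter, so does its inverse square root `A`. -/
theorem measurable_scaling {Ω : Type*} [MeasurableSpace Ω] {A M : Ω → Act d →L[ℝ] Act d}
    (hA : ∀ ω, (A ω).IsPositive) (h : ∀ ω, A ω * A ω * M ω = 1) (hM : Measurable M) :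
    Measurable A := by
  set S : Set (Act d →L[ℝ] Act d) := {T | T.IsPositive ∧ IsUnit T} with hS
  have hSm : MeasurableSet S := by
    refine MeasurableSet.inter (s₁ := {T : Act d →L[ℝ] Act d | T.IsPositive}) ?_ Units.isOpen.measurableSet
    have : {T : Act d →L[ℝ] Act d | T.IsPositive}
        = (⋂ x, ⋂ y, {T | inner ℝ (T x) y = inner ℝ x (T y)}) ∩ ⋂ x, {T | 0 ≤ inner ℝ (T x) x} := by
      ext T
      simp only [mem_inter_iff, mem_iInter]
      exact ContinuousLinearMap.isPositive_def
    rw [this]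
    refine IsClosed.measurableSet (IsClosed.inter ?_ ?_)
    · exact isClosed_iInter fun x => isClosed_iInter fun y =>
        isClosed_eq (by fun_prop) (by fun_prop)
    · exact isClosed_iInter fun x => isClosed_le (by fun_prop) (by fun_prop)
  -- T ↦ T⁻² is continuous and injective on the Borel set of positive invertible operators, hence a
  -- measurable embedding (Lusin–Souslin). As M = A⁻², measurability of M passes to A.
  set f : (Act d →L[ℝ] Act d) → (Act d →L[ℝ] Act d) := fun T => Ring.inverse T * Ring.inverse T
  have hfc : ContinuousOn f S := fun T hT => by
    obtain ⟨u, rfl⟩ := hT.2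
    have := NormedRing.inverse_continuousAt u
    exact (this.mul this).continuousWithinAt
  have hfi : InjOn f S := by
    rintro S ⟨hS, u, rfl⟩ T ⟨hT, w, rfl⟩ hST
    simp only [f, Ring.inverse_unit] at hST
    refine isPositive_eq_of_sq_eq hS hT ?_
    have : u⁻¹ * u⁻¹ = w⁻¹ * w⁻¹ := Units.ext (by simpa using hST)
    have h2 : u * u = w * w := by
      have := congrArg (fun a => a⁻¹) this
      simpa [mul_inv_rev] using this
    exact congrArg Units.val h2
  have hemb := hfc.measurableEmbedding hSm hfi
  have hunit : ∀ ω, IsUnit (A ω) := fun ω => by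
    have h1 : A ω * (A ω * M ω) = 1 := by rw [← mul_assoc]; exact h ω
    exact ⟨⟨A ω, A ω * M ω, h1, clm_mul_eq_one_comm h1⟩, rfl⟩
  have key : Measurable (fun ω => (⟨A ω, hA ω, hunit ω⟩ : S)) := by
    rw [← hemb.measurable_comp_iff]
    convert hM using 1
    ext1 ω
    have h1 : A ω * (A ω * M ω) = 1 := by rw [← mul_assoc]; exact h ω
    have h2 := clm_mul_eq_one_comm h1
    have h3 : Ring.inverse (A ω) = A ω * M ω :=
      Ring.inverse_unit ⟨A ω, A ω * M ω, h1, h2⟩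
    simp only [Function.comp, domRestrict_apply, f, h3]
    rw [← mul_assoc, h2, one_mul] 
  exact measurable_subtype_coe.comp key

end Scaling

/-! ### The smooth regularizer: consequences of a nearly constant Hessian. -/

section SmoothConvex
open Set Filter Topology

variable {d : ℕ} {X : Set (Act d)} {p : Act d → ℝ}

theorem bregman_nonneg_of_hess_nonneg (hX : Convex ℝ X) (hp : ∀ x ∈ X, ContDiffAt ℝ 2 p x)
    (hH : ∀ x ∈ X, ∀ v, 0 ≤ inner ℝ (hess p x v) v) {x y : Act d} (hx : x ∈ X) (hy : y ∈ X) :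
    0 ≤ bregman p y x := by
  have := le_bregman_of_le_hess (f := p) (x := x) (y := y) (m := 0)
    (fun s hs => hp _ (hX.add_smul_sub_mem hx hy hs))
    (fun s hs => hH _ (hX.add_smul_sub_mem hx hy hs) _)
  linarith

theorem continuousOn_hess (hp : ∀ x ∈ X, ContDiffAt ℝ 2 p x) : ContinuousOn (hess p) X :=
  fun x hx => ((hp x hx).gradient_one.fderiv_right (m := 0) (by norm_num)).continuousAt
    |>.continuousWithinAt

theorem continuousOn_gradient (hp : ∀ x ∈ X, ContDiffAt ℝ 2 p x) : ContinuousOn (gradient p) X :=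
  fun x hx => (hp x hx).gradient_one.continuousAt.continuousWithinAt

/-- Uniform continuity of the Hessian on a compact set. -/
theorem exists_hess_close (hXc : IsCompact X) (hp : ∀ x ∈ X, ContDiffAt ℝ 2 p x) {ε : ℝ}
    (hε : 0 < ε) : ∃ ρ > 0, ∀ x ∈ X, ∀ y ∈ X, ‖y - x‖ < ρ → ‖hess p y - hess p x‖ ≤ ε := by
  obtain ⟨ρ, hρ, hu⟩ := Metric.uniformContinuousOn_iff.1
    (hXc.uniformContinuousOn_of_continuous (continuousOn_hess hp)) ε hε
  refine ⟨ρ, hρ, fun x hx y hy hxy => ?_⟩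
  rw [← dist_eq_norm]
  exact (hu y hy x hx (by rwa [dist_eq_norm])).le

theorem norm_smul_sub_lt {x y : Act d} {ρ s : ℝ} (h : ‖y - x‖ < ρ) (hs : s ∈ Icc (0 : ℝ) 1) :
    ‖x + s • (y - x) - x‖ < ρ := by
  rw [add_sub_cancel_left, norm_smul, Real.norm_of_nonneg hs.1]
  exact (mul_le_of_le_one_left (norm_nonneg _) hs.2).trans_lt h

theorem bregman_ge_of_hess_close (hX : Convex ℝ X) (hp : ∀ x ∈ X, ContDiffAt ℝ 2 p x) {ε ρ : ℝ}
    (hρ : ∀ x ∈ X, ∀ y ∈ X, ‖y - x‖ < ρ → ‖hess p y - hess p x‖ ≤ ε) {x y : Act d}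
    (hx : x ∈ X) (hy : y ∈ X) (hxy : ‖y - x‖ < ρ) :
    (inner ℝ (hess p x (y - x)) (y - x) - ε * ‖y - x‖ ^ 2) / 2 ≤ bregman p y x := by
  refine le_bregman_of_le_hess (fun s hs => hp _ (hX.add_smul_sub_mem hx hy hs)) fun s hs => ?_
  set v := y - x
  have h1 := hρ x hx _ (hX.add_smul_sub_mem hx hy hs) (norm_smul_sub_lt hxy hs)
  have h2 : |inner ℝ ((hess p (x + s • v) - hess p x) v) v| ≤ ε * ‖v‖ ^ 2 := by
    refine (abs_real_inner_le_norm _ _).trans ?_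
    rw [pow_two, ← mul_assoc]
    exact mul_le_mul_of_nonneg_right (((hess p (x + s • v) - hess p x).le_opNorm v).trans
      (mul_le_mul_of_nonneg_right h1 (norm_nonneg _))) (norm_nonneg _)
  have h3 := (abs_le.1 h2).1
  rw [sub_apply, inner_sub_left] at h3
  linarith

theorem norm_gradient_sub_sub_le (hX : Convex ℝ X) (hp : ∀ x ∈ X, ContDiffAt ℝ 2 p x) {ε ρ : ℝ}
    (hρ : ∀ x ∈ X, ∀ y ∈ X, ‖y - x‖ < ρ → ‖hess p y - hess p x‖ ≤ ε) {x y : Act d}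
    (hx : x ∈ X) (hy : y ∈ X) (hxy : ‖y - x‖ < ρ) :
    ‖gradient p y - gradient p x - hess p x (y - x)‖ ≤ ε * ‖y - x‖ := by
  have hsub : segment ℝ x y ⊆ X := hX.segment_subset hx hy
  refine (convex_segment x y).norm_image_sub_le_of_norm_hasFDerivWithin_le'
    (f' := fun w => hess p w)
    (fun w hw => (hasFDerivAt_gradient (hp w (hsub hw))).hasFDerivWithinAt)
    (fun w hw => ?_) (left_mem_segment ℝ x y) (right_mem_segment ℝ x y)
  rw [segment_eq_image'] at hw
  obtain ⟨s, hs, rfl⟩ := hw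
  exact hρ x hx _ (hX.add_smul_sub_mem hx hy hs) (norm_smul_sub_lt hxy hs)

end SmoothConvex

/-! ### One mirror step: optimality, three-point identity, stability. -/

section MirrorStep
open Set Filter Topology

variable {d : ℕ} {ν B ζ : ℝ} {X : Set (Act d)} {h p : Act d → ℝ}

theorem hasGradientAt_bregman {f : Act d → ℝ} {x y : Act d} (hf : DifferentiableAt ℝ f y) :
    HasGradientAt (fun w => bregman f w x) (gradient f y - gradient f x) y := by
  have h1 : HasFDerivAt (fun w => inner ℝ (gradient f x) (w - x)) (innerSL ℝ (gradient f x)) y := by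
    simp only [inner_sub_right]
    exact ((innerSL ℝ (gradient f x)).hasFDerivAt (x := y)).sub_const _
  rw [hasGradientAt_iff_hasFDerivAt]
  refine ((hf.hasFDerivAt.sub_const (f x)).sub h1).congr_fderiv ?_
  rw [map_sub, toDual_gradient]
  rfl

/-- First-order optimality of the mirror step. -/
theorem mirror_step_optimality {x y g : Act d} {η σ : ℝ} (hy : y ∈ interior X)
    (hh : DifferentiableAt ℝ h y) (hp : DifferentiableAt ℝ p y)
    (hmin : IsMinOn (fun w => η * inner ℝ w g + σ * bregman p w x + bregman h w x)
      (interior X) y) :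
    η • g + σ • (gradient p y - gradient p x) + (gradient h y - gradient h x) = 0 := by
  have hloc := hmin.isLocalMin (isOpen_interior.mem_nhds hy)
  have h1 : HasFDerivAt (fun w : Act d => inner ℝ w g) (innerSL ℝ g) y := by
    have := (innerSL ℝ g).hasFDerivAt (x := y)
    simpa [real_inner_comm] using this
  have hd := ((h1.const_mul η).add ((hasGradientAt_bregman (x := x) hp).hasFDerivAt.const_mul σ)).add
    (hasGradientAt_bregman (x := x) hh).hasFDerivAt
  have h0 := hloc.hasFDerivAt_eq_zero hd
  refine ext_inner_right ℝ fun v => ?_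
  have := congrArg (fun L : Act d →L[ℝ] ℝ => L v) h0
  simpa [inner_add_left, inner_smul_left, inner_sub_left] using this

/-- The three-point identity for a step satisfying the optimality condition. -/
theorem three_point {x y g : Act d} {η σ : ℝ}
    (hopt : η • g + σ • (gradient p y - gradient p x) + (gradient h y - gradient h x) = 0)
    (u : Act d) :
    bregman h u y + σ * bregman p u y = bregman h u x + σ * bregman p u x
      - bregman h y x - σ * bregman p y x + η * inner ℝ g (u - y) := by
  have h0 := congrArg (fun w => inner ℝ w (u - y)) hopt
  simp only [inner_add_left, inner_smul_left, inner_sub_left, inner_zero_left, conj_trivial] at h0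
  have e : u - x = (u - y) + (y - x) := by abel
  simp only [bregman, e, inner_add_right]
  linarith

/-- The local-norm bound for the stability term of one mirror step. -/
theorem stability_le (hb : IsSelfConcordantBarrier ν X h) (hX : Convex ℝ X)
    (hB : ∀ y ∈ X, ∀ y' ∈ X, ‖y - y'‖ ≤ B) (hB0 : 0 < B)
    (hp : ∀ x ∈ X, ContDiffAt ℝ 2 p x)
    (hH : ∀ x ∈ X, ∀ v, 0 ≤ inner ℝ (hess p x v) v)
    (hζ : ∀ x ∈ X, ∀ v, inner ℝ (hess p x v) v ≤ ζ * ‖v‖ ^ 2) (hζ0 : 0 ≤ ζ)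
    {ε ρ : ℝ} (hε : 0 ≤ ε)
    (hρ : ∀ x ∈ X, ∀ y ∈ X, ‖y - x‖ < ρ → ‖hess p y - hess p x‖ ≤ ε)
    {x y g : Act d} (hx : x ∈ interior X) (hy : y ∈ interior X) {η τ κ γ c : ℝ}
    (hη : 0 ≤ η) (hτ : 0 ≤ τ) (hκ : 0 < κ) (hγ : 0 ≤ γ) (hc0 : 0 ≤ c) (hc1 : c ≤ 1)
    (hopt : η • g + (κ * τ) • (gradient p y - gradient p x) + (gradient h y - gradient h x) = 0)
    (hg : |inner ℝ g (y - x)| ≤ γ * c * Real.sqrt (inner ℝ (hess h x (y - x)) (y - x)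
      + τ * inner ℝ (hess p x (y - x)) (y - x)))
    (hs1 : η * γ * Real.sqrt (1 + τ * ζ * B ^ 2) < 1 / 8)
    (hs2 : 8 * (η * γ * Real.sqrt (1 + τ * ζ * B ^ 2)) * B < ρ) :
    -(η * inner ℝ g (y - x)) - bregman h y x - κ * τ * bregman p y x
      ≤ η ^ 2 * γ ^ 2 * c ^ 2 * (8 * (1 + τ * ε * B ^ 2) + 2 / κ) / 4 := by
  have hxX := interior_subset hx
  have hyX := interior_subset hy
  set v := y - x with hv
  set a := inner ℝ (hess h x v) v with ha
  set b := inner ℝ (hess p x v) v with hbdef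
  set s := η * γ * Real.sqrt (1 + τ * ζ * B ^ 2) with hs
  have ha0 : 0 ≤ a := hb.hess_nonneg x hx v
  have hb0 : 0 ≤ b := hH x hxX v
  have hs0 : 0 ≤ s := by positivity
  have hva : ‖v‖ ^ 2 ≤ B ^ 2 * a := hb.norm_sq_le hB hB0 hx v
  have hDp : 0 ≤ bregman p y x := bregman_nonneg_of_hess_nonneg hX hp hH hxX hyX
  have hDh : 0 ≤ bregman h y x := hb.bregman_nonneg hX hx hy
  -- the step is short
  have hshort : bregman h y x ≤ s * Real.sqrt a := by
    have h1 := three_point hopt x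
    have h2 := bregman_nonneg_of_hess_nonneg hX hp hH hyX hxX
    have h3 := hb.bregman_nonneg hX hy hx
    rw [bregman_self, bregman_self, show x - y = -v by rw [hv]; abel, inner_neg_right] at h1
    have h4 : bregman h y x ≤ η * |inner ℝ g v| := by
      have h5 : 0 ≤ κ * τ * bregman p x y := by positivity
      have h6 : 0 ≤ κ * τ * bregman p y x := by positivity
      have h7 : -inner ℝ g v ≤ |inner ℝ g v| := neg_le_abs _
      have h8 := mul_le_mul_of_nonneg_left h7 hη
      linarith
    refine h4.trans ?_
    have h5 : a + τ * b ≤ (1 + τ * ζ * B ^ 2) * a := by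
      have h6 : b ≤ ζ * (B ^ 2 * a) := (hζ x hxX v).trans (mul_le_mul_of_nonneg_left hva hζ0)
      nlinarith [mul_le_mul_of_nonneg_left h6 hτ]
    have h7 : Real.sqrt (a + τ * b) ≤ Real.sqrt (1 + τ * ζ * B ^ 2) * Real.sqrt a := by
      rw [← Real.sqrt_mul (by positivity)]; exact Real.sqrt_le_sqrt h5
    calc η * |inner ℝ g v| ≤ η * (γ * c * Real.sqrt (a + τ * b)) :=
          mul_le_mul_of_nonneg_left hg hη
      _ ≤ η * (γ * 1 * (Real.sqrt (1 + τ * ζ * B ^ 2) * Real.sqrt a)) := by gcongr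
      _ = s * Real.sqrt a := by rw [hs]; ring
  set r := Real.sqrt a with hr
  have hr0 : 0 ≤ r := Real.sqrt_nonneg _
  have hr2 : r ^ 2 = a := Real.sq_sqrt ha0
  -- Outside the unit local ball the divergence is at least r/8, which contradicts D_h ≤ s·r with s
  -- < 1/8.
  have har : a ≤ 1 := by
    by_contra! hlt
    have h1 := hb.bregman_ge_of_one_le hX hx hy hlt.le
    have h2 : 0 < r := Real.sqrt_pos.2 (by linarith)
    have h3 : r / 8 ≤ s * r := h1.trans hshort
    nlinarith
  have hDa : a / 8 ≤ bregman h y x := hb.bregman_ge_of_le_one hX hx hy har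
  have hr8 : r ≤ 8 * s := by
    have h3 : r ^ 2 / 8 ≤ s * r := by rw [hr2]; exact hDa.trans hshort
    rcases hr0.eq_or_lt with h0 | h0
    · rw [← h0]; positivity
    · nlinarith
  have hvρ : ‖v‖ < ρ := by
    have h1 : ‖v‖ ≤ B * r := by
      refine le_of_sq_le_sq ?_ (by positivity)
      rw [mul_pow, hr2]; exact hva
    nlinarith
  have hDp2 := bregman_ge_of_hess_close hX hp hρ hxX hyX hvρ
  rw [← hv, ← hbdef] at hDp2
  -- compare the dual norm with the divergences
  set D := bregman h y x + κ * τ * bregman p y x with hD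
  have hD0 : 0 ≤ D := by positivity
  -- The 8 comes from a ≤ 8 D_h, the 2/κ from b ≤ 2 D_p + ε‖v‖², and τεB² from ‖v‖² ≤ B² a.
  set C := 8 * (1 + τ * ε * B ^ 2) + 2 / κ with hC
  have hC0 : 0 ≤ C := by positivity
  have hkey : a + τ * b ≤ C * D := by
    have h1 : b ≤ 2 * bregman p y x + ε * (B ^ 2 * a) := by
      linarith [mul_le_mul_of_nonneg_left hva hε]
    have h2 : a + τ * b ≤ (1 + τ * ε * B ^ 2) * a + 2 * τ * bregman p y x := by
      linarith [mul_le_mul_of_nonneg_left h1 hτ]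
    have h3 : (1 + τ * ε * B ^ 2) * a ≤ (1 + τ * ε * B ^ 2) * (8 * bregman h y x) :=
      mul_le_mul_of_nonneg_left (by linarith) (by positivity)
    have h4 : 2 * τ * bregman p y x = 2 / κ * (κ * τ * bregman p y x) := by field_simp
    have h5 : 0 ≤ κ * τ * bregman p y x := by positivity
    have h6 : 0 ≤ 2 / κ * bregman h y x := by positivity
    have h7 : 0 ≤ 8 * (1 + τ * ε * B ^ 2) * (κ * τ * bregman p y x) := by positivity
    rw [hC, hD, add_mul, mul_add, mul_add]
    linarith
  have hfin : -(η * inner ℝ g v) ≤ η * γ * c * (Real.sqrt C * Real.sqrt D) := by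
    have h1 : -inner ℝ g v ≤ γ * c * Real.sqrt (C * D) :=
      (neg_le_abs _).trans (hg.trans (mul_le_mul_of_nonneg_left (Real.sqrt_le_sqrt hkey)
        (by positivity)))
    rw [Real.sqrt_mul hC0] at h1
    linarith [mul_le_mul_of_nonneg_left h1 hη]
  have hCs : Real.sqrt C ^ 2 = C := Real.sq_sqrt hC0
  have hDs : Real.sqrt D ^ 2 = D := Real.sq_sqrt hD0
  -- Completing the square: the linear term in √D is paid for by the divergences D subtracted on the
  -- left of the claim.
  have := sq_nonneg (η * γ * c * Real.sqrt C / 2 - Real.sqrt D)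
  have e : (η * γ * c * Real.sqrt C / 2 - Real.sqrt D) ^ 2
      = η ^ 2 * γ ^ 2 * c ^ 2 * C / 4 - η * γ * c * (Real.sqrt C * Real.sqrt D) + D := by
    linear_combination (η * γ * c) ^ 2 / 4 * hCs + hDs
  linarith

end MirrorStep

/-! ### The gradient inequality. -/

section Convexity
open Set Filter Topology

/-- Convexity bounds the difference quotients along the segment by g y' - g y, and they converge to
the directional derivative. Differentiability is needed only at y, so y' may be a boundary point. -/
theorem ConvexOn.add_fderiv_le {E : Type*} [NormedAddCommGroup E] [NormedSpace ℝ E] {s : Set E}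
    {g : E → ℝ} {g' : E →L[ℝ] ℝ} {y y' : E} (hg : ConvexOn ℝ s g) (hd : HasFDerivAt g g' y)
    (hy : y ∈ s) (hy' : y' ∈ s) : g y + g' (y' - y) ≤ g y' := by
  have h1 : HasDerivAt (fun t : ℝ => y + t • (y' - y)) (y' - y) 0 := by
    simpa using ((hasDerivAt_id (0 : ℝ)).smul_const (y' - y)).const_add y
  have h2 : HasDerivAt (fun t : ℝ => g (y + t • (y' - y))) (g' (y' - y)) 0 := by
    have hd' : HasFDerivAt g g' (y + (0 : ℝ) • (y' - y)) := by simpa using hd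
    exact hd'.comp_hasDerivAt (0 : ℝ) h1
  have h3 := (hasDerivAt_iff_tendsto_slope_zero.1 h2).mono_left (nhdsGT_le_nhdsNE (0 : ℝ))
  have h4 : g' (y' - y) ≤ g y' - g y := by
    refine le_of_tendsto h3 ?_
    filter_upwards [Ioo_mem_nhdsGT (zero_lt_one (α := ℝ))] with t ht
    have h5 := hg.2 hy hy' (show (0 : ℝ) ≤ 1 - t by linarith [ht.2]) ht.1.le (by ring)
    have h6 : ((1 : ℝ) - t) • y + t • y' = y + t • (y' - y) := by module
    rw [h6] at h5
    simp only [zero_add, zero_smul, add_zero, smul_eq_mul] at h5 ⊢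
    rw [inv_mul_le_iff₀ ht.1]
    linarith
  linarith

end Convexity

/-! ### Bias of the one-point gradient estimator. -/

section Estimator
open Set Filter Topology

variable {d : ℕ}

instance [NeZero d] : IsProbabilityMeasure (uniformSphere d) := by
  refine ⟨?_⟩
  have : Nontrivial (Act d) := by
    have : Nonempty (Fin d) := ⟨0⟩
    infer_instance
  rw [uniformSphere, Measure.smul_apply, smul_eq_mul]
  refine ENNReal.inv_mul_cancel ?_ (measure_ne_top _ _)
  rw [Ne, Measure.measure_univ_eq_zero]
  exact Measure.toSphere_ne_zero _

theorem integrable_uniformSphere [NeZero d] {F : Sph d → ℝ} (hF : Continuous F) :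
    Integrable F (uniformSphere d) :=
  hF.integrable_of_hasCompactSupport (HasCompactSupport.of_compactSpace F)

/-- Sphere averages as ball averages. -/
theorem integral_uniformSphere_mul_inner [NeZero d] {F : Act d → ℝ} (w : Act d)
    (hf : ∀ x ∈ Metric.closedBall (0 : Act d) 1, DifferentiableAt ℝ F x)
    (hf' : ContinuousOn (fun x => fderiv ℝ F x w) (Metric.closedBall 0 1)) :
    (d : ℝ) * ∫ z, F z * inner ℝ (z : Act d) w ∂uniformSphere d
      = ⨍ x in Metric.ball (0 : Act d) 1, fderiv ℝ F x w := by
  have : Nontrivial (Act d) := by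
    have : Nonempty (Fin d) := ⟨0⟩
    infer_instance
  rw [uniformSphere, integral_smul_measure, integral_sphere_mul_inner w hf hf', setAverage_eq,
    ENNReal.toReal_inv]
  have h1 : ((volume : Measure (Act d)).toSphere univ).toReal
      = d * (volume : Measure (Act d)).real (Metric.ball 0 1) := by
    have := Measure.toSphere_real_apply_univ (volume : Measure (Act d))
    rwa [finrank_euclideanSpace_fin] at this
  have hd : (d : ℝ) ≠ 0 := Nat.cast_ne_zero.2 (NeZero.ne d)
  rw [h1, smul_eq_mul, smul_eq_mul, mul_inv, ← mul_assoc, ← mul_assoc, mul_inv_cancel₀ hd, one_mul]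

theorem integral_uniformSphere_inner [NeZero d] (w : Act d) :
    ∫ z, inner ℝ (z : Act d) w ∂uniformSphere d = 0 := by
  have h := integral_uniformSphere_mul_inner (F := fun _ : Act d => (1 : ℝ)) w
    (fun _ _ => by fun_prop) (by simpa using continuousOn_const)
  have hd : (d : ℝ) ≠ 0 := Nat.cast_ne_zero.2 (NeZero.ne d)
  simpa [hd] using h

theorem setAverage_ball_clm (L : Act d →L[ℝ] ℝ) : ⨍ x in Metric.ball (0 : Act d) 1, L x = 0 := by
  rw [setAverage_eq]
  have h : ∫ x in Metric.ball (0 : Act d) 1, L x = - ∫ x in Metric.ball (0 : Act d) 1, L x := by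
    rw [← integral_neg, ← integral_indicator measurableSet_ball,
      ← integral_indicator measurableSet_ball, ← integral_neg_eq_self]
    refine integral_congr_ae (.of_forall fun x => ?_)
    change (Metric.ball (0 : Act d) 1).indicator (fun x => L x) (-x) = _
    by_cases hx : x ∈ Metric.ball (0 : Act d) 1
    · rw [indicator_of_mem hx, indicator_of_mem (by simpa using hx)]; simp
    · rw [indicator_of_notMem hx, indicator_of_notMem (by simpa using hx)]
  have : ∫ x in Metric.ball (0 : Act d) 1, L x = 0 := by linarith
  rw [this, smul_zero]

variable {ν B ζ ℓ κ τ ε ρ δ : ℝ} {X : Set (Act d)} {h p f : Act d → ℝ} {x u : Act d}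
  {A : Act d →L[ℝ] Act d}

/-- `A` carries the unit ball to the unit ellipsoid of the full Hessian, and discarding the
nonnegative part from `p` places it inside the Dikin ellipsoid of `h`. -/
theorem inner_hess_scaling_le (hA : A.IsPositive)
    (hAM : A * A * (hess h x + τ • hess p x) = 1) (hτ : 0 ≤ τ)
    (hH : ∀ v, 0 ≤ inner ℝ (hess p x v) v) (z : Act d) :
    inner ℝ (hess h x (A z)) (A z) ≤ ‖z‖ ^ 2 := by
  have h1 := inner_hessian_scaling hA hAM z
  rw [add_apply, inner_add_left, smul_apply, inner_smul_left] at h1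
  simp only [conj_trivial] at h1
  have := mul_nonneg hτ (hH (A z))
  linarith

theorem IsSelfConcordantBarrier.norm_scaling_le (hb : IsSelfConcordantBarrier ν X h)
    (hB : ∀ y ∈ X, ∀ y' ∈ X, ‖y - y'‖ ≤ B) (hB0 : 0 < B) (hx : x ∈ interior X)
    (hA : A.IsPositive) (hAM : A * A * (hess h x + τ • hess p x) = 1) (hτ : 0 ≤ τ)
    (hH : ∀ v, 0 ≤ inner ℝ (hess p x v) v) (z : Act d) : ‖A z‖ ≤ B * ‖z‖ := by
  have h1 := hb.norm_sq_le hB hB0 hx (A z)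
  have h2 := inner_hess_scaling_le hA hAM hτ hH z
  refine le_of_sq_le_sq ?_ (by positivity)
  rw [mul_pow]
  exact h1.trans (mul_le_mul_of_nonneg_left h2 (sq_nonneg _))

theorem IsSelfConcordantBarrier.sample_mem_interior (hb : IsSelfConcordantBarrier ν X h)
    (hx : x ∈ interior X)
    (hA : A.IsPositive) (hAM : A * A * (hess h x + τ • hess p x) = 1) (hτ : 0 ≤ τ)
    (hH : ∀ v, 0 ≤ inner ℝ (hess p x v) v) (hδ0 : 0 ≤ δ) (hδ1 : δ < 1) {z : Act d}
    (hz : ‖z‖ ≤ 1) : x + δ • A z ∈ interior X := by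
  refine hb.dikin hx ?_
  have h2 := inner_hess_scaling_le hA hAM hτ hH z
  have h0 := hb.hess_nonneg x hx (A z)
  rw [map_smul, inner_smul_left, inner_smul_right]
  simp only [conj_trivial]
  have h3 : ‖z‖ ^ 2 ≤ 1 := pow_le_one₀ (norm_nonneg _) hz
  have h4 : δ * (δ * inner ℝ (hess h x (A z)) (A z)) ≤ δ * (δ * 1) := by gcongr; linarith
  nlinarith

theorem IsSelfConcordantBarrier.sample_mem (hb : IsSelfConcordantBarrier ν X h)
    (hX : IsClosed X) (hx : x ∈ interior X)
    (hA : A.IsPositive) (hAM : A * A * (hess h x + τ • hess p x) = 1) (hτ : 0 ≤ τ)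
    (hH : ∀ v, 0 ≤ inner ℝ (hess p x v) v) (hδ0 : 0 ≤ δ) (hδ1 : δ ≤ 1) {z : Act d}
    (hz : ‖z‖ ≤ 1) : x + δ • A z ∈ X := by
  refine hb.dikin_closed hX hx ?_
  have h2 := inner_hess_scaling_le hA hAM hτ hH z
  have h0 := hb.hess_nonneg x hx (A z)
  rw [map_smul, inner_smul_left, inner_smul_right]
  simp only [conj_trivial]
  have h3 : ‖z‖ ^ 2 ≤ 1 := pow_le_one₀ (norm_nonneg _) hz
  have h4 : δ * (δ * inner ℝ (hess h x (A z)) (A z)) ≤ 1 * (1 * 1) := by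
    gcongr; linarith
  linarith

/-- The one-point gradient estimator bounds the regret of the sampled point in expectation. -/
theorem IsSelfConcordantBarrier.integral_estimator_le [NeZero d]
    (hb : IsSelfConcordantBarrier ν X h) (hX : Convex ℝ X)
    (hB : ∀ y ∈ X, ∀ y' ∈ X, ‖y - y'‖ ≤ B) (hB0 : 0 < B)
    (hfd : DifferentiableOn ℝ f X) (hfc : ConvexOn ℝ X f)
    (hℓ : ∀ y ∈ X, ∀ y' ∈ X, ‖gradientWithin f X y - gradientWithin f X y'‖ ≤ ℓ * ‖y - y'‖)
    (hℓ0 : 0 ≤ ℓ) (hκ : 0 ≤ κ) (hqc : ConvexOn ℝ X (fun y => f y - κ * p y))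
    (hp : ∀ x ∈ X, ContDiffAt ℝ 2 p x) (hH : ∀ x ∈ X, ∀ v, 0 ≤ inner ℝ (hess p x v) v)
    (hε : 0 ≤ ε) (hρ : ∀ x ∈ X, ∀ y ∈ X, ‖y - x‖ < ρ → ‖hess p y - hess p x‖ ≤ ε)
    (hx : x ∈ interior X) (hA : A.IsPositive)
    (hAM : A * A * (hess h x + τ • hess p x) = 1) (hτ : 0 ≤ τ)
    (hδ0 : 0 < δ) (hδ1 : δ < 1) (hδρ : δ * B < ρ) (hu : u ∈ X) :
    ∫ z : Sph d, ((d : ℝ) / δ * f (x + δ • A z) * inner ℝ (A.inverse z) (u - x)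
        + f (x + δ • A z)) ∂uniformSphere d
      ≤ f u - κ * bregman p u x + (2 * ℓ * δ ^ 2 * B ^ 2 + κ * ε * δ * B ^ 2) := by
  have hxX := interior_subset hx
  have hin : ∀ z ∈ Metric.closedBall (0 : Act d) 1, x + δ • A z ∈ interior X := fun z hz =>
    hb.sample_mem_interior hx hA hAM hτ (hH x hxX) hδ0.le hδ1 (mem_closedBall_zero_iff.1 hz)
  have hAn : ∀ z ∈ Metric.closedBall (0 : Act d) 1, ‖δ • A z‖ ≤ δ * B := fun z hz => by
    rw [norm_smul, Real.norm_of_nonneg hδ0.le]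
    have h1 := hb.norm_scaling_le hB hB0 hx hA hAM hτ (hH x hxX) z
    have h2 := mem_closedBall_zero_iff.1 hz
    gcongr
    nlinarith
  have hdiff : ∀ y ∈ interior X, DifferentiableAt ℝ f y := fun y hy =>
    (hfd y (interior_subset hy)).differentiableAt (mem_interior_iff_mem_nhds.1 hy)
  have hgw : ∀ y ∈ interior X, gradientWithin f X y = gradient f y := fun y hy => by
    rw [gradientWithin, gradient, fderivWithin_of_mem_nhds (mem_interior_iff_mem_nhds.1 hy)]
  have hlip : ∀ y ∈ interior X, ∀ y' ∈ interior X,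
      ‖gradient f y - gradient f y'‖ ≤ ℓ * ‖y - y'‖ := fun y hy y' hy' => by
    rw [← hgw y hy, ← hgw y' hy']; exact hℓ y (interior_subset hy) y' (interior_subset hy')
  have hgc : ContinuousOn (gradient f) (interior X) :=
    (LipschitzOnWith.of_dist_le_mul (K := ⟨ℓ, hℓ0⟩) fun y hy y' hy' => by
      rw [dist_eq_norm, dist_eq_norm]; exact hlip y hy y' hy').continuousOn
  have hfirst : ∀ y ∈ interior X, ∀ y' ∈ X, f y + inner ℝ (gradient f y) (y' - y) ≤ f y' :=
    fun y hy y' hy' => by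
      rw [inner_gradient_left]
      exact hfc.add_fderiv_le (hdiff y hy).hasFDerivAt (interior_subset hy) hy'
  have hline : Continuous fun z : Act d => x + δ • A z := by fun_prop
  have hFd : ∀ z ∈ Metric.closedBall (0 : Act d) 1, HasFDerivAt (fun z => f (x + δ • A z))
      ((fderiv ℝ f (x + δ • A z)) ∘L (δ • A)) z := fun z hz =>
    (hdiff _ (hin z hz)).hasFDerivAt.comp z
      (((δ • A).hasFDerivAt (x := z)).const_add x)
  -- Chosen so that differentiating z ↦ f(x + δAz) along w is differentiating f along u - x.
  set w := δ⁻¹ • A.inverse (u - x) with hw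
  have hFw : ∀ z ∈ Metric.closedBall (0 : Act d) 1, fderiv ℝ (fun z => f (x + δ • A z)) z w
      = inner ℝ (gradient f (x + δ • A z)) (u - x) := fun z hz => by
    rw [(hFd z hz).fderiv, inner_gradient_left, hw]
    simp only [ContinuousLinearMap.comp_apply, smul_apply, map_smul]
    rw [scaling_apply_inverse hAM, smul_smul, inv_mul_cancel₀ hδ0.ne', one_smul]
  have hcontB : ContinuousOn (fun z => inner ℝ (gradient f (x + δ • A z)) (u - x))
      (Metric.closedBall (0 : Act d) 1) :=
    (hgc.comp hline.continuousOn hin).inner continuousOn_const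
  have hstokes := integral_uniformSphere_mul_inner (F := fun z => f (x + δ • A z)) w
    (fun z hz => (hFd z hz).differentiableAt) (hcontB.congr hFw)
  have hS : ∀ z : Sph d, (z : Act d) ∈ Metric.closedBall (0 : Act d) 1 := fun z =>
    Metric.sphere_subset_closedBall z.2
  have hFcont : Continuous fun z : Sph d => f (x + δ • A z) := by
    have hfc' : ContinuousOn f (interior X) := fun y hy => (hdiff y hy).continuousAt.continuousWithinAt
    exact hfc'.comp_continuous (hline.comp continuous_subtype_val) fun z => hin z (hS z)
  have hAinv : Continuous fun z : Sph d => inner ℝ (A.inverse (z : Act d)) (u - x) := by fun_prop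
  rw [integral_add (f := fun z : Sph d =>
      (d : ℝ) / δ * f (x + δ • A z) * inner ℝ (A.inverse z) (u - x))
    (integrable_uniformSphere ((continuous_const.mul hFcont).mul hAinv))
    (integrable_uniformSphere hFcont)]
  -- the gradient part
  have hgrad : ∫ z : Sph d, (d : ℝ) / δ * f (x + δ • A z) * inner ℝ (A.inverse z) (u - x)
      ∂uniformSphere d = ⨍ z in Metric.ball (0 : Act d) 1,
        inner ℝ (gradient f (x + δ • A z)) (u - x) := by
    calc _ = (d : ℝ) * ∫ z : Sph d, f (x + δ • A z) * inner ℝ (z : Act d) w ∂uniformSphere d := by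
          rw [← integral_const_mul]
          refine integral_congr_ae (.of_forall fun z => ?_)
          simp only [hw, inner_smul_right, inner_scaling_inverse hA hAM]
          ring
      _ = _ := by
          rw [hstokes, setAverage_eq, setAverage_eq]
          congr 1
          exact setIntegral_congr_fun measurableSet_ball fun z hz =>
            hFw z (Metric.ball_subset_closedBall hz)
  set K : ℝ := f u - κ * bregman p u x - f x + (ℓ * δ ^ 2 * B ^ 2 + κ * ε * δ * B ^ 2) with hK
  -- First-order effect of moving the base point of D_p(u, ·) from the sample back to x. It is
  -- linear in z, so it averages to zero over the ball; only the Hessian oscillation ε survives.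
  set L : Act d →L[ℝ] ℝ := (κ * δ) • ((innerSL ℝ (u - x)) ∘L (hess p x ∘L A)) with hL
  have hpoint : ∀ z ∈ Metric.closedBall (0 : Act d) 1,
      inner ℝ (gradient f (x + δ • A z)) (u - x) ≤ K + L z := by
    intro z hz
    set y := x + δ • A z with hy
    have hyi : y ∈ interior X := hin z hz
    have hyX := interior_subset hyi
    have hyx : y - x = δ • A z := by rw [hy]; abel
    have hn : ‖y - x‖ ≤ δ * B := by rw [hyx]; exact hAn z hz
    have h1 : f y - κ * p y + (inner ℝ (gradient f y) (u - y) - κ * inner ℝ (gradient p y) (u - y))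
        ≤ f u - κ * p u := by
      have hd := (hdiff y hyi).hasFDerivAt.sub
        ((((hp y hyX).differentiableAt (by norm_num)).hasFDerivAt).const_mul κ)
      have := hqc.add_fderiv_le hd hyX hu
      rw [inner_gradient_left, inner_gradient_left]
      simpa using this
    have h2 : 0 ≤ bregman p x y := bregman_nonneg_of_hess_nonneg hX hp hH hyX hxX
    have h3 := hfirst x hx y hyX
    have h4 : inner ℝ (gradient f y - gradient f x) (y - x) ≤ ℓ * δ ^ 2 * B ^ 2 := by
      refine (real_inner_le_norm _ _).trans ?_
      calc _ ≤ (ℓ * ‖y - x‖) * ‖y - x‖ := by gcongr; exact hlip y hyi x hx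
        _ ≤ (ℓ * (δ * B)) * (δ * B) := by gcongr
        _ = _ := by ring
    have h5 : inner ℝ (gradient p y - gradient p x - hess p x (y - x)) (u - x)
        ≤ ε * δ * B ^ 2 := by
      refine (real_inner_le_norm _ _).trans ?_
      calc _ ≤ (ε * ‖y - x‖) * B := by
            gcongr
            · exact norm_gradient_sub_sub_le hX hp hρ hxX hyX (hn.trans_lt hδρ)
            · exact hB u hu x hxX
        _ ≤ (ε * (δ * B)) * B := by gcongr
        _ = _ := by ring
    have h6 : L z = κ * inner ℝ (hess p x (y - x)) (u - x) := by
      rw [hyx, hL]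
      simp only [smul_apply, ContinuousLinearMap.comp_apply, innerSL_apply_apply, map_smul,
        inner_smul_left, smul_eq_mul, conj_trivial]
      rw [real_inner_comm]
      ring
    have e1 : u - x = (u - y) + (y - x) := by abel
    have e2 : x - y = -(y - x) := by abel
    rw [h6, hK]
    have h7 := mul_le_mul_of_nonneg_left h5 hκ
    have h8 := mul_nonneg hκ h2
    simp only [bregman, e2, inner_neg_right, inner_sub_left] at h4 h5 h7 h8 ⊢
    have g1 : inner ℝ (gradient f y) (u - x) = inner ℝ (gradient f y) (u - y)
        + inner ℝ (gradient f y) (y - x) := by rw [e1, inner_add_right]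
    have g2 : inner ℝ (gradient p y) (u - x) = inner ℝ (gradient p y) (u - y)
        + inner ℝ (gradient p y) (y - x) := by rw [e1, inner_add_right]
    rw [g2] at h7
    rw [g1]
    linarith
  have hV : (volume : Measure (Act d)).real (Metric.ball 0 1) ≠ 0 :=
    (ENNReal.toReal_pos (Metric.measure_ball_pos _ _ one_pos).ne' measure_ball_lt_top.ne).ne'
  have hgradle : ⨍ z in Metric.ball (0 : Act d) 1,
      inner ℝ (gradient f (x + δ • A z)) (u - x) ≤ K := by
    have hLint : IntegrableOn (fun z => L z) (Metric.ball (0 : Act d) 1) :=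
      (L.continuous.continuousOn.integrableOn_compact (isCompact_closedBall _ _)).mono_set
        Metric.ball_subset_closedBall
    have hKint : IntegrableOn (fun _ : Act d => K) (Metric.ball (0 : Act d) 1) :=
      integrableOn_const measure_ball_lt_top.ne
    have h0 := setAverage_ball_clm L
    rw [setAverage_eq, smul_eq_mul] at h0 ⊢
    have h1 : ∫ z in Metric.ball (0 : Act d) 1, inner ℝ (gradient f (x + δ • A z)) (u - x)
        ≤ ∫ z in Metric.ball (0 : Act d) 1, (K + L z) := by
      refine setIntegral_mono_on ?_ (hKint.add hLint) measurableSet_ball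
        fun z hz => hpoint z (Metric.ball_subset_closedBall hz)
      exact (hcontB.integrableOn_compact (isCompact_closedBall _ _)).mono_set
        Metric.ball_subset_closedBall
    rw [integral_add hKint hLint, setIntegral_const, smul_eq_mul] at h1
    have h2 := mul_le_mul_of_nonneg_left h1
      (inv_nonneg.2 (measureReal_nonneg (μ := (volume : Measure (Act d))) (s := Metric.ball 0 1)))
    rw [mul_add, h0, ← mul_assoc, inv_mul_cancel₀ hV, one_mul, add_zero] at h2
    exact h2
  -- the sampled value
  have hval : ∫ z : Sph d, f (x + δ • A z) ∂uniformSphere d ≤ f x + ℓ * δ ^ 2 * B ^ 2 := by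
    have hlin : ∫ z : Sph d, inner ℝ (gradient f x) (δ • A (z : Act d)) ∂uniformSphere d = 0 := by
      have h1 := integral_uniformSphere_inner (d := d) (δ • A (gradient f x))
      rw [← h1]
      refine integral_congr_ae (.of_forall fun z => ?_)
      simp only [inner_smul_right]
      rw [← hA.isSymmetric.apply_clm, real_inner_comm]
    have hlinc : Continuous fun z : Sph d => inner ℝ (gradient f x) (δ • A (z : Act d)) := by fun_prop
    calc _ ≤ ∫ z : Sph d, ((f x + ℓ * δ ^ 2 * B ^ 2)
          + inner ℝ (gradient f x) (δ • A (z : Act d))) ∂uniformSphere d := by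
          refine integral_mono (integrable_uniformSphere hFcont)
            (integrable_uniformSphere (continuous_const.add hlinc)) fun z => ?_
          have hz := hS z
          have hn := hAn z hz
          have h1 := hfirst _ (hin z hz) x hxX
          have e1 : x - (x + δ • A (z : Act d)) = -(δ • A (z : Act d)) := by abel
          rw [e1, inner_neg_right] at h1
          have h2 : inner ℝ (gradient f (x + δ • A (z : Act d)) - gradient f x) (δ • A (z : Act d))
              ≤ ℓ * δ ^ 2 * B ^ 2 := by
            refine (real_inner_le_norm _ _).trans ?_
            have h3 := hlip _ (hin z hz) x hx
            rw [add_sub_cancel_left] at h3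
            calc _ ≤ (ℓ * (δ * B)) * (δ * B) := by
                  gcongr
                  exact h3.trans (by gcongr)
              _ = _ := by ring
          rw [inner_sub_left] at h2
          simp only
          linarith
      _ = f x + ℓ * δ ^ 2 * B ^ 2 := by
          rw [integral_add (integrable_const _) (integrable_uniformSphere hlinc), hlin,
            integral_const]
          simp
  rw [hgrad]
  linarith

end Estimator

/-! ### Measurability of compositions. -/

section Measurability
open Set Filter Topology

theorem ContinuousOn.measurable_comp_of_mem {Ω α β : Type*} [MeasurableSpace Ω]
    [TopologicalSpace α] [MeasurableSpace α] [OpensMeasurableSpace α]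
    [TopologicalSpace β] [MeasurableSpace β] [BorelSpace β]
    {f : α → β} {s : Set α} (hf : ContinuousOn f s) {g : Ω → α} (hg : Measurable g)
    (hs : ∀ ω, g ω ∈ s) : Measurable fun ω => f (g ω) :=
  (continuousOn_iff_continuous_domRestrict.1 hf).measurable.comp (hg.subtype_mk (h := hs))

theorem measurable_clm_apply {Ω : Type*} [MeasurableSpace Ω] {d : ℕ} {A : Ω → Act d →L[ℝ] Act d}
    {v : Ω → Act d} (hA : Measurable A) (hv : Measurable v) : Measurable fun ω => A ω (v ω) :=
  (isBoundedBilinearMap_apply (𝕜 := ℝ) (E := Act d) (F := Act d)).continuous.measurable.comp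
    (hA.prodMk hv)

end Measurability

/-! ### Runs of the algorithm: pathwise bounds and measurability of the iterates. -/

/-- The standing assumptions on a run of the algorithm, with general learning rates and radii. -/
structure RunContext {n d : ℕ} {Ω : Type*} (𝒢 : Game n d) (B G : ℝ) (ℓ : Fin n → ℝ)
    (ν κ μ ζ Cp : ℝ) (h p : Fin n → Act d → ℝ) (η δ : ℕ → ℝ) (z : Fin n → ℕ → Ω → Sph d)
    (x : Fin n → ℕ → Ω → Act d) (A : Fin n → ℕ → Ω → Act d →L[ℝ] Act d) : Prop where
  dim_pos : 1 ≤ d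
  game : 𝒢.IsMonotoneGame B G ℓ
  barrier : ∀ i, IsSelfConcordantBarrier ν (𝒢.X i) (h i)
  reg : IsRegularizer 𝒢 κ μ ζ Cp p
  η_nonneg : ∀ t, 0 ≤ η t
  δ_pos : ∀ t ≥ 1, 0 < δ t
  δ_le_one : ∀ t ≥ 1, δ t ≤ 1
  run : IsAlgorithmRun 𝒢 h p κ η δ z x A

namespace RunContext
open Set Filter Topology

variable {n d : ℕ} {Ω : Type*} {𝒢 : Game n d} {B G : ℝ} {ℓ : Fin n → ℝ} {ν κ μ ζ Cp : ℝ}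
  {h p : Fin n → Act d → ℝ} {η δ : ℕ → ℝ} {z : Fin n → ℕ → Ω → Sph d}
  {x : Fin n → ℕ → Ω → Act d} {A : Fin n → ℕ → Ω → Act d →L[ℝ] Act d}

section Deterministic

variable (C : RunContext 𝒢 B G ℓ ν κ μ ζ Cp h p η δ z x A)
include C

theorem diameter_pos (i : Fin n) : 0 < B := by
  obtain ⟨y, hy⟩ := C.game.nonempty_interior i
  obtain ⟨r, hr, hball⟩ := Metric.isOpen_iff.1 isOpen_interior y hy
  have : Nontrivial (Act d) := by
    have : Nonempty (Fin d) := ⟨⟨0, C.dim_pos⟩⟩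
    infer_instance
  obtain ⟨e, he⟩ := exists_norm_eq (Act d) (by positivity : 0 ≤ r / 2)
  have h1 : y + e ∈ interior (𝒢.X i) := hball (by simp [he]; linarith)
  have h2 := C.game.diameter i _ (interior_subset h1) _ (interior_subset hy)
  rw [add_sub_cancel_left, he] at h2
  linarith

theorem mem_interior (i : Fin n) {t : ℕ} (ht : 1 ≤ t) (ω : Ω) : x i t ω ∈ interior (𝒢.X i) := by
  obtain rfl | ht := ht.eq_or_lt
  · exact C.run.init_mem i ω
  · obtain ⟨s, rfl⟩ := Nat.exists_eq_add_of_lt ht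
    exact C.run.step_mem i (1 + s) (by omega) ω

theorem mem (i : Fin n) {t : ℕ} (ht : 1 ≤ t) (ω : Ω) : x i t ω ∈ 𝒢.X i :=
  interior_subset (C.mem_interior i ht ω)

theorem hess_nonneg (i : Fin n) : ∀ y ∈ 𝒢.X i, ∀ v, 0 ≤ inner ℝ (hess (p i) y v) v :=
  fun y hy v => (mul_nonneg C.reg.μ_nonneg (sq_nonneg _)).trans (C.reg.hess_lower i y hy v)

theorem rate_nonneg (t : ℕ) : 0 ≤ η t * ((t : ℝ) + 1) := mul_nonneg (C.η_nonneg t) (by positivity)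

theorem sample_mem (i : Fin n) {t : ℕ} (ht : 1 ≤ t) (ω : Ω) (w : Sph d) :
    x i t ω + δ t • A i t ω w ∈ 𝒢.X i :=
  (C.barrier i).sample_mem (C.game.compact_set i).isClosed (C.mem_interior i ht ω)
    (C.run.scaling_pos i t ht ω) (C.run.scaling_eq i t ht ω) (C.rate_nonneg t)
    (C.hess_nonneg i _ (C.mem i ht ω)) (C.δ_pos t ht).le (C.δ_le_one t ht)
    (mem_sphere_zero_iff_norm.1 w.2).le

theorem played_mem {t : ℕ} (ht : 1 ≤ t) (ω : Ω) : played δ z x A t ω ∈ 𝒢.profiles :=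
  fun i => C.sample_mem i ht ω (z i t ω)

theorem update_mem {i : Fin n} {y : Act d} (hy : y ∈ 𝒢.X i) {t : ℕ} (ht : 1 ≤ t) (ω : Ω) :
    Function.update (played δ z x A t ω) i y ∈ 𝒢.profiles := fun j => by
  by_cases hj : j = i
  · subst hj; simpa using hy
  · simpa [hj] using C.played_mem ht ω j

theorem optimality (i : Fin n) {t : ℕ} (ht : 1 ≤ t) (ω : Ω) :
    η t • gradEst 𝒢 δ z x A i t ω
      + (κ * (η t * ((t : ℝ) + 1))) • (gradient (p i) (x i (t + 1) ω) - gradient (p i) (x i t ω))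
      + (gradient (h i) (x i (t + 1) ω) - gradient (h i) (x i t ω)) = 0 := by
  have hy := C.run.step_mem i t ht ω
  have hmin := C.run.step_min i t ht ω
  rw [show η t * κ * ((t : ℝ) + 1) = κ * (η t * ((t : ℝ) + 1)) by ring] at hmin
  exact mirror_step_optimality hy
    (((C.barrier i).contDiffAt hy).differentiableAt (by norm_num))
    ((C.reg.contDiffAt i _ (interior_subset hy)).differentiableAt (by norm_num)) hmin

theorem norm_inverse_sq (i : Fin n) {t : ℕ} (ht : 1 ≤ t) (ω : Ω) (v : Act d) :
    ‖(A i t ω).inverse v‖ ^ 2 = inner ℝ (hess (h i) (x i t ω) v) v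
      + η t * ((t : ℝ) + 1) * inner ℝ (hess (p i) (x i t ω) v) v := by
  rw [norm_scaling_inverse_sq (C.run.scaling_pos i t ht ω) (C.run.scaling_eq i t ht ω) v,
    add_apply, inner_add_left, smul_apply, inner_smul_left]
  simp

theorem abs_cost_le {y : Fin n → Act d} (hy : y ∈ 𝒢.profiles) (i : Fin n) : |𝒢.c i y| ≤ 1 := by
  have := C.game.range i y hy
  rw [abs_of_nonneg this.1]; exact this.2

theorem exists_norm_inverse_le_of_bound (i : Fin n) {t : ℕ} (ht : 1 ≤ t) {M : ℝ}
    (hM : ∀ ω, h i (x i t ω) ≤ M) :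
    ∃ K, 0 ≤ K ∧ ∀ ω, ∀ w : Sph d, ‖(A i t ω).inverse (w : Act d)‖ ≤ K := by
  have hc := (C.barrier i).isCompact_sublevel (C.game.compact_set i) M
  have h2 : ∀ y ∈ {y | y ∈ interior (𝒢.X i) ∧ h i y ≤ M}, ContDiffAt ℝ 2 (h i) y :=
    fun y hy => (C.barrier i).contDiffAt_two hy.1
  obtain ⟨K1, hK1⟩ := hc.exists_bound_of_continuousOn (continuousOn_hess h2)
  obtain ⟨K2, hK2⟩ := (C.game.compact_set i).exists_bound_of_continuousOn
    (continuousOn_hess (C.reg.contDiffAt i))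
  set τ := η t * ((t : ℝ) + 1)
  have hτ := C.rate_nonneg t
  refine ⟨Real.sqrt (K1 + τ * K2), Real.sqrt_nonneg _, fun ω w => Real.le_sqrt_of_sq_le ?_⟩
  rw [C.norm_inverse_sq i ht ω]
  have hw := mem_sphere_zero_iff_norm.1 w.2
  have hb : ∀ L : Act d →L[ℝ] Act d, inner ℝ (L w) (w : Act d) ≤ ‖L‖ := fun L => by
    refine (real_inner_le_norm _ _).trans ?_
    have := L.le_opNorm w
    rw [hw, mul_one] at *
    exact this
  have e1 := (hb (hess (h i) (x i t ω))).trans (hK1 _ ⟨C.mem_interior i ht ω, hM ω⟩)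
  have e2 := (hb (hess (p i) (x i t ω))).trans (hK2 _ (C.mem i ht ω))
  have := mul_le_mul_of_nonneg_left e2 hτ
  linarith

theorem norm_gradEst_le (i : Fin n) {t : ℕ} (ht : 1 ≤ t) {K : ℝ} (ω : Ω)
    (hK : ‖(A i t ω).inverse (z i t ω : Act d)‖ ≤ K) :
    ‖gradEst 𝒢 δ z x A i t ω‖ ≤ d / δ t * K := by
  have hδ := C.δ_pos t ht
  rw [gradEst, norm_smul, norm_mul, Real.norm_of_nonneg (by positivity : 0 ≤ (d : ℝ) / δ t)]
  have h1 := C.abs_cost_le (C.played_mem ht ω) i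
  rw [← Real.norm_eq_abs] at h1
  have : (d : ℝ) / δ t * ‖𝒢.c i (played δ z x A t ω)‖ ≤ d / δ t :=
    mul_le_of_le_one_right (by positivity) h1
  gcongr

/-- In each round the iterates stay in a compact subset of the interior. -/
theorem exists_barrier_bound (i : Fin n) {t : ℕ} (ht : 1 ≤ t) : ∃ M, ∀ ω, h i (x i t ω) ≤ M := by
  obtain ⟨x0, hx0⟩ := C.game.nonempty_interior i
  induction t, ht using Nat.le_induction with
  | base => exact ⟨h i x0, fun ω => C.run.init_min i ω hx0⟩
  | succ t ht ih =>
    obtain ⟨M, hM⟩ := ih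
    obtain ⟨K, hK0, hK⟩ := C.exists_norm_inverse_le_of_bound i ht hM
    have hc := (C.barrier i).isCompact_sublevel (C.game.compact_set i) M
    obtain ⟨K1, hK1⟩ := hc.exists_bound_of_continuousOn
      (continuousOn_gradient (p := h i) fun y hy => (C.barrier i).contDiffAt_two hy.1)
    obtain ⟨K2, hK2⟩ := (C.game.compact_set i).exists_bound_of_continuousOn
      (continuousOn_gradient (C.reg.contDiffAt i))
    set τ := η t * ((t : ℝ) + 1)
    have hτ : 0 ≤ τ := C.rate_nonneg t
    refine ⟨h i x0 + (η t * (d / δ t * K) + κ * τ * (K2 + K2) + K1) * B, fun ω => ?_⟩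
    have hy := C.run.step_mem i t ht ω
    -- Optimality expresses the new barrier gradient through quantities bounded uniformly in ω; the
    -- gradient inequality from the new iterate to x0 then bounds its barrier value.
    have hgrad : gradient (h i) (x i (t + 1) ω) = gradient (h i) (x i t ω)
        - η t • gradEst 𝒢 δ z x A i t ω
        - (κ * τ) • (gradient (p i) (x i (t + 1) ω) - gradient (p i) (x i t ω)) := by
      have := C.optimality i ht ω
      rw [← sub_eq_zero, ← this]; abel
    have hκτ : 0 ≤ κ * τ := mul_nonneg C.reg.κ_pos.le hτ
    have hn : ‖gradient (h i) (x i (t + 1) ω)‖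
        ≤ η t * (d / δ t * K) + κ * τ * (K2 + K2) + K1 := by
      rw [hgrad]
      refine (norm_sub_le _ _).trans ?_
      have e1 : ‖(κ * τ) • (gradient (p i) (x i (t + 1) ω) - gradient (p i) (x i t ω))‖
          ≤ κ * τ * (K2 + K2) := by
        rw [norm_smul, Real.norm_of_nonneg hκτ]
        exact mul_le_mul_of_nonneg_left ((norm_sub_le _ _).trans
          (add_le_add (hK2 _ (interior_subset hy)) (hK2 _ (C.mem i ht ω)))) hκτ
      have e2 : ‖η t • gradEst 𝒢 δ z x A i t ω‖ ≤ η t * (d / δ t * K) := by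
        rw [norm_smul, Real.norm_of_nonneg (C.η_nonneg t)]
        exact mul_le_mul_of_nonneg_left (C.norm_gradEst_le i ht ω (hK ω _)) (C.η_nonneg t)
      have e3 := hK1 _ ⟨C.mem_interior i ht ω, hM ω⟩
      have e4 := norm_sub_le (gradient (h i) (x i t ω)) (η t • gradEst 𝒢 δ z x A i t ω)
      linarith
    have hbr := (C.barrier i).bregman_nonneg (C.game.convex_set i) hy hx0
    rw [bregman] at hbr
    have h1 : -inner ℝ (gradient (h i) (x i (t + 1) ω)) (x0 - x i (t + 1) ω)
        ≤ ‖gradient (h i) (x i (t + 1) ω)‖ * ‖x0 - x i (t + 1) ω‖ :=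
      (neg_le_abs _).trans (abs_real_inner_le_norm _ _)
    have h2 : ‖gradient (h i) (x i (t + 1) ω)‖ * ‖x0 - x i (t + 1) ω‖
        ≤ (η t * (d / δ t * K) + κ * τ * (K2 + K2) + K1) * B :=
      mul_le_mul hn (C.game.diameter i _ (interior_subset hx0) _ (interior_subset hy))
        (norm_nonneg _) ((norm_nonneg _).trans hn)
    linarith

theorem exists_norm_inverse_le (i : Fin n) {t : ℕ} (ht : 1 ≤ t) :
    ∃ K, 0 ≤ K ∧ ∀ ω, ∀ w : Sph d, ‖(A i t ω).inverse (w : Act d)‖ ≤ K := by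
  obtain ⟨M, hM⟩ := C.exists_barrier_bound i ht
  exact C.exists_norm_inverse_le_of_bound i ht hM

/-- Pairing a difference of gradients with a - b gives symmetrized divergences, strictly positive
for `h` when a ≠ b. With σ = 0 this yields uniqueness of the initial point, with σ > 0 it inverts
the step. -/
theorem injOn_mirror (i : Fin n) {σ : ℝ} (hσ : 0 ≤ σ) :
    InjOn (fun y => gradient (h i) y + σ • gradient (p i) y) (interior (𝒢.X i)) := by
  intro a ha b hb hab
  by_contra hne
  have hX := C.game.convex_set i
  have h1 := (C.barrier i).bregman_pos hX (C.game.diameter i) (C.diameter_pos i) ha hb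
    (fun h => hne h.symm)
  have h2 := (C.barrier i).bregman_pos hX (C.game.diameter i) (C.diameter_pos i) hb ha hne
  have h3 := bregman_nonneg_of_hess_nonneg hX (C.reg.contDiffAt i) (C.hess_nonneg i)
    (interior_subset ha) (interior_subset hb)
  have h4 := bregman_nonneg_of_hess_nonneg hX (C.reg.contDiffAt i) (C.hess_nonneg i)
    (interior_subset hb) (interior_subset ha)
  have h5 : inner ℝ ((gradient (h i) a + σ • gradient (p i) a)
      - (gradient (h i) b + σ • gradient (p i) b)) (a - b) = 0 := by
    rw [show gradient (h i) a + σ • gradient (p i) a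
      = gradient (h i) b + σ • gradient (p i) b from hab, sub_self, inner_zero_left]
  rw [show (gradient (h i) a + σ • gradient (p i) a) - (gradient (h i) b + σ • gradient (p i) b)
    = (gradient (h i) a - gradient (h i) b) + σ • (gradient (p i) a - gradient (p i) b) by module,
    inner_add_left, inner_smul_left, inner_gradient_sub, inner_gradient_sub] at h5
  simp only [conj_trivial] at h5
  have := mul_nonneg hσ (add_nonneg h4 h3)
  linarith

theorem init_const (i : Fin n) (ω ω' : Ω) : x i 1 ω = x i 1 ω' := by
  have hz : ∀ ω, gradient (h i) (x i 1 ω) = 0 := fun ω => by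
    have hloc := (C.run.init_min i ω).isLocalMin
      (isOpen_interior.mem_nhds (C.run.init_mem i ω))
    rw [gradient, hloc.fderiv_eq_zero, map_zero]
  refine C.injOn_mirror i le_rfl (C.run.init_mem i ω) (C.run.init_mem i ω') ?_
  simp [hz]

end Deterministic

section Measurable

variable [MeasurableSpace Ω] (C : RunContext 𝒢 B G ℓ ν κ μ ζ Cp h p η δ z x A)
include C

theorem measurable_hess (i : Fin n) {t : ℕ} (ht : 1 ≤ t) (hx : Measurable (x i t)) :
    Measurable fun ω => hess (h i) (x i t ω) + (η t * ((t : ℝ) + 1)) • hess (p i) (x i t ω) :=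
  ((continuousOn_hess fun _ hy => (C.barrier i).contDiffAt_two hy).measurable_comp_of_mem hx
    (C.mem_interior i ht)).add
    (((continuousOn_hess (C.reg.contDiffAt i)).measurable_comp_of_mem hx (C.mem i ht)).fun_const_smul _)

theorem measurable_A (i : Fin n) {t : ℕ} (ht : 1 ≤ t) (hx : Measurable (x i t)) :
    Measurable (A i t) :=
  measurable_scaling (C.run.scaling_pos i t ht) (C.run.scaling_eq i t ht)
    (C.measurable_hess i ht hx)

theorem measurable_inverse (i : Fin n) {t : ℕ} (ht : 1 ≤ t) (hx : Measurable (x i t)) :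
    Measurable fun ω => (A i t ω).inverse := by
  have h1 : (fun ω => (A i t ω).inverse) = fun ω => A i t ω *
      (hess (h i) (x i t ω) + (η t * ((t : ℝ) + 1)) • hess (p i) (x i t ω)) := by
    ext1 ω; exact scaling_inverse (C.run.scaling_eq i t ht ω)
  rw [h1]
  exact continuous_mul.measurable.comp
    ((C.measurable_A i ht hx).prodMk (C.measurable_hess i ht hx))

omit [MeasurableSpace Ω] in
theorem measurable_cost {Ω' : Type*} [MeasurableSpace Ω'] (i : Fin n) {y : Ω' → Fin n → Act d}
    (hy : Measurable y) (hmem : ∀ ω, y ω ∈ 𝒢.profiles) : Measurable fun ω => 𝒢.c i (y ω) :=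
  (C.game.continuous i).measurable_comp_of_mem hy hmem

theorem measurable_played {t : ℕ} (ht : 1 ≤ t) (hx : ∀ i, Measurable (x i t))
    (hz : ∀ i, Measurable (z i t)) : Measurable (played δ z x A t) :=
  measurable_pi_iff.2 fun i => (hx i).add ((measurable_clm_apply (C.measurable_A i ht (hx i))
    (measurable_subtype_coe.comp (hz i))).fun_const_smul _)

theorem measurable_gradEst (i : Fin n) {t : ℕ} (ht : 1 ≤ t) (hx : ∀ i, Measurable (x i t))
    (hz : ∀ i, Measurable (z i t)) : Measurable (gradEst 𝒢 δ z x A i t) :=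
  (((C.measurable_cost i (C.measurable_played ht hx hz) (C.played_mem ht)).const_mul _)).smul
    (measurable_clm_apply (C.measurable_inverse i ht (hx i))
      (measurable_subtype_coe.comp (hz i)))

/-- The next iterate is given only as a minimizer. Its image under ∇h + σ∇p is an explicit
measurable function of the current data, and this map is a measurable embedding because it is
continuous and injective on an open set. -/
theorem measurable_step (i : Fin n) {t : ℕ} (ht : 1 ≤ t) (hx : ∀ i, Measurable (x i t))
    (hz : ∀ i, Measurable (z i t)) : Measurable (x i (t + 1)) := by
  set σ := κ * (η t * ((t : ℝ) + 1)) with hσ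
  have hσ0 : 0 ≤ σ := mul_nonneg C.reg.κ_pos.le (C.rate_nonneg t)
  have hgh : ContinuousOn (gradient (h i)) (interior (𝒢.X i)) :=
    continuousOn_gradient fun y hy => (C.barrier i).contDiffAt_two hy
  have hgp : ContinuousOn (gradient (p i)) (interior (𝒢.X i)) :=
    (continuousOn_gradient (C.reg.contDiffAt i)).mono interior_subset
  have hemb := (hgh.add (hgp.const_smul σ)).measurableEmbedding
    isOpen_interior.measurableSet (C.injOn_mirror i hσ0)
  have key : Measurable fun ω => (⟨x i (t + 1) ω, C.run.step_mem i t ht ω⟩ : interior (𝒢.X i)) := by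
    rw [← hemb.measurable_comp_iff]
    have h1 : Measurable fun ω => (gradient (h i) (x i t ω) + σ • gradient (p i) (x i t ω))
        - η t • gradEst 𝒢 δ z x A i t ω :=
      ((hgh.measurable_comp_of_mem (hx i) (C.mem_interior i ht)).add
        ((hgp.measurable_comp_of_mem (hx i) (C.mem_interior i ht)).const_smul σ)).sub
        ((C.measurable_gradEst i ht hx hz).fun_const_smul _)
    convert h1 using 1
    ext1 ω
    have := C.optimality i ht ω
    rw [← hσ] at this
    change gradient (h i) (x i (t + 1) ω) + σ • gradient (p i) (x i (t + 1) ω) = _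
    rw [← sub_eq_zero, ← this]
    module
  exact measurable_subtype_coe.comp key

/-- The iterates of round `t` are measurable functions of the directions sampled before `t`. -/
theorem measurable_iterate {t : ℕ} (ht : 1 ≤ t)
    (hz : ∀ i s, 1 ≤ s → s < t → Measurable (z i s)) : ∀ i, Measurable (x i t) := by
  induction t, ht using Nat.le_induction with
  | base =>
    intro i
    rcases isEmpty_or_nonempty Ω with hΩ | ⟨⟨ω0⟩⟩
    · exact measurable_of_empty _
    · rw [show x i 1 = fun _ => x i 1 ω0 from funext fun ω => C.init_const i ω ω0]
      exact measurable_const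
  | succ t ht ih =>
    exact fun i => C.measurable_step i ht (ih fun i s hs hst => hz i s hs (by omega))
      fun i => hz i t ht (by omega)

end Measurable

end RunContext

/-! ### Integrating out one independent direction. -/

section Independence
open Set Filter Topology

/-- Integrating out an independent random variable. -/
theorem integral_eq_integral_integral_of_indepFun {Ω β γ : Type*} {mΩ : MeasurableSpace Ω}
    {mβ : MeasurableSpace β} {mγ : MeasurableSpace γ} {P : Measure Ω} [IsProbabilityMeasure P]
    {W : Ω → β} {Z : Ω → γ} (hW : Measurable W) (hZ : Measurable Z) (hWZ : IndepFun W Z P)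
    {F : β × γ → ℝ} (hF : Measurable F) {K : ℝ} (hK : ∀ q, |F q| ≤ K) :
    ∫ ω, F (W ω, Z ω) ∂P = ∫ ω, (∫ c, F (W ω, c) ∂(P.map Z)) ∂P
      ∧ Integrable (fun ω => ∫ c, F (W ω, c) ∂(P.map Z)) P := by
  have : IsProbabilityMeasure (P.map Z) := Measure.isProbabilityMeasure_map hZ.aemeasurable
  have : IsProbabilityMeasure (P.map W) := Measure.isProbabilityMeasure_map hW.aemeasurable
  have hmap := hWZ.map_prod_eq_prod_map_map hW.aemeasurable hZ.aemeasurable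
  have hint : Integrable F ((P.map W).prod (P.map Z)) :=
    Integrable.of_bound hF.aestronglyMeasurable K (.of_forall hK)
  have hi := hint.integral_prod_left
  refine ⟨?_, hi.comp_measurable hW⟩
  calc ∫ ω, F (W ω, Z ω) ∂P = ∫ q, F q ∂(P.map fun ω => (W ω, Z ω)) :=
        (integral_map (hW.prodMk hZ).aemeasurable hF.aestronglyMeasurable).symm
    _ = ∫ w, ∫ c, F (w, c) ∂(P.map Z) ∂(P.map W) := by rw [hmap, integral_prod _ hint]
    _ = _ := integral_map hW.aemeasurable hi.aestronglyMeasurable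

/-- A family member is independent of the σ-algebra generated by finitely many other members. -/
theorem iIndepFun.exists_indepFun_id {Ω ι γ : Type*} {mΩ : MeasurableSpace Ω}
    {mγ : MeasurableSpace γ} {P : Measure Ω} {Z : ι → Ω → γ}
    (hZ : ∀ k, Measurable (Z k)) (h : iIndepFun Z P) {S : Finset ι} {k : ι} (hk : k ∉ S) :
    ∃ m : MeasurableSpace Ω, Measurable[mΩ, m] id ∧ (∀ j ∈ S, Measurable[m] (Z j)) ∧
      @IndepFun Ω Ω γ mΩ m mγ id (Z k) P := by
  have h1 := h.indepFun_finset S {k} (by simpa using hk) hZ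
  have h2 : IndepFun (fun ω (j : S) => Z j ω) (Z k) P :=
    h1.comp measurable_id (measurable_pi_apply (⟨k, by simp⟩ : ({k} : Finset ι)))
  have hle : MeasurableSpace.comap (fun ω (j : S) => Z j ω) MeasurableSpace.pi ≤ mΩ :=
    Measurable.comap_le (measurable_pi_iff.2 fun j : S => hZ j)
  refine ⟨MeasurableSpace.comap (fun ω (j : S) => Z j ω) MeasurableSpace.pi,
    measurable_id'' hle, fun j hj => ?_, ?_⟩
  · have h3 : (Z j) = (fun f : S → γ => f ⟨j, hj⟩) ∘ fun ω (j : S) => Z j ω := rfl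
    rw [h3]
    exact (measurable_pi_apply (⟨j, hj⟩ : S)).comp (comap_measurable _)
  · rw [IndepFun_iff_Indep] at h2
    refine (@IndepFun_iff_Indep Ω Ω γ mΩ (MeasurableSpace.comap _ MeasurableSpace.pi) mγ id
      (Z k) P).2 ?_
    rwa [MeasurableSpace.comap_id]

end Independence

/-! ### Resampling one player's direction: expected one-round regret. -/

namespace RunContext
open Set Filter Topology

variable {n d : ℕ} {Ω : Type*} {𝒢 : Game n d} {B G : ℝ} {ℓ : Fin n → ℝ} {ν κ μ ζ Cp : ℝ}
  {h p : Fin n → Act d → ℝ} {η δ : ℕ → ℝ} {z : Fin n → ℕ → Ω → Sph d}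
  {x : Fin n → ℕ → Ω → Act d} {A : Fin n → ℕ → Ω → Act d →L[ℝ] Act d}

/-- The action profile of round `t` when player `i` samples the direction `w` instead. -/
def resampled (δ : ℕ → ℝ) (z : Fin n → ℕ → Ω → Sph d) (x : Fin n → ℕ → Ω → Act d)
    (A : Fin n → ℕ → Ω → Act d →L[ℝ] Act d) (i : Fin n) (t : ℕ) (ω : Ω) (w : Sph d) :
    Fin n → Act d :=
  Function.update (played δ z x A t ω) i (x i t ω + δ t • A i t ω w)

/-- The estimated regret plus the sampled cost, as a function of the direction of player `i`. -/
def resampledValue (𝒢 : Game n d) (δ : ℕ → ℝ) (z : Fin n → ℕ → Ω → Sph d)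
    (x : Fin n → ℕ → Ω → Act d) (A : Fin n → ℕ → Ω → Act d →L[ℝ] Act d) (i : Fin n) (t : ℕ)
    (u : Act d) (q : Ω × Sph d) : ℝ :=
  (d : ℝ) / δ t * 𝒢.c i (resampled δ z x A i t q.1 q.2)
      * inner ℝ ((A i t q.1).inverse (q.2 : Act d)) (u - x i t q.1)
    + 𝒢.c i (resampled δ z x A i t q.1 q.2)

theorem resampledValue_self (i : Fin n) (t : ℕ) (u : Act d) (ω : Ω) :
    resampledValue 𝒢 δ z x A i t u (ω, z i t ω)
      = inner ℝ (gradEst 𝒢 δ z x A i t ω) (u - x i t ω) + 𝒢.c i (played δ z x A t ω) := by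
  have : resampled δ z x A i t ω (z i t ω) = played δ z x A t ω := Function.update_eq_self i _
  simp only [resampledValue, gradEst, this, inner_smul_left, conj_trivial]

variable (C : RunContext 𝒢 B G ℓ ν κ μ ζ Cp h p η δ z x A)
include C

theorem resampled_mem (i : Fin n) {t : ℕ} (ht : 1 ≤ t) (ω : Ω) (w : Sph d) :
    resampled δ z x A i t ω w ∈ 𝒢.profiles := C.update_mem (C.sample_mem i ht ω w) ht ω

/-- Nothing is asked of z_i^t, so the σ-algebra on Ω may be one that does not see this direction.
That is how the lemma is used for conditioning. -/
theorem measurable_resampledValue [MeasurableSpace Ω] (i : Fin n) {t : ℕ} (ht : 1 ≤ t)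
    (hx : ∀ j, Measurable (x j t)) (hz : ∀ j, j ≠ i → Measurable (z j t)) (u : Act d) :
    Measurable (resampledValue 𝒢 δ z x A i t u) := by
  have hr : Measurable fun q : Ω × Sph d => resampled δ z x A i t q.1 q.2 := by
    refine measurable_pi_iff.2 fun j => ?_
    by_cases hj : j = i
    · subst hj
      simp only [resampled, Function.update_self]
      exact ((hx j).comp measurable_fst).add ((measurable_clm_apply
        ((C.measurable_A j ht (hx j)).comp measurable_fst)
        (measurable_subtype_coe.comp measurable_snd)).fun_const_smul _)
    · simp only [resampled, Function.update_of_ne hj, played]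
      exact ((hx j).add ((measurable_clm_apply (C.measurable_A j ht (hx j))
        (measurable_subtype_coe.comp (hz j hj))).fun_const_smul _)).comp measurable_fst
  have hc : Measurable fun q : Ω × Sph d => 𝒢.c i (resampled δ z x A i t q.1 q.2) :=
    C.measurable_cost i hr fun q => C.resampled_mem i ht q.1 q.2
  exact ((hc.const_mul _).mul ((measurable_clm_apply
    ((C.measurable_inverse i ht (hx i)).comp measurable_fst)
    (measurable_subtype_coe.comp measurable_snd)).inner
    (measurable_const.sub ((hx i).comp measurable_fst)))).add hc

theorem exists_resampledValue_bound (i : Fin n) {t : ℕ} (ht : 1 ≤ t) {u : Act d} (hu : u ∈ 𝒢.X i) :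
    ∃ K, ∀ q, |resampledValue 𝒢 δ z x A i t u q| ≤ K := by
  obtain ⟨K, hK0, hK⟩ := C.exists_norm_inverse_le i ht
  have hδ := C.δ_pos t ht
  refine ⟨d / δ t * 1 * (K * B) + 1, fun q => ?_⟩
  have hc := C.abs_cost_le (C.resampled_mem i ht q.1 q.2) i
  refine (abs_add_le _ _).trans (add_le_add ?_ hc)
  rw [abs_mul, abs_mul, abs_of_nonneg (by positivity : 0 ≤ (d : ℝ) / δ t)]
  have h1 : |inner ℝ ((A i t q.1).inverse (q.2 : Act d)) (u - x i t q.1)| ≤ K * B :=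
    (abs_real_inner_le_norm _ _).trans (mul_le_mul (hK q.1 q.2)
      (C.game.diameter i u hu _ (C.mem i ht q.1)) (norm_nonneg _) hK0)
  gcongr

/-- The bounded measurable functions of the state are integrable. -/
theorem integrable_bregman [MeasurableSpace Ω] {P : Measure Ω} [IsProbabilityMeasure P]
    (i : Fin n) {t : ℕ} (ht : 1 ≤ t) (hx : Measurable (x i t)) (u : Act d) :
    Integrable (fun ω => bregman (p i) u (x i t ω)) P ∧
      Integrable (fun ω => bregman (h i) u (x i t ω)) P := by
  have key : ∀ (f : Act d → ℝ) (K : Set (Act d)), IsCompact K → (∀ y ∈ K, ContDiffAt ℝ 2 f y) →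
      (∀ ω, x i t ω ∈ K) → Integrable (fun ω => bregman f u (x i t ω)) P := by
    intro f K hK hf hmem
    have hc : ContinuousOn (fun y => bregman f u y) K :=
      (continuousOn_const.sub fun y hy => (hf y hy).continuousAt.continuousWithinAt).sub
        ((continuousOn_gradient hf).inner (continuousOn_const.sub continuousOn_id))
    obtain ⟨M, hM⟩ := hK.exists_bound_of_continuousOn hc
    exact Integrable.of_bound (hc.measurable_comp_of_mem hx hmem).aestronglyMeasurable M
      (.of_forall fun ω => hM _ (hmem ω))
  obtain ⟨M, hM⟩ := C.exists_barrier_bound i ht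
  exact ⟨key _ _ (C.game.compact_set i) (C.reg.contDiffAt i) (C.mem i ht),
    key _ _ ((C.barrier i).isCompact_sublevel (C.game.compact_set i) M)
      (fun y hy => (C.barrier i).contDiffAt_two hy.1) fun ω => ⟨C.mem_interior i ht ω, hM ω⟩⟩

theorem integrable_cost [MeasurableSpace Ω] {P : Measure Ω} [IsProbabilityMeasure P]
    (i : Fin n) {y : Ω → Fin n → Act d} (hy : Measurable y) (hmem : ∀ ω, y ω ∈ 𝒢.profiles) :
    Integrable (fun ω => 𝒢.c i (y ω)) P :=
  Integrable.of_bound (C.measurable_cost i hy hmem).aestronglyMeasurable 1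
    (.of_forall fun ω => C.abs_cost_le (hmem ω) i)

/-- The sign of `ℓ i` is not assumed: a negative constant would collapse the action set to one
point, against its nonempty interior in positive dimension. -/
theorem smooth_nonneg (i : Fin n) {y : Fin n → Act d} (hy : y ∈ 𝒢.profiles) : 0 ≤ ℓ i := by
  obtain ⟨w, hw⟩ := C.game.nonempty_interior i
  by_contra! hneg
  have hsub : ∀ w ∈ 𝒢.X i, w = y i := fun w hw => by
    have h1 := (norm_nonneg _).trans (C.game.smooth i y hy w hw)
    by_contra hne
    have h2 : 0 < ‖w - y i‖ := norm_pos_iff.2 (sub_ne_zero.2 hne)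
    nlinarith
  have hss : (interior (𝒢.X i)).Subsingleton := fun a ha b hb =>
    (hsub a (interior_subset ha)).trans (hsub b (interior_subset hb)).symm
  have : Nontrivial (Act d) := by
    have : Nonempty (Fin d) := ⟨⟨0, C.dim_pos⟩⟩
    infer_instance
  have h3 : interior (𝒢.X i) = {w} := hss.eq_singleton_of_mem hw
  exact not_isOpen_singleton w (h3 ▸ isOpen_interior)

variable [mΩ : MeasurableSpace Ω] {P : Measure Ω} [IsProbabilityMeasure P]

/-- Fubini after conditioning on all other directions up to round t. The σ-algebra they generate
makes the iterates and the opponents' actions measurable and is independent of z_i^t; it is placed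
on Ω itself, with the identity as the conditioning variable. -/
theorem integral_resampledValue (hz : IsUniformSampling P z) (i : Fin n) {t : ℕ} (ht : 1 ≤ t)
    {u : Act d} (hu : u ∈ 𝒢.X i) :
    ∫ ω, resampledValue 𝒢 δ z x A i t u (ω, z i t ω) ∂P
        = ∫ ω, (∫ c, resampledValue 𝒢 δ z x A i t u (ω, c) ∂uniformSphere d) ∂P
      ∧ Integrable (fun ω => ∫ c, resampledValue 𝒢 δ z x A i t u (ω, c) ∂uniformSphere d) P := by
  classical
  set S : Finset (Fin n × ℕ) := (Finset.univ ×ˢ Finset.range (t + 1)).erase (i, t) with hS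
  set Z : Fin n × ℕ → Ω → Sph d := fun k => z k.1 k.2 with hZ
  have hZm : ∀ k, Measurable (Z k) := fun k => hz.measurable k.1 k.2
  have hlaw : P.map (Z (i, t)) = uniformSphere d := hz.law i t
  obtain ⟨K, hK⟩ := C.exists_resampledValue_bound i ht hu
  obtain ⟨m, hm, hZS, hindep⟩ := iIndepFun.exists_indepFun_id hZm hz.indep (S := S) (k := (i, t))
    (by simp [hS])
  have hFm : Measurable[m.prod (inferInstance : MeasurableSpace (Sph d))] (resampledValue 𝒢 δ z x A i t u) := by
    refine @measurable_resampledValue n d Ω 𝒢 B G ℓ ν κ μ ζ Cp h p η δ z x A C m i t ht ?_ ?_ u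
    · exact @measurable_iterate n d Ω 𝒢 B G ℓ ν κ μ ζ Cp h p η δ z x A m C t ht
        fun j s _ hst => hZS (j, s) (by simp [hS]; omega)
    · exact fun j hj => hZS (j, t) (by simp [hS, hj])
  have := integral_eq_integral_integral_of_indepFun (mβ := m) (W := (id : Ω → Ω))
    (Z := Z (i, t)) hm (hZm _) hindep hFm hK
  rwa [hlaw] at this

theorem integrable_update_cost_sub (hz : IsUniformSampling P z) (i : Fin n) {t : ℕ} (ht : 1 ≤ t)
    {u : Act d} (hu : u ∈ 𝒢.X i) :
    Integrable (fun ω => 𝒢.c i (Function.update (played δ z x A t ω) i u)) P ∧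
      Integrable (fun ω => κ * bregman (p i) u (x i t ω)) P := by
  have hxm : ∀ j, Measurable (x j t) := C.measurable_iterate ht fun j s _ _ => hz.measurable j s
  refine ⟨C.integrable_cost i (measurable_pi_iff.2 fun j => ?_) (C.update_mem hu ht),
    ((C.integrable_bregman i ht (hxm i) u).1).const_mul κ⟩
  have hp := C.measurable_played ht hxm fun j => hz.measurable j t
  by_cases hj : j = i
  · subst hj; simp
  · simpa [hj] using measurable_pi_iff.1 hp j

/-- One-round regret of a player in expectation. -/
theorem integral_estimated_regret_le (hz : IsUniformSampling P z) {ε ρ : ℝ} (hε : 0 ≤ ε)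
    (i : Fin n)
    (hρ : ∀ y ∈ 𝒢.X i, ∀ y' ∈ 𝒢.X i, ‖y' - y‖ < ρ → ‖hess (p i) y' - hess (p i) y‖ ≤ ε)
    {t : ℕ} (ht : 1 ≤ t) (hδ1 : δ t < 1) (hδρ : δ t * B < ρ) {u : Act d} (hu : u ∈ 𝒢.X i) :
    ∫ ω, (inner ℝ (gradEst 𝒢 δ z x A i t ω) (u - x i t ω) + 𝒢.c i (played δ z x A t ω)) ∂P
      ≤ ∫ ω, (𝒢.c i (Function.update (played δ z x A t ω) i u)
          - κ * bregman (p i) u (x i t ω)) ∂P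
        + (2 * ℓ i * δ t ^ 2 * B ^ 2 + κ * ε * δ t * B ^ 2) := by
  have : NeZero d := ⟨by have := C.dim_pos; omega⟩
  obtain ⟨heq, hint⟩ := C.integral_resampledValue hz i ht hu
  obtain ⟨hi1, hi2⟩ := C.integrable_update_cost_sub hz i ht hu
  calc _ = ∫ ω, resampledValue 𝒢 δ z x A i t u (ω, z i t ω) ∂P := by
        refine integral_congr_ae (.of_forall fun ω => ?_)
        exact (resampledValue_self i t u ω).symm
    _ = ∫ ω, (∫ c, resampledValue 𝒢 δ z x A i t u (ω, c) ∂uniformSphere d) ∂P := heq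
    _ ≤ ∫ ω, ((𝒢.c i (Function.update (played δ z x A t ω) i u)
          - κ * bregman (p i) u (x i t ω))
        + (2 * ℓ i * δ t ^ 2 * B ^ 2 + κ * ε * δ t * B ^ 2)) ∂P := by
        refine integral_mono hint ?_ fun ω => ?_
        · exact (hi1.sub hi2).add (integrable_const _)
        · set y := played δ z x A t ω with hy
          have hyp : y ∈ 𝒢.profiles := C.played_mem ht ω
          have hup : ∀ a ∈ 𝒢.X i, Function.update y i a ∈ 𝒢.profiles :=
            fun a ha => C.update_mem ha ht ω
          have hpg : ∀ a, 𝒢.partialGrad i (Function.update y i a)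
              = gradientWithin (𝒢.ownCost i y) (𝒢.X i) a := fun a => by
            have : 𝒢.ownCost i (Function.update y i a) = 𝒢.ownCost i y := by
              ext1 b; simp [Game.ownCost]
            simp [Game.partialGrad, this]
          have hsm : ∀ a ∈ 𝒢.X i, ∀ b ∈ 𝒢.X i, ‖gradientWithin (𝒢.ownCost i y) (𝒢.X i) a
              - gradientWithin (𝒢.ownCost i y) (𝒢.X i) b‖ ≤ ℓ i * ‖a - b‖ := fun a ha b hb => by
            have := C.game.smooth i _ (hup b hb) a ha
            rwa [Function.update_idem, hpg, hpg, Function.update_self] at this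
          have := (C.barrier i).integral_estimator_le (f := 𝒢.ownCost i y) (δ := δ t)
            (C.game.convex_set i)
            (C.game.diameter i) (C.diameter_pos i) (C.game.differentiable i y hyp)
            (C.game.convex i y hyp) hsm (C.smooth_nonneg i hyp) C.reg.κ_pos.le
            (C.reg.convex_sub i y hyp) (C.reg.contDiffAt i) (C.hess_nonneg i) hε hρ
            (C.mem_interior i ht ω) (C.run.scaling_pos i t ht ω) (C.run.scaling_eq i t ht ω)
            (C.rate_nonneg t) (C.δ_pos t ht) hδ1 hδρ hu
          exact this
    _ = _ := by
        rw [integral_add (f := fun ω => 𝒢.c i (Function.update (played δ z x A t ω) i u)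
          - κ * bregman (p i) u (x i t ω)) (hi1.sub hi2) (integrable_const _)]
        simp

end RunContext

/-! ### The potential and its one-round decrease. -/

namespace RunContext
open Set Filter Topology

variable {n d : ℕ} {Ω : Type*} {𝒢 : Game n d} {B G : ℝ} {ℓ : Fin n → ℝ} {ν κ μ ζ Cp : ℝ}
  {h p : Fin n → Act d → ℝ} {η δ : ℕ → ℝ} {z : Fin n → ℕ → Ω → Sph d}
  {x : Fin n → ℕ → Ω → Act d} {A : Fin n → ℕ → Ω → Act d →L[ℝ] Act d}

/-- The potential of player `i` relative to the comparator `u`. -/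
def potential (h p : Fin n → Act d → ℝ) (κ : ℝ) (η : ℕ → ℝ) (x : Fin n → ℕ → Ω → Act d)
    (i : Fin n) (u : Act d) (t : ℕ) (ω : Ω) : ℝ :=
  bregman (h i) u (x i t ω) + κ * (η t * t) * bregman (p i) u (x i t ω)

variable (C : RunContext 𝒢 B G ℓ ν κ μ ζ Cp h p η δ z x A)
include C

theorem bregman_reg_nonneg (i : Fin n) {t : ℕ} (ht : 1 ≤ t) {u : Act d} (hu : u ∈ 𝒢.X i) (ω : Ω) :
    0 ≤ bregman (p i) u (x i t ω) :=
  bregman_nonneg_of_hess_nonneg (C.game.convex_set i) (C.reg.contDiffAt i) (C.hess_nonneg i)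
    (C.mem i ht ω) hu

theorem potential_nonneg (i : Fin n) {t : ℕ} (ht : 1 ≤ t) {u : Act d} (hu : u ∈ interior (𝒢.X i))
    (ω : Ω) : 0 ≤ potential h p κ η x i u t ω :=
  add_nonneg ((C.barrier i).bregman_nonneg (C.game.convex_set i) (C.mem_interior i ht ω) hu)
    (mul_nonneg (mul_nonneg C.reg.κ_pos.le (mul_nonneg (C.η_nonneg t) (Nat.cast_nonneg t)))
      (C.bregman_reg_nonneg i ht (interior_subset hu) ω))

/-- The comparator will vary with T while the starting round does not, so it matters that `M` is
independent of `u`. -/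
theorem exists_potential_le (i : Fin n) {t : ℕ} (ht : 1 ≤ t) :
    ∃ M, ∀ u ∈ 𝒢.X i, ∀ ω, potential h p κ η x i u t ω ≤ h i u + M := by
  obtain ⟨M, hM⟩ := C.exists_barrier_bound i ht
  have hc := (C.barrier i).isCompact_sublevel (C.game.compact_set i) M
  have h2 : ∀ y ∈ {y | y ∈ interior (𝒢.X i) ∧ h i y ≤ M}, ContDiffAt ℝ 2 (h i) y :=
    fun y hy => (C.barrier i).contDiffAt_two hy.1
  obtain ⟨K1, hK1⟩ := hc.exists_bound_of_continuousOn (continuousOn_gradient h2)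
  obtain ⟨K2, hK2⟩ := hc.exists_bound_of_continuousOn (f := h i)
    fun y hy => (h2 y hy).continuousAt.continuousWithinAt
  refine ⟨K2 + K1 * B + κ * (η t * t) * Cp, fun u hu ω => ?_⟩
  have hmem := C.mem_interior i ht ω
  have e1 := hK1 _ ⟨hmem, hM ω⟩
  have e2 := (neg_le_abs _).trans (hK2 _ ⟨hmem, hM ω⟩)
  have e3 : -inner ℝ (gradient (h i) (x i t ω)) (u - x i t ω) ≤ K1 * B :=
    (neg_le_abs _).trans ((abs_real_inner_le_norm _ _).trans (mul_le_mul e1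
      (C.game.diameter i u hu _ (C.mem i ht ω)) (norm_nonneg _) ((norm_nonneg _).trans e1)))
  have e4 := mul_le_mul_of_nonneg_left (C.reg.bregman_le i u hu _ (C.mem i ht ω))
    (mul_nonneg C.reg.κ_pos.le (mul_nonneg (C.η_nonneg t) (Nat.cast_nonneg t)))
  have e5 : potential h p κ η x i u t ω = h i u - h i (x i t ω)
    - inner ℝ (gradient (h i) (x i t ω)) (u - x i t ω)
    + κ * (η t * t) * bregman (p i) u (x i t ω) := rfl
  linarith

/-- Cauchy–Schwarz after moving A⁻¹ onto v, as ‖A⁻¹v‖ is the local norm. Keeping the cost as a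
factor, rather than bounding it by 1, is what later permits absorption. -/
theorem abs_inner_gradEst_le (i : Fin n) {t : ℕ} (ht : 1 ≤ t) (ω : Ω) (v : Act d) :
    |inner ℝ (gradEst 𝒢 δ z x A i t ω) v| ≤ d / δ t * 𝒢.c i (played δ z x A t ω)
      * Real.sqrt (inner ℝ (hess (h i) (x i t ω) v) v
        + η t * ((t : ℝ) + 1) * inner ℝ (hess (p i) (x i t ω) v) v) := by
  have hδ := C.δ_pos t ht
  have hc := (C.game.range i _ (C.played_mem ht ω)).1
  rw [gradEst, inner_smul_left, conj_trivial, abs_mul,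
    abs_of_nonneg (by positivity : 0 ≤ (d : ℝ) / δ t * 𝒢.c i (played δ z x A t ω)),
    inner_scaling_inverse (C.run.scaling_pos i t ht ω) (C.run.scaling_eq i t ht ω),
    ← C.norm_inverse_sq i ht ω v, Real.sqrt_sq (norm_nonneg _)]
  refine mul_le_mul_of_nonneg_left ?_ (by positivity)
  have := abs_real_inner_le_norm (z i t ω : Act d) ((A i t ω).inverse v)
  rwa [mem_sphere_zero_iff_norm.1 (z i t ω).2, one_mul] at this

/-- One step of a player: the potential decreases up to the estimated regret and a small multiple
of the observed cost. -/
theorem potential_succ_le {ε ρ θ : ℝ} (hε : 0 ≤ ε) (i : Fin n)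
    (hρ : ∀ y ∈ 𝒢.X i, ∀ y' ∈ 𝒢.X i, ‖y' - y‖ < ρ → ‖hess (p i) y' - hess (p i) y‖ ≤ ε)
    {t : ℕ} (ht : 1 ≤ t) (hη : η (t + 1) ≤ η t)
    (hs1 : η t * (d / δ t) * Real.sqrt (1 + η t * ((t : ℝ) + 1) * ζ * B ^ 2) < 1 / 8)
    (hs2 : 8 * (η t * (d / δ t) * Real.sqrt (1 + η t * ((t : ℝ) + 1) * ζ * B ^ 2)) * B < ρ)
    (hθ : η t * (d / δ t) ^ 2 * (8 * (1 + η t * ((t : ℝ) + 1) * ε * B ^ 2) + 2 / κ) / 4 ≤ θ)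
    {u : Act d} (hu : u ∈ 𝒢.X i) (ω : Ω) :
    potential h p κ η x i u (t + 1) ω ≤ potential h p κ η x i u t ω
      + η t * (κ * bregman (p i) u (x i t ω)
        + (inner ℝ (gradEst 𝒢 δ z x A i t ω) (u - x i t ω) + 𝒢.c i (played δ z x A t ω))
        + (θ - 1) * 𝒢.c i (played δ z x A t ω)) := by
  have hopt := C.optimality i ht ω
  have hδ := C.δ_pos t ht
  have hc := C.game.range i _ (C.played_mem ht ω)
  have hst := stability_le (C.barrier i) (C.game.convex_set i) (C.game.diameter i)
    (C.diameter_pos i) (C.reg.contDiffAt i) (C.hess_nonneg i) (C.reg.hess_upper i)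
    C.reg.ζ_pos.le hε hρ (C.mem_interior i ht ω) (C.run.step_mem i t ht ω) (C.η_nonneg t)
    (C.rate_nonneg t) C.reg.κ_pos (by positivity : 0 ≤ (d : ℝ) / δ t) hc.1 hc.2 hopt
    (C.abs_inner_gradEst_le i ht ω _) hs1 hs2
  have h3 := three_point hopt u
  have hDp := C.bregman_reg_nonneg i (by omega : 1 ≤ t + 1) hu ω
  set c := 𝒢.c i (played δ z x A t ω)
  set g := gradEst 𝒢 δ z x A i t ω
  have hsplit : inner ℝ g (u - x i (t + 1) ω)
      = inner ℝ g (u - x i t ω) - inner ℝ g (x i (t + 1) ω - x i t ω) := by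
    rw [← inner_sub_right]; congr 1; abel
  rw [hsplit] at h3
  have hη0 := C.η_nonneg t
  -- Since 0 ≤ c ≤ 1, c² ≤ c turns the noise into a multiple of the observed cost.
  have hnoise : η t ^ 2 * (d / δ t) ^ 2 * c ^ 2
      * (8 * (1 + η t * ((t : ℝ) + 1) * ε * B ^ 2) + 2 / κ) / 4 ≤ η t * (θ * c) := by
    have hτ := C.rate_nonneg t
    have hκ := C.reg.κ_pos
    have hc2 : c ^ 2 ≤ c := by nlinarith [hc.1, hc.2]
    have hpos : 0 ≤ η t * (d / δ t) ^ 2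
        * (8 * (1 + η t * ((t : ℝ) + 1) * ε * B ^ 2) + 2 / κ) / 4 := by positivity
    calc _ = η t * (η t * (d / δ t) ^ 2
          * (8 * (1 + η t * ((t : ℝ) + 1) * ε * B ^ 2) + 2 / κ) / 4 * c ^ 2) := by ring
      _ ≤ _ := mul_le_mul_of_nonneg_left (mul_le_mul hθ hc2 (sq_nonneg _) (hpos.trans hθ)) hη0
  -- The step carries weight η_t (t + 1), which dominates the new weight η_{t+1} (t + 1) and exceeds
  -- the old weight η_t t by η_t; that excess is the D_p term on the right.
  have hmono : κ * (η (t + 1) * ((t + 1 : ℕ) : ℝ)) * bregman (p i) u (x i (t + 1) ω)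
      ≤ κ * (η t * ((t : ℝ) + 1)) * bregman (p i) u (x i (t + 1) ω) := by
    push_cast
    have := C.reg.κ_pos.le
    gcongr
  simp only [potential]
  linarith

variable [mΩ : MeasurableSpace Ω] {P : Measure Ω} [IsProbabilityMeasure P]

omit [IsProbabilityMeasure P] in
theorem measurable_iterate_of_sampling (hz : IsUniformSampling P z) {t : ℕ} (ht : 1 ≤ t)
    (i : Fin n) : Measurable (x i t) :=
  C.measurable_iterate ht (fun i s _ _ => hz.measurable i s) i

theorem integrable_cost_played (hz : IsUniformSampling P z) (i : Fin n) {t : ℕ} (ht : 1 ≤ t) :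
    Integrable (fun ω => 𝒢.c i (played δ z x A t ω)) P :=
  C.integrable_cost i (C.measurable_played ht (C.measurable_iterate_of_sampling hz ht)
    fun i => hz.measurable i t) (C.played_mem ht)

theorem integrable_potential (hz : IsUniformSampling P z) (i : Fin n) {t : ℕ} (ht : 1 ≤ t)
    (u : Act d) : Integrable (fun ω => potential h p κ η x i u t ω) P := by
  obtain ⟨h1, h2⟩ := C.integrable_bregman (P := P) i ht (C.measurable_iterate_of_sampling hz ht i) u
  exact h2.add (h1.const_mul _)

theorem integrable_estimated_regret (hz : IsUniformSampling P z) (i : Fin n) {t : ℕ} (ht : 1 ≤ t)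
    {u : Act d} (hu : u ∈ 𝒢.X i) :
    Integrable (fun ω => inner ℝ (gradEst 𝒢 δ z x A i t ω) (u - x i t ω)
      + 𝒢.c i (played δ z x A t ω)) P := by
  obtain ⟨K, hK⟩ := C.exists_resampledValue_bound i ht hu
  have hm := (C.measurable_resampledValue i ht (C.measurable_iterate_of_sampling hz ht)
    (fun j _ => hz.measurable j t) u).comp (measurable_id.prodMk (hz.measurable i t))
  refine (Integrable.of_bound hm.aestronglyMeasurable K
    (.of_forall fun ω => hK (ω, z i t ω))).congr (.of_forall fun ω => ?_)
  exact resampledValue_self i t u ω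

/-- One round of a player in expectation. -/
theorem integral_potential_succ_le (hz : IsUniformSampling P z) {ε ρ θ e : ℝ} (hε : 0 ≤ ε)
    (i : Fin n)
    (hρ : ∀ y ∈ 𝒢.X i, ∀ y' ∈ 𝒢.X i, ‖y' - y‖ < ρ → ‖hess (p i) y' - hess (p i) y‖ ≤ ε)
    {t : ℕ} (ht : 1 ≤ t) (hη : η (t + 1) ≤ η t)
    (hs1 : η t * (d / δ t) * Real.sqrt (1 + η t * ((t : ℝ) + 1) * ζ * B ^ 2) < 1 / 8)
    (hs2 : 8 * (η t * (d / δ t) * Real.sqrt (1 + η t * ((t : ℝ) + 1) * ζ * B ^ 2)) * B < ρ)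
    (hθ : η t * (d / δ t) ^ 2 * (8 * (1 + η t * ((t : ℝ) + 1) * ε * B ^ 2) + 2 / κ) / 4 ≤ θ)
    (hδ1 : δ t < 1) (hδρ : δ t * B < ρ)
    (he : 2 * ℓ i * δ t ^ 2 * B ^ 2 + κ * ε * δ t * B ^ 2 ≤ e) {u : Act d} (hu : u ∈ 𝒢.X i) :
    ∫ ω, potential h p κ η x i u (t + 1) ω ∂P ≤ ∫ ω, potential h p κ η x i u t ω ∂P
      + η t * (∫ ω, 𝒢.c i (Function.update (played δ z x A t ω) i u) ∂P + e
        + (θ - 1) * ∫ ω, 𝒢.c i (played δ z x A t ω) ∂P) := by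
  obtain ⟨hi1, hi2⟩ := C.integrable_update_cost_sub hz i ht hu
  have hi3 := C.integrable_estimated_regret hz i ht hu
  have hi4 := C.integrable_cost_played hz i ht
  have hi5 := C.integrable_potential hz i ht u
  have hreg := C.integral_estimated_regret_le hz hε i hρ ht hδ1 hδρ hu
  rw [integral_sub hi1 hi2] at hreg
  have hmono := integral_mono (C.integrable_potential hz i (by omega : 1 ≤ t + 1) u)
    (hi5.add (((hi2.add hi3).add (hi4.const_mul (θ - 1))).const_mul (η t)))
    (C.potential_succ_le hε i hρ ht hη hs1 hs2 hθ hu)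
  have hsum : ∫ ω, (potential h p κ η x i u t ω
      + η t * (κ * bregman (p i) u (x i t ω)
        + (inner ℝ (gradEst 𝒢 δ z x A i t ω) (u - x i t ω) + 𝒢.c i (played δ z x A t ω))
        + (θ - 1) * 𝒢.c i (played δ z x A t ω))) ∂P
      = ∫ ω, potential h p κ η x i u t ω ∂P
        + η t * (∫ ω, κ * bregman (p i) u (x i t ω) ∂P
          + ∫ ω, (inner ℝ (gradEst 𝒢 δ z x A i t ω) (u - x i t ω)
            + 𝒢.c i (played δ z x A t ω)) ∂P
          + (θ - 1) * ∫ ω, 𝒢.c i (played δ z x A t ω) ∂P) := by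
    have e1 := integral_add hi5 (((hi2.add hi3).add (hi4.const_mul (θ - 1))).const_mul (η t))
    have e2 := integral_add (hi2.add hi3) (hi4.const_mul (θ - 1))
    have e3 := integral_add hi2 hi3
    rw [integral_const_mul] at e1 e2
    simp only [Pi.add_apply] at e1 e2 e3
    rw [e1, e2, e3]
  refine hmono.trans (hsum.le.trans ?_)
  have := mul_le_mul_of_nonneg_left (hreg.trans (add_le_add le_rfl he)) (C.η_nonneg t)
  linarith

/-- The social cost of a round, in expectation, is controlled by the decrease of the potentials. -/
theorem integral_SW_le (hz : IsUniformSampling P z) {C₁ C₂ β θ e : ℝ} {x' : Fin n → Act d}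
    (hsm : ∀ y ∈ 𝒢.profiles,
      ∑ i, 𝒢.c i (Function.update y i (x' i)) ≤ C₁ * 𝒢.OPT + C₂ * 𝒢.SW y)
    {u : Fin n → Act d} (hu : ∀ i, u i ∈ 𝒢.X i)
    (hβ : ∀ i, ∀ y ∈ 𝒢.profiles,
      𝒢.c i (Function.update y i (u i)) ≤ 𝒢.c i (Function.update y i (x' i)) + β)
    {t : ℕ} (ht : 1 ≤ t)
    (hround : ∀ i, ∫ ω, potential h p κ η x i (u i) (t + 1) ω ∂P
      ≤ ∫ ω, potential h p κ η x i (u i) t ω ∂P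
      + η t * (∫ ω, 𝒢.c i (Function.update (played δ z x A t ω) i (u i)) ∂P + e
        + (θ - 1) * ∫ ω, 𝒢.c i (played δ z x A t ω) ∂P)) :
    η t * (1 - C₂ - θ) * ∫ ω, 𝒢.SW (played δ z x A t ω) ∂P
      ≤ ∑ i, ∫ ω, potential h p κ η x i (u i) t ω ∂P
        - ∑ i, ∫ ω, potential h p κ η x i (u i) (t + 1) ω ∂P
        + η t * (C₁ * 𝒢.OPT + n * β + n * e) := by
  have hi1 := fun i => (C.integrable_update_cost_sub hz i ht (hu i)).1
  have hi2 := fun i => C.integrable_cost_played hz i ht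
  have hSW : ∫ ω, 𝒢.SW (played δ z x A t ω) ∂P = ∑ i, ∫ ω, 𝒢.c i (played δ z x A t ω) ∂P :=
    integral_finsetSum _ fun i _ => hi2 i
  have hiSW : Integrable (fun ω => 𝒢.SW (played δ z x A t ω)) P :=
    integrable_finsetSum _ fun i _ => hi2 i
  have hupd : ∑ i, ∫ ω, 𝒢.c i (Function.update (played δ z x A t ω) i (u i)) ∂P
      ≤ C₁ * 𝒢.OPT + n * β + C₂ * ∫ ω, 𝒢.SW (played δ z x A t ω) ∂P := by
    rw [← integral_finsetSum _ fun i _ => hi1 i]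
    have hm : ∫ ω, ∑ i, 𝒢.c i (Function.update (played δ z x A t ω) i (u i)) ∂P
        ≤ ∫ ω, ((C₁ * 𝒢.OPT + n * β) + C₂ * 𝒢.SW (played δ z x A t ω)) ∂P := by
      refine integral_mono (integrable_finsetSum _ fun i _ => hi1 i)
        ((integrable_const _).add (hiSW.const_mul _)) fun ω => ?_
      have h1 := hsm _ (C.played_mem ht ω)
      have h2 := Finset.sum_le_sum fun i (_ : i ∈ Finset.univ) => hβ i _ (C.played_mem ht ω)
      rw [Finset.sum_add_distrib] at h2
      simp only [Finset.sum_const, Finset.card_univ, Fintype.card_fin, nsmul_eq_mul] at h2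
      change ∑ i, 𝒢.c i (Function.update (played δ z x A t ω) i (u i)) ≤ _
      linarith
    rw [integral_add (integrable_const _) (hiSW.const_mul _), integral_const_mul] at hm
    simpa using hm
  have hsum := Finset.sum_le_sum fun i (_ : i ∈ Finset.univ) => hround i
  rw [Finset.sum_add_distrib, ← Finset.mul_sum, Finset.sum_add_distrib, Finset.sum_add_distrib,
    ← Finset.mul_sum, ← hSW] at hsum
  simp only [Finset.sum_const, Finset.card_univ, Fintype.card_fin, nsmul_eq_mul] at hsum
  have := mul_le_mul_of_nonneg_left hupd (C.η_nonneg t)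
  linarith

end RunContext

/-! ### Sums of the step sizes and the averaging argument. -/

section RealSums
open Filter Topology

theorem sum_inv_rpow_three_quarters_le (T : ℕ) :
    ∑ t ∈ Finset.Icc 1 T, 1 / (t : ℝ) ^ (3 / 4 : ℝ) ≤ 4 * (T : ℝ) ^ (1 / 4 : ℝ) := by
  induction T with
  | zero => simp
  | succ T ih =>
    rw [Finset.sum_Icc_succ_top (by omega)]
    have hpow : ∀ s : ℝ, 0 ≤ s → (s ^ (1 / 4 : ℝ)) ^ 4 = s ∧ s ^ (3 / 4 : ℝ) = (s ^ (1 / 4 : ℝ)) ^ 3 :=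
      fun s hs => by
        constructor
        · rw [← Real.rpow_natCast, ← Real.rpow_mul hs]; norm_num
        · rw [← Real.rpow_natCast, ← Real.rpow_mul hs]; norm_num
    obtain ⟨ha, ha3⟩ := hpow ((T + 1 : ℕ) : ℝ) (by positivity)
    obtain ⟨hb, -⟩ := hpow (T : ℝ) (by positivity)
    have ha0 : 0 < ((T + 1 : ℕ) : ℝ) ^ (1 / 4 : ℝ) := by positivity
    have hb0 : 0 ≤ (T : ℝ) ^ (1 / 4 : ℝ) := by positivity
    have hab : (T : ℝ) ^ (1 / 4 : ℝ) ≤ ((T + 1 : ℕ) : ℝ) ^ (1 / 4 : ℝ) :=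
      Real.rpow_le_rpow (by positivity) (by push_cast; linarith) (by norm_num)
    rw [ha3]
    set a := ((T + 1 : ℕ) : ℝ) ^ (1 / 4 : ℝ)
    set b := (T : ℝ) ^ (1 / 4 : ℝ)
    have h1 : a ^ 4 - b ^ 4 = 1 := by rw [ha, hb]; push_cast; ring
    -- Telescoping: 1 = a⁴ - b⁴ = (a - b)(a³ + a²b + ab² + b³) ≤ 4a³(a - b).
    have h2 : 1 / a ^ 3 ≤ 4 * a - 4 * b := by
      rw [div_le_iff₀ (by positivity)]
      have e1 : b ^ 3 ≤ a ^ 3 := pow_le_pow_left₀ hb0 hab 3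
      have e2 : a * b ^ 2 ≤ a * a ^ 2 := by gcongr
      have e3 : a ^ 2 * b ≤ a ^ 2 * a := by gcongr
      have := mul_nonneg (sub_nonneg.2 hab)
        (by linarith : 0 ≤ 4 * a ^ 3 - (a ^ 3 + a ^ 2 * b + a * b ^ 2 + b ^ 3))
      linarith
    linarith

theorem sum_inv_le_one_add_log (T : ℕ) :
    ∑ t ∈ Finset.Icc 1 T, 1 / (t : ℝ) ≤ 1 + Real.log T := by
  have := harmonic_le_one_add_log T
  rw [harmonic_eq_sum_Icc] at this
  push_cast at this
  simpa using this

theorem sum_Ico_sub_succ (V : ℕ → ℝ) {a b : ℕ} (hab : a ≤ b) :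
    ∑ t ∈ Finset.Ico a b, (V t - V (t + 1)) = V a - V b := by
  induction b, hab using Nat.le_induction with
  | base => simp
  | succ b hb ih => rw [Finset.sum_Ico_succ_top hb, ih]; ring

/-- From a potential recursion with the learning rates `1 / (2 d t ^ (3/4))` to averages. -/
theorem exists_average_le {S η δ : ℕ → ℝ} {α D N ν d M : ℝ} {t₀ : ℕ} (hα : 0 < α) (hD : 0 ≤ D)
    (hN : 1 ≤ N) (hν : 0 < ν) (hd : 1 ≤ d) (ht₀ : 1 ≤ t₀)
    (hη : ∀ t : ℕ, η t = 1 / (2 * d * (t : ℝ) ^ (3 / 4 : ℝ)))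
    (hδ : ∀ t : ℕ, δ t = 1 / (t : ℝ) ^ (1 / 4 : ℝ))
    (hS0 : ∀ t ≥ 1, 0 ≤ S t) (hSN : ∀ t ≥ 1, S t ≤ N) :
    ∃ T₀ : ℕ, ∀ T ≥ T₀, ∀ V : ℕ → ℝ, (∀ t ≥ t₀, 0 ≤ V t) →
      V t₀ ≤ N * ν * Real.log T + M →
      (∀ t ≥ t₀, η t * (α / 2) * S t ≤ V t - V (t + 1)
        + η t * (D + N * (1 / (T : ℝ)) + N * (ν * δ t))) →
      (1 / (T : ℝ)) * ∑ t ∈ Finset.Icc 1 T, S t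
        ≤ 8 * (D / α + N * ν * d * Real.log T / (α * (T : ℝ) ^ (1 / 4 : ℝ))) := by
  -- Collects every contribution without log T, including the rounds before t₀. The threshold
  -- depends on none of the potentials `V`, which may therefore change with T.
  set K := 4 * d * M + 2 * N * ν + 8 * N + α * t₀ * N with hK
  have hlog : ∀ᶠ T : ℕ in atTop, K / (2 * d * N * ν) ≤ Real.log T :=
    (Real.tendsto_log_atTop.comp tendsto_natCast_atTop_atTop).eventually_ge_atTop _
  obtain ⟨T₁, hT₁⟩ := eventually_atTop.1 hlog
  refine ⟨max T₁ t₀, fun T hT V hV0 hV hrec => ?_⟩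
  have hL := hT₁ T (le_of_max_le_left hT)
  have htT : t₀ ≤ T := le_of_max_le_right hT
  have hT1 : 1 ≤ T := ht₀.trans htT
  have hTr : (1 : ℝ) ≤ T := by exact_mod_cast hT1
  rw [div_le_iff₀ (by positivity)] at hL
  set L := Real.log T
  have hL0 : 0 ≤ L := Real.log_nonneg hTr
  set r := (T : ℝ) ^ (1 / 4 : ℝ) with hr
  have hr1 : 1 ≤ r := Real.one_le_rpow hTr (by norm_num)
  have hr4 : r ^ 4 = T := by rw [hr, ← Real.rpow_natCast, ← Real.rpow_mul (by positivity)]; norm_num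
  have hr3 : (T : ℝ) ^ (3 / 4 : ℝ) = r ^ 3 := by
    rw [hr, ← Real.rpow_natCast, ← Real.rpow_mul (by positivity)]; norm_num
  have hηnn : ∀ t, 0 ≤ η t := fun t => by rw [hη]; positivity
  have hsub : Finset.Ico t₀ (T + 1) ⊆ Finset.Icc 1 T := fun t ht => by
    simp only [Finset.mem_Ico, Finset.mem_Icc] at *; omega
  have hsumη : ∑ t ∈ Finset.Ico t₀ (T + 1), η t ≤ 2 / d * r := by
    calc _ ≤ ∑ t ∈ Finset.Icc 1 T, η t :=
          Finset.sum_le_sum_of_subset_of_nonneg hsub fun t _ _ => hηnn t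
      _ = 1 / (2 * d) * ∑ t ∈ Finset.Icc 1 T, 1 / (t : ℝ) ^ (3 / 4 : ℝ) := by
          rw [Finset.mul_sum]
          exact Finset.sum_congr rfl fun t _ => by rw [hη, one_div_mul_one_div]
      _ ≤ 1 / (2 * d) * (4 * r) := by gcongr; exact sum_inv_rpow_three_quarters_le T
      _ = 2 / d * r := by field_simp; norm_num
  have hsumηδ : ∑ t ∈ Finset.Ico t₀ (T + 1), η t * δ t ≤ 1 / (2 * d) * (1 + L) := by
    calc _ ≤ ∑ t ∈ Finset.Icc 1 T, η t * δ t :=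
          Finset.sum_le_sum_of_subset_of_nonneg hsub fun t _ _ =>
            mul_nonneg (hηnn t) (by rw [hδ]; positivity)
      _ = 1 / (2 * d) * ∑ t ∈ Finset.Icc 1 T, 1 / (t : ℝ) := by
          rw [Finset.mul_sum]
          refine Finset.sum_congr rfl fun t ht => ?_
          have ht0 : (0 : ℝ) < t := by exact_mod_cast (Finset.mem_Icc.1 ht).1
          rw [hη, hδ, one_div_mul_one_div, one_div_mul_one_div, mul_assoc (2 * d),
            ← Real.rpow_add ht0]
          norm_num
      _ ≤ _ := by gcongr; exact sum_inv_le_one_add_log T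
  set tail := ∑ t ∈ Finset.Ico t₀ (T + 1), S t with htail_def
  have htail : η T * (α / 2) * tail ≤ N * ν * L + M + (D + N * (1 / (T : ℝ))) * (2 / d * r)
      + N * ν * (1 / (2 * d) * (1 + L)) := by
    calc η T * (α / 2) * tail ≤ ∑ t ∈ Finset.Ico t₀ (T + 1), η t * (α / 2) * S t := by
          rw [htail_def, Finset.mul_sum]
          refine Finset.sum_le_sum fun t ht => ?_
          have ht' := Finset.mem_Ico.1 ht
          have ht1 : 1 ≤ t := ht₀.trans ht'.1
          have ht0 : (0 : ℝ) < t := by exact_mod_cast ht1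
          have hS := hS0 t ht1
          have : η T ≤ η t := by
            rw [hη, hη]
            have : (t : ℝ) ≤ T := by exact_mod_cast Nat.lt_succ_iff.1 ht'.2
            gcongr
          gcongr
      _ ≤ ∑ t ∈ Finset.Ico t₀ (T + 1), ((V t - V (t + 1))
            + ((D + N * (1 / (T : ℝ))) * η t + N * ν * (η t * δ t))) := by
          refine Finset.sum_le_sum fun t ht => (hrec t (Finset.mem_Ico.1 ht).1).trans_eq ?_
          ring
      _ = V t₀ - V (T + 1) + ((D + N * (1 / (T : ℝ))) * ∑ t ∈ Finset.Ico t₀ (T + 1), η t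
            + N * ν * ∑ t ∈ Finset.Ico t₀ (T + 1), η t * δ t) := by
          rw [Finset.sum_add_distrib, Finset.sum_add_distrib, sum_Ico_sub_succ V (by omega),
            ← Finset.mul_sum, ← Finset.mul_sum]
      _ ≤ V t₀ - V (T + 1) + ((D + N * (1 / (T : ℝ))) * (2 / d * r)
            + N * ν * (1 / (2 * d) * (1 + L))) := by gcongr
      _ ≤ _ := by
          have := hV0 (T + 1) (by omega)
          linarith
  have hhead : ∑ t ∈ Finset.Ico 1 t₀, S t ≤ t₀ * N := by
    calc _ ≤ ∑ t ∈ Finset.Ico 1 t₀, N :=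
          Finset.sum_le_sum fun t ht => hSN t (Finset.mem_Ico.1 ht).1
      _ = ((t₀ - 1 : ℕ) : ℝ) * N := by simp
      _ ≤ _ := by gcongr; omega
  have hsplit : ∑ t ∈ Finset.Icc 1 T, S t = ∑ t ∈ Finset.Ico 1 t₀, S t + tail := by
    rw [htail_def, Finset.sum_Ico_consecutive _ ht₀ (by omega)]; rfl
  have hηT : η T = 1 / (2 * d * r ^ 3) := by rw [hη, hr3]
  rw [hηT, ← hr4] at htail
  rw [hsplit, ← hr4]
  have hr0 : 0 < r := by linarith
  have hd0 : 0 < d := by linarith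
  -- Multiplication by 4 d r³ = 2/η_T.
  have htail_mul : α * tail ≤ 4 * d * r ^ 3 * (N * ν * L + M) + 8 * r ^ 4 * D + 8 * N
      + 2 * N * ν * r ^ 3 * (1 + L) := by
    have := mul_le_mul_of_nonneg_left htail (by positivity : 0 ≤ 4 * d * r ^ 3)
    have e1 : 4 * d * r ^ 3 * (1 / (2 * d * r ^ 3) * (α / 2) * tail) = α * tail := by
      field_simp; norm_num
    have e2 : 4 * d * r ^ 3 * (N * ν * L + M + (D + N * (1 / r ^ 4)) * (2 / d * r)
        + N * ν * (1 / (2 * d) * (1 + L))) = 4 * d * r ^ 3 * (N * ν * L + M) + 8 * r ^ 4 * D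
        + 8 * N + 2 * N * ν * r ^ 3 * (1 + L) := by
      field_simp; ring
    linarith
  -- Of the eight units of Nνd log T, four pay for the initial potential, two for the errors νδ_t
  -- (using d ≥ 1), and two for `K`.
  have hfin : α * (∑ t ∈ Finset.Ico 1 t₀, S t + tail)
      ≤ 8 * r ^ 4 * D + 8 * r ^ 3 * (N * ν * d * L) := by
    have e1 : (1 : ℝ) ≤ r ^ 3 := one_le_pow₀ hr1
    have e2 : α * ∑ t ∈ Finset.Ico 1 t₀, S t ≤ α * (t₀ * N) * r ^ 3 :=
      (mul_le_mul_of_nonneg_left hhead hα.le).trans (le_mul_of_one_le_right (by positivity) e1)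
    have e3 : 8 * N ≤ 8 * N * r ^ 3 := le_mul_of_one_le_right (by positivity) e1
    have e4 : K * r ^ 3 ≤ L * (2 * d * N * ν) * r ^ 3 := by gcongr
    have e5 : 2 * N * ν * r ^ 3 * L ≤ 2 * N * ν * r ^ 3 * L * d :=
      le_mul_of_one_le_right (by positivity) hd
    rw [hK] at e4
    linarith
  have e : 8 * (D / α + N * ν * d * L / (α * r))
      = (1 / (α * r ^ 4)) * (8 * r ^ 4 * D + 8 * r ^ 3 * (N * ν * d * L)) := by
    field_simp
  rw [e]
  calc 1 / r ^ 4 * (∑ t ∈ Finset.Ico 1 t₀, S t + tail)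
      = 1 / (α * r ^ 4) * (α * (∑ t ∈ Finset.Ico 1 t₀, S t + tail)) := by field_simp
    _ ≤ _ := by gcongr

end RealSums

/-! ### Comparators and the prescribed schedules. -/

namespace RunContext
open Set Filter Topology

variable {n d : ℕ} {Ω : Type*} {𝒢 : Game n d} {B G : ℝ} {ℓ : Fin n → ℝ} {ν κ μ ζ Cp : ℝ}
  {h p : Fin n → Act d → ℝ} {η δ : ℕ → ℝ} {z : Fin n → ℕ → Ω → Sph d}
  {x : Fin n → ℕ → Ω → Act d} {A : Fin n → ℕ → Ω → Act d →L[ℝ] Act d}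
  (C : RunContext 𝒢 B G ℓ ν κ μ ζ Cp h p η δ z x A)
include C

/-- Moving the target action slightly into the interior costs little and keeps the barrier
logarithmic. -/
theorem exists_comparator (i : Fin n) (hν : 0 < ν) {y₀ y₁ : Act d} (hy₀ : y₀ ∈ interior (𝒢.X i))
    (hy₁ : y₁ ∈ 𝒢.X i) {T : ℕ} (hT : 1 ≤ T) :
    ∃ u ∈ interior (𝒢.X i), h i u ≤ h i y₀ + ν * Real.log T ∧
      ∀ y ∈ 𝒢.profiles, 𝒢.c i (Function.update y i u)
        ≤ 𝒢.c i (Function.update y i y₁) + 1 / (T : ℝ) := by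
  have hTr : (1 : ℝ) ≤ T := by exact_mod_cast hT
  set a : ℝ := 1 / T with ha
  have ha0 : 0 < a := by positivity
  have ha1 : a ≤ 1 := by rw [ha, div_le_one (by positivity)]; exact hTr
  have hu : y₀ + (1 - a) • (y₁ - y₀) = a • y₀ + (1 - a) • y₁ := by module
  refine ⟨y₀ + (1 - a) • (y₁ - y₀), ?_, ?_, fun y hy => ?_⟩
  · rw [hu]
    exact (C.game.convex_set i).combo_interior_self_mem_interior hy₀ hy₁ ha0 (by linarith) (by ring)
  · have := (C.barrier i).le_add_log (C.game.convex_set i) hν hy₀ hy₁ (s := 1 - a) (by linarith)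
      (by linarith)
    rw [sub_sub_cancel, ha, one_div, Real.log_inv] at this
    rw [ha, one_div]
    linarith
  · have hmem : ∀ b ∈ 𝒢.X i, Function.update y i b ∈ 𝒢.profiles := fun b hb j => by
      by_cases hj : j = i
      · subst hj; simpa using hb
      · simpa [hj] using hy j
    have h1 := (C.game.convex i y hy).2 (interior_subset hy₀) hy₁ ha0.le
      (by linarith : 0 ≤ 1 - a) (by ring)
    simp only [Game.ownCost, smul_eq_mul] at h1
    rw [hu]
    have h2 := (C.game.range i _ (hmem _ (interior_subset hy₀))).2
    have h3 := (C.game.range i _ (hmem _ hy₁)).1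
    nlinarith

/-- With the prescribed schedules, every late round of a player has small error. -/
theorem eventually_integral_potential_succ_le [MeasurableSpace Ω] {P : Measure Ω}
    [IsProbabilityMeasure P] (hz : IsUniformSampling P z)
    (hη : ∀ t : ℕ, η t = 1 / (2 * (d : ℝ) * (t : ℝ) ^ (3 / 4 : ℝ)))
    (hδ : ∀ t : ℕ, δ t = 1 / (t : ℝ) ^ (1 / 4 : ℝ)) {θ : ℝ} (hθ : 0 < θ) (hν : 0 < ν)
    (i : Fin n) :
    ∀ᶠ t in atTop, ∀ u ∈ 𝒢.X i,
      ∫ ω, potential h p κ η x i u (t + 1) ω ∂P ≤ ∫ ω, potential h p κ η x i u t ω ∂P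
        + η t * (∫ ω, 𝒢.c i (Function.update (played δ z x A t ω) i u) ∂P + ν * δ t
          + (θ - 1) * ∫ ω, 𝒢.c i (played δ z x A t ω) ∂P) := by
  have hB := C.diameter_pos i
  have hκ := C.reg.κ_pos
  have hζ := C.reg.ζ_pos
  have hd : (1 : ℝ) ≤ d := by exact_mod_cast C.dim_pos
  -- Since τ grows like t^(1/4)/d, the product d δ_t τ does not vanish, so the Hessian oscillation
  -- itself must be small: the first entry caps its share of the noise at θ/2, the second its share
  -- of the bias at νδ_t/2.
  set ε := min (θ / (2 * B ^ 2)) (ν / (2 * κ * B ^ 2)) with hε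
  have hε0 : 0 < ε := lt_min (by positivity) (by positivity)
  have hε1 : ε * B ^ 2 ≤ θ / 2 := by
    have := min_le_left (θ / (2 * B ^ 2)) (ν / (2 * κ * B ^ 2))
    rw [← hε, le_div_iff₀ (by positivity)] at this
    linarith
  have hε2 : κ * ε * B ^ 2 ≤ ν / 2 := by
    have := min_le_right (θ / (2 * B ^ 2)) (ν / (2 * κ * B ^ 2))
    rw [← hε, le_div_iff₀ (by positivity)] at this
    linarith
  obtain ⟨ρ, hρ0, hρ⟩ := exists_hess_close (C.game.compact_set i) (C.reg.contDiffAt i) hε0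
  have hδlim : Tendsto δ atTop (𝓝 0) := by
    have h1 : Tendsto (fun t : ℕ => ((t : ℝ) ^ (1 / 4 : ℝ))⁻¹) atTop (𝓝 0) :=
      ((tendsto_rpow_atTop (by norm_num)).comp tendsto_natCast_atTop_atTop).inv_tendsto_atTop
    refine h1.congr fun t => ?_
    rw [hδ, one_div ((t : ℝ) ^ (1 / 4 : ℝ))]
  have hsmall : ∀ a b : ℝ, 0 < b → ∀ᶠ t in atTop, δ t * a < b := fun a b hb => by
    have := hδlim.mul_const a
    rw [zero_mul] at this
    exact this.eventually_lt_const hb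
  filter_upwards [eventually_ge_atTop 1, hsmall 1 1 one_pos, hsmall B ρ hρ0,
    hsmall (1 + ζ * B ^ 2) (1 / 8) (by norm_num), hsmall (8 * (1 + ζ * B ^ 2) * B) ρ hρ0,
    hsmall (d / 8 * (8 + 2 / κ)) (θ / 2) (by positivity),
    hsmall (2 * ℓ i * B ^ 2) (ν / 2) (by positivity)] with t ht e1 e2 e3 e4 e5 e6 u hu
  have htr : (1 : ℝ) ≤ t := by exact_mod_cast ht
  set r := (t : ℝ) ^ (1 / 4 : ℝ) with hr
  have hr1 : 1 ≤ r := Real.one_le_rpow htr (by norm_num)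
  have hr0 : 0 < r := by linarith
  have hr4 : (t : ℝ) = r ^ 4 := by
    rw [hr, ← Real.rpow_natCast, ← Real.rpow_mul (by positivity)]; norm_num
  have hr3 : (t : ℝ) ^ (3 / 4 : ℝ) = r ^ 3 := by
    rw [hr, ← Real.rpow_natCast, ← Real.rpow_mul (by positivity)]; norm_num
  have hδr : δ t = 1 / r := hδ t
  have hηr : η t = 1 / (2 * d * r ^ 3) := by rw [hη, hr3]
  have hδ0 : 0 < δ t := by rw [hδr]; positivity
  set τ := η t * ((t : ℝ) + 1) with hτ
  have hτ0 : 0 ≤ τ := C.rate_nonneg t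
  have hτd : τ * d ≤ r := by
    have : τ * d = (r ^ 4 + 1) / (2 * r ^ 3) := by rw [hτ, hηr, hr4]; field_simp
    rw [this, div_le_iff₀ (by positivity)]
    have := one_le_pow₀ hr1 (n := 4)
    linarith
  have hτr : τ ≤ r := (le_mul_of_one_le_right hτ0 hd).trans hτd
  have hγ : η t * (d / δ t) = 1 / (2 * r ^ 2) := by rw [hηr, hδr]; field_simp
  have hs : η t * (d / δ t) * Real.sqrt (1 + τ * ζ * B ^ 2) ≤ δ t * (1 + ζ * B ^ 2) := by
    have h1 : Real.sqrt (1 + τ * ζ * B ^ 2) ≤ 1 + τ * ζ * B ^ 2 := by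
      rw [Real.sqrt_le_left (by positivity)]
      have : 0 ≤ τ * ζ * B ^ 2 := by positivity
      nlinarith
    have h2 : 1 + τ * ζ * B ^ 2 ≤ r * (1 + ζ * B ^ 2) := by
      have : τ * ζ * B ^ 2 ≤ r * ζ * B ^ 2 := by gcongr
      linarith
    rw [hγ, hδr]
    calc 1 / (2 * r ^ 2) * Real.sqrt (1 + τ * ζ * B ^ 2)
        ≤ 1 / r ^ 2 * (r * (1 + ζ * B ^ 2)) := by
          gcongr
          · linarith [sq_nonneg r]
          · exact h1.trans h2
      _ = _ := by field_simp
  refine C.integral_potential_succ_le hz hε0.le i hρ ht ?_ (hs.trans_lt e3) ?_ ?_ (by linarith) e2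
    ?_ hu
  · rw [hη, hη]
    push_cast
    gcongr
    linarith
  · refine lt_of_le_of_lt ?_ e4
    calc 8 * (η t * (d / δ t) * Real.sqrt (1 + τ * ζ * B ^ 2)) * B
        ≤ 8 * (δ t * (1 + ζ * B ^ 2)) * B := by gcongr
      _ = _ := by ring
  · have h1 : η t * (d / δ t) ^ 2 = d * δ t / 2 := by rw [hηr, hδr]; field_simp
    have h2 : δ t * (τ * d) ≤ 1 := by
      rw [hδr, one_div_mul_eq_div, div_le_one hr0]; exact hτd
    have h3 : δ t * (τ * d) * (ε * B ^ 2) ≤ 1 * (ε * B ^ 2) := by gcongr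
    rw [h1]
    linarith
  · have := mul_le_mul_of_nonneg_left e6.le hδ0.le
    have := mul_le_mul_of_nonneg_left hε2 hδ0.le
    linarith

end RunContext

end

/-! ### Assembly. -/

theorem mainTheorem4 :
    ∃ K : ℝ, 0 < K ∧
      ∀ (n d : ℕ), 1 ≤ d →
      ∀ (𝒢 : Game n d) (B G : ℝ) (ℓ : Fin n → ℝ), 𝒢.IsMonotoneGame B G ℓ →
      ∀ (C₁ C₂ : ℝ), 𝒢.IsSmoothGame C₁ C₂ →
      ∀ (ν κ μ ζ Cp : ℝ) (h p : Fin n → Act d → ℝ),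
        (∀ i, IsSelfConcordantBarrier ν (𝒢.X i) (h i)) →
        IsRegularizer 𝒢 κ μ ζ Cp p →
      ∀ (η δ : ℕ → ℝ),
        (∀ t : ℕ, η t = 1 / (2 * (d : ℝ) * (t : ℝ) ^ (3 / 4 : ℝ))) →
        (∀ t : ℕ, δ t = 1 / (t : ℝ) ^ (1 / 4 : ℝ)) →
      ∀ (Ω : Type*) [MeasurableSpace Ω] (P : Measure Ω) [IsProbabilityMeasure P]
        (z : Fin n → ℕ → Ω → Sph d) (x : Fin n → ℕ → Ω → Act d)
        (A : Fin n → ℕ → Ω → Act d →L[ℝ] Act d),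
        IsUniformSampling P z →
        IsAlgorithmRun 𝒢 h p κ η δ z x A →
        (∀ t : ℕ, 1 ≤ t → Integrable (fun ω => 𝒢.SW (played δ z x A t ω)) P) ∧
        ∃ T₀ : ℕ, ∀ T : ℕ, T₀ ≤ T →
          (1 / (T : ℝ)) * ∑ t ∈ Finset.Icc 1 T, ∫ ω, 𝒢.SW (played δ z x A t ω) ∂P
            ≤ K * (C₁ * 𝒢.OPT / (1 - C₂)
                + (n : ℝ) * ν * (d : ℝ) * Real.log T / ((1 - C₂) * (T : ℝ) ^ (1 / 4 : ℝ))
                + Real.sqrt n * B * (∑ i, ℓ i) / ((1 - C₂) * (T : ℝ) ^ (1 / 4 : ℝ))) := by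
  refine ⟨8, by norm_num, ?_⟩
  intro n d hd 𝒢 B G ℓ hG C₁ C₂ hsmooth ν κ μ ζ Cp h p hh hp η δ hη hδ Ω _ P _ z x A hz hrun
  obtain ⟨hC₁, hC₂, x', hx', hsm⟩ := hsmooth
  have C : RunContext 𝒢 B G ℓ ν κ μ ζ Cp h p η δ z x A :=
    { dim_pos := hd
      game := hG
      barrier := hh
      reg := hp
      η_nonneg := fun t => by rw [hη]; positivity
      δ_pos := fun t ht => by
        have : (0 : ℝ) < t := by exact_mod_cast ht
        rw [hδ]; positivity
      δ_le_one := fun t ht => by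
        rw [hδ]
        exact div_le_one_of_le₀ (Real.one_le_rpow (by exact_mod_cast ht) (by norm_num))
          (by positivity)
      run := hrun }
  have hi := fun (i : Fin n) (t : ℕ) (ht : 1 ≤ t) => C.integrable_cost_played hz i ht
  refine ⟨fun t ht => integrable_finsetSum _ fun i _ => hi i t ht, ?_⟩
  have hα : 0 < 1 - C₂ := sub_pos.2 hC₂
  have hSW : ∀ y ∈ 𝒢.profiles, 0 ≤ 𝒢.SW y ∧ 𝒢.SW y ≤ n := fun y hy =>
    ⟨Finset.sum_nonneg fun i _ => (hG.range i y hy).1, by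
      simpa [Game.SW] using Finset.sum_le_sum fun i (_ : i ∈ Finset.univ) => (hG.range i y hy).2⟩
  have hOPT : 0 ≤ 𝒢.OPT := Real.sInf_nonneg (by rintro _ ⟨y, hy, rfl⟩; exact (hSW y hy).1)
  have hD : 0 ≤ C₁ * 𝒢.OPT := mul_nonneg hC₁.le hOPT
  -- Without players nothing forces B or ν to be positive, but the social cost is then zero.
  rcases Nat.eq_zero_or_pos n with rfl | hn
  · refine ⟨0, fun T _ => ?_⟩
    have : 0 ≤ C₁ * 𝒢.OPT / (1 - C₂) := div_nonneg hD hα.le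
    simpa [Game.SW] using this
  have i₀ : Fin n := ⟨0, hn⟩
  have hB := C.diameter_pos i₀
  have hν := (hh i₀).nu_pos (hG.convex_set i₀) (hG.compact_set i₀) hd (hG.nonempty_interior i₀)
  have hℓ : 0 ≤ ∑ i, ℓ i := Finset.sum_nonneg fun i _ => C.smooth_nonneg i hx'
  -- Taking θ = (1 - C₂)/2 leaves half of 1 - C₂ on the left after absorption.
  obtain ⟨t₁, ht₁⟩ := Filter.eventually_atTop.1 (Filter.eventually_all.2 fun i =>
    C.eventually_integral_potential_succ_le hz hη hδ (half_pos hα) hν i)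
  set t₀ := max t₁ 1
  have ht₀ : 1 ≤ t₀ := le_max_right _ _
  obtain ⟨ω₀⟩ : Nonempty Ω := P.nonempty_of_neZero
  choose M hM using fun i => C.exists_potential_le i ht₀
  obtain ⟨T₀, hT₀⟩ := exists_average_le (S := fun t => ∫ ω, 𝒢.SW (played δ z x A t ω) ∂P)
    (M := ∑ i, (h i (x i 1 ω₀) + M i)) hα hD (Nat.one_le_cast.2 hn) hν (Nat.one_le_cast.2 hd)
    ht₀ hη hδ (fun t ht => integral_nonneg fun ω => (hSW _ (C.played_mem ht ω)).1)
    (fun t ht => by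
      have := integral_mono (integrable_finsetSum _ fun i _ => hi i t ht)
        (integrable_const (μ := P) (n : ℝ)) fun ω => (hSW _ (C.played_mem ht ω)).2
      simpa [Game.SW] using this)
  refine ⟨max T₀ 1, fun T hT => ?_⟩
  have hT1 : 1 ≤ T := le_of_max_le_right hT
  -- The base point is the initial iterate at an arbitrary ω₀; only its being interior matters.
  choose u huint hulog hucost using fun i =>
    C.exists_comparator i hν (hrun.init_mem i ω₀) (hx' i) hT1
  have huX := fun i => interior_subset (huint i)
  have key := hT₀ T (le_of_max_le_left hT)
    (fun t => ∑ i, ∫ ω, RunContext.potential h p κ η x i (u i) t ω ∂P)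
    (fun t ht => Finset.sum_nonneg fun i _ => integral_nonneg fun ω =>
      C.potential_nonneg i (ht₀.trans ht) (huint i) ω)
    (by
      have hbound : ∀ i, ∫ ω, RunContext.potential h p κ η x i (u i) t₀ ω ∂P
          ≤ ν * Real.log T + (h i (x i 1 ω₀) + M i) := fun i => by
        have := integral_mono (C.integrable_potential hz i ht₀ (u i))
          (integrable_const (μ := P) (ν * Real.log T + (h i (x i 1 ω₀) + M i))) fun ω => by
            have h1 := hM i (u i) (huX i) ω
            have h2 := hulog i
            change RunContext.potential h p κ η x i (u i) t₀ ω ≤ _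
            linarith
        simpa using this
      have := Finset.sum_le_sum fun i (_ : i ∈ Finset.univ) => hbound i
      rw [Finset.sum_add_distrib] at this
      simpa [mul_assoc] using this)
    (fun t ht => by
      have := C.integral_SW_le hz hsm huX hucost (ht₀.trans ht)
        fun i => ht₁ t ((le_max_left _ _).trans ht) i (u i) (huX i)
      rwa [show 1 - C₂ - (1 - C₂) / 2 = (1 - C₂) / 2 by ring] at this)
  -- The smoothness bias was already absorbed into nνδ_t, so the third term of the bound enters only
  -- through its sign.
  refine key.trans (mul_le_mul_of_nonneg_left (le_add_of_nonneg_right ?_) (by norm_num))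
  positivity
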